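/- **Theorem.** For $N\in\mathbb N$ let $\hat U(N)$ be the set of signatures, i.e. $N$-tuples of integers $\lambda_1\ge\lambda_2\ge\dots\ge\lambda_N$. For $\lambda\in\hat U(N)$ let $$\chi^\lambda(u_1,\dots,u_N)=\frac{\det\big(u_i^{\lambda_j+N-j}\big)_{i,j=1}^N}{\prod_{i<j}(u_i-u_j)}$$ be the rational Schur function (a symmetric Laurent polynomial, hence also defined when some of the $u_i$ coincide). For a probability measure $\varrho$ on $\hat U(N)$ let $$S_\varrho^{U(N)}(u_1,\dots,u_N)=\sum_{\lambda\in\hat U(N)}\varrho(\lambda)\,\frac{\chi^\lambda(u_1,\dots,u_N)}{\chi^\lambda(1^N)},\qquad 1^N=(1,\dots,1),$$ be its Schur generating function. Let $\varrho(N)$, $N=1,2,\dots$, be probability measures on $\hat U(N)$ and let $\Psi,\Phi$ be complex functions, analytic in a complex neighborhood of $1$. Assume that for every finite $r$ there is a connected open complex neighborhood $U_r$ of $1^r$ such that, for all sufficiently large $N$, the series $S^{U(N)}_{\varrho(N)}(u_1,\dots,u_r,1^{N-r})$ converges absolutely on $U_r$ and has there a continuous logarithm $\log S^{U(N)}_{\varrho(N)}$,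 normalized to be $0$ at $1^r$, and that $$\lim_{N\to\infty}N\left(\frac1N\log S^{U(N)}_{\varrho(N)}(u_1,\dots,u_r,1^{N-r})-\sum_{i=1}^r\Psi(u_i)\right)=\sum_{i=1}^r\Phi(u_i)$$ uniformly on $U_r$. Then for every integer $k\ge 0$ the sum over $\lambda$ below converges absolutely for all sufficiently large $N$, and $$\lim_{N\to\infty}N\left(\frac1N\sum_{\lambda\in\hat U(N)}\varrho(N)[\lambda]\sum_{i=1}^N\left(\frac{\lambda_i+N-i}{N}\right)^k-\mathbf m_k\right)=\mathbf m'_k,$$ where $$\mathbf m_k=\sum_{m=0}^{k}\frac{k!}{m!\,(m+1)!\,(k-m)!}\,\frac{d^m}{dx^m}\Big(x^k(\Psi'(x))^{k-m}\Big)\Big|_{x=1},$$ $$\mathbf m'_k=\sum_{m=0}^{k-1}\frac{k!}{m!\,(m+1)!\,(k-m-1)!}\,\frac{d^m}{dx^m}\left(x^k\Big(\Phi'(x)-\frac1{2x}\Big)(\Psi'(x))^{k-m-1}\right)\Big|_{x=1}.$$ -/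

import Mathlib

open Filter Topology

noncomputable section

namespace SchurGF

/-- A signature of `U(N)`: a weakly decreasing `N`-tuple of integers. The index `j : Fin N` stands
for the one-based index `j + 1`. -/
def Signature (N : ℕ) : Type := {l : Fin N → ℤ // Antitone l}

instance (N : ℕ) : CoeFun (Signature N) (fun _ => Fin N → ℤ) := ⟨Subtype.val⟩

/-- The shifted coordinate `l_i + N - i` (one-based `i`, that is `i = j + 1`). -/
def Signature.coord {N : ℕ} (l : Signature N) (j : Fin N) : ℤ := l j + (N : ℤ) - ((j : ℤ) + 1)

/-- A natural number `s` such that all `l j + s` are nonnegative. -/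
def Signature.shift {N : ℕ} (l : Signature N) : ℕ := ∑ j, (l j).natAbs

/-- The number `l_j + N - j + s` (one-based `j`), which is nonnegative. -/
def Signature.exponent {N : ℕ} (l : Signature N) (j : Fin N) : ℕ := (l.coord j + l.shift).toNat

theorem Signature.exponent_cast {N : ℕ} (l : Signature N) (j : Fin N) :
    (l.exponent j : ℤ) = l.coord j + l.shift := by
  unfold Signature.exponent Signature.coord
  apply Int.toNat_of_nonneg
  have h1 : (l j).natAbs ≤ l.shift :=
    Finset.single_le_sum (f := fun j => (l j).natAbs) (fun _ _ => Nat.zero_le _)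
      (Finset.mem_univ j)
  have h2 := j.isLt
  omega

/-- The polynomial `∏_{i<j} (X_i - X_j)`. -/
def vandermondePoly (N : ℕ) : MvPolynomial (Fin N) ℂ :=
  ∏ i : Fin N, ∏ j ∈ Finset.Ioi i, (MvPolynomial.X i - MvPolynomial.X j)

/-- The polynomial `det (X_i ^ (l_j + N - j + s)) = (∏ X_i) ^ s * det (X_i ^ (l_j + N - j))`. -/
def alternantPoly {N : ℕ} (l : Signature N) : MvPolynomial (Fin N) ℂ :=
  Matrix.det (Matrix.of fun i j : Fin N =>
    (MvPolynomial.X i : MvPolynomial (Fin N) ℂ) ^ l.exponent j)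

theorem det_rev_vandermonde {R : Type*} [CommRing R] {N : ℕ} (x : Fin N → R) :
    Matrix.det (Matrix.of fun i j : Fin N => x i ^ (Fin.rev j : ℕ)) =
      ∏ i : Fin N, ∏ j ∈ Finset.Ioi i, (x i - x j) := by
  have h := Matrix.det_projVandermonde (1 : Fin N → R) x
  have e : Matrix.projVandermonde (1 : Fin N → R) x =
      Matrix.of fun i j : Fin N => x i ^ (Fin.rev j : ℕ) := by
    ext i j
    rw [Matrix.projVandermonde_apply]
    simp
  rw [e] at h
  simpa using h

theorem prod_sub_dvd_det_pow {R : Type*} [CommRing R] {N : ℕ} (x : Fin N → R) (a : Fin N → ℕ) :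
    (∏ i : Fin N, ∏ j ∈ Finset.Ioi i, (x i - x j)) ∣
      Matrix.det (Matrix.of fun i j : Fin N => x i ^ a j) := by
  nontriviality R
  let P : Polynomial R := ∏ i, (Polynomial.X - Polynomial.C (x i))
  have hP : P.Monic := Polynomial.monic_prod_of_monic _ _ fun i _ => Polynomial.monic_X_sub_C _
  have hdeg : P.natDegree = N := by
    simp [P, Polynomial.natDegree_prod_of_monic, Polynomial.monic_X_sub_C]
  let c : Matrix (Fin N) (Fin N) R :=
    Matrix.of fun m j => ((Polynomial.X ^ a j : Polynomial R) %ₘ P).coeff (Fin.rev m : ℕ)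
  have hfac : (Matrix.of fun i j : Fin N => x i ^ a j) =
      (Matrix.of fun i j : Fin N => x i ^ (Fin.rev j : ℕ)) * c := by
    ext i j
    have hroot : P.eval (x i) = 0 := by
      simp only [P, Polynomial.eval_prod]
      exact Finset.prod_eq_zero (Finset.mem_univ i) (by simp)
    have hN : 0 < N := i.pos
    have hlt : ((Polynomial.X ^ a j : Polynomial R) %ₘ P).natDegree < N := by
      rw [← hdeg]
      apply Polynomial.natDegree_modByMonic_lt _ hP
      intro h1
      rw [h1] at hdeg
      simp at hdeg
      omega
    have h1 := congrArg (Polynomial.eval (x i))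
      (Polynomial.modByMonic_add_div (Polynomial.X ^ a j : Polynomial R) P)
    rw [Polynomial.eval_add, Polynomial.eval_mul, hroot, zero_mul, add_zero,
      Polynomial.eval_eq_sum_range' hlt, Polynomial.eval_pow, Polynomial.eval_X,
      ← Fin.sum_univ_eq_sum_range
        (fun m => ((Polynomial.X ^ a j : Polynomial R) %ₘ P).coeff m * x i ^ m) N,
      ← Equiv.sum_comp Fin.revPerm] at h1
    simp only [Matrix.mul_apply, Matrix.of_apply, c]
    rw [← h1]
    exact Finset.sum_congr rfl fun m _ => by simp [mul_comm]
  rw [hfac, Matrix.det_mul, det_rev_vandermonde]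
  exact dvd_mul_right _ _

theorem vandermondePoly_dvd {N : ℕ} (l : Signature N) : vandermondePoly N ∣ alternantPoly l :=
  prod_sub_dvd_det_pow _ _

/-- The polynomial quotient `det (X_i ^ (l_j + N - j + s)) / ∏_{i<j} (X_i - X_j)`; it is unique
since the ring is a domain. -/
def schurPoly {N : ℕ} (l : Signature N) : MvPolynomial (Fin N) ℂ :=
  Classical.choose (vandermondePoly_dvd l)

theorem vandermondePoly_mul_schurPoly {N : ℕ} (l : Signature N) :
    vandermondePoly N * schurPoly l = alternantPoly l :=
  (Classical.choose_spec (vandermondePoly_dvd l)).symm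

/-- The (rational) Schur function, the Laurent polynomial
`χ^l(u) = det (u_i ^ (l_j + N - j)) / ∏_{i<j} (u_i - u_j)`, as a function of `u` with nonzero
coordinates, coinciding coordinates included. -/
def schurFun {N : ℕ} (l : Signature N) (u : Fin N → ℂ) : ℂ :=
  (∏ i, u i) ^ (-(l.shift : ℤ)) * MvPolynomial.eval u (schurPoly l)

theorem prod_sub_mul_schurFun {N : ℕ} (l : Signature N) (u : Fin N → ℂ) (hu : ∀ i, u i ≠ 0) :
    (∏ i : Fin N, ∏ j ∈ Finset.Ioi i, (u i - u j)) * schurFun l u =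
      Matrix.det (Matrix.of fun i j : Fin N => u i ^ l.coord j) := by
  have h := congrArg (MvPolynomial.eval u) (vandermondePoly_mul_schurPoly l)
  have hp : (∏ i, u i) ≠ 0 := Finset.prod_ne_zero_iff.mpr fun i _ => hu i
  have hV : MvPolynomial.eval u (vandermondePoly N) =
      ∏ i : Fin N, ∏ j ∈ Finset.Ioi i, (u i - u j) := by
    simp [vandermondePoly, map_prod]
  have hA : MvPolynomial.eval u (alternantPoly l) =
      (∏ i, u i) ^ (l.shift : ℤ) * Matrix.det (Matrix.of fun i j : Fin N => u i ^ l.coord j) := by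
    rw [alternantPoly, RingHom.map_det, zpow_natCast, ← Finset.prod_pow, ← Matrix.det_mul_column]
    congr 1
    ext i j
    simp only [RingHom.mapMatrix_apply, Matrix.map_apply, Matrix.of_apply, map_pow,
      MvPolynomial.eval_X]
    rw [← zpow_natCast, Signature.exponent_cast, zpow_add₀ (hu i), zpow_natCast, mul_comm]
  rw [map_mul, hV, hA] at h
  rw [schurFun, mul_left_comm, h, ← mul_assoc, ← zpow_add₀ hp]
  simp

/-- The term of the signature `l` in the Schur generating function of `ρ`. -/
def schurGenTerm {N : ℕ} (ρ : PMF (Signature N)) (u : Fin N → ℂ) (l : Signature N) : ℂ :=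
  ((ρ l).toReal : ℂ) * (schurFun l u / schurFun l 1)

/-- The Schur generating function `S_ρ(u) = ∑_l ρ(l) χ^l(u) / χ^l(1^N)`. -/
def schurGen {N : ℕ} (ρ : PMF (Signature N)) (u : Fin N → ℂ) : ℂ :=
  ∑' l : Signature N, schurGenTerm ρ u l

/-- The point `(u_1, …, u_r, 1^{N-r})`, for `r ≤ N`. -/
def padOne {r : ℕ} (N : ℕ) (u : Fin r → ℂ) : Fin N → ℂ :=
  fun i => if h : (i : ℕ) < r then u ⟨i, h⟩ else 1

/-- `L` is the branch of `log f` on the neighbourhood `U` of `1^r` that vanishes at `1^r`. -/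
structure IsLogBranch {r : ℕ} (U : Set (Fin r → ℂ)) (f L : (Fin r → ℂ) → ℂ) : Prop where
  continuousOn : ContinuousOn L U
  exp_eq : ∀ u ∈ U, Complex.exp (L u) = f u
  map_one : L 1 = 0

/-- For every `r`, uniformly in a complex neighbourhood `U` of `1^r`, the sequence
`N ((1/N) log S_{ρ(N)}(u_1, …, u_r, 1^{N-r}) - ∑ Ψ(u_i))` tends to `∑ Φ(u_i)`. This includes that,
for all large `N`, the series `S_{ρ(N)}` converges at these points and has a logarithm there. -/
def LogAsymptotics (ρ : (N : ℕ) → PMF (Signature N)) (Ψ Φ : ℂ → ℂ) : Prop :=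
  ∀ r : ℕ, ∃ U : Set (Fin r → ℂ), IsOpen U ∧ IsConnected U ∧ (1 : Fin r → ℂ) ∈ U ∧
    ∃ L : ℕ → (Fin r → ℂ) → ℂ,
      (∀ᶠ N in atTop, (∀ u ∈ U, Summable (schurGenTerm (ρ N) (padOne N u))) ∧
        IsLogBranch U (fun u => schurGen (ρ N) (padOne N u)) (L N)) ∧
      TendstoUniformlyOn
        (fun (N : ℕ) (u : Fin r → ℂ) => (N : ℂ) * ((1 / (N : ℂ)) * L N u - ∑ i, Ψ (u i)))
        (fun u => ∑ i, Φ (u i)) atTop U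

/-- The sum `∑_i ((l_i + N - i) / N) ^ k`. -/
def powerSum {N : ℕ} (k : ℕ) (l : Signature N) : ℝ :=
  ∑ i : Fin N, ((l.coord i : ℝ) / (N : ℝ)) ^ k

/-- The limiting moment `m_k`. -/
def limitMoment (Ψ : ℂ → ℂ) (k : ℕ) : ℂ :=
  ∑ m ∈ Finset.range (k + 1),
    ((k.factorial : ℂ) / ((m.factorial : ℂ) * ((m + 1).factorial : ℂ) * ((k - m).factorial : ℂ))) *
      iteratedDeriv m (fun x : ℂ => x ^ k * (deriv Ψ x) ^ (k - m)) 1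

/-- The correction `m'_k`; in the range of summation `k - m - 1` is not truncated. -/
def correctionMoment (Ψ Φ : ℂ → ℂ) (k : ℕ) : ℂ :=
  ∑ m ∈ Finset.range k,
    ((k.factorial : ℂ) /
        ((m.factorial : ℂ) * ((m + 1).factorial : ℂ) * ((k - m - 1).factorial : ℂ))) *
      iteratedDeriv m
        (fun x : ℂ => x ^ k * (deriv Φ x - 1 / (2 * x)) * (deriv Ψ x) ^ (k - m - 1)) 1

end SchurGF

end

noncomputable section

namespace SchurGF

/-! Fix a signature and write its Schur function as a finite sum of Laurent monomials `∏ u_i ^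
a_s(i)`, so that its value at `1^N` is the number of monomials. The determinant with entries `[X^i]
(1 + X)^(l_j + N - j)` has this same value. Applying `(1 + X)^k D^k / k!` in one row multiplies the
entries by `binom (l_j + N - j) k`, and summing over the rows multiplies the determinant by `∑_j
binom (l_j + N - j) k`. Hence this sum, times the dimension, is a sum over the monomials of a
multilinear form in the `N` series `(1 + X)^(a_s(i))` (`sum_binom_mul_card`). The family of
exponents is symmetric, so only the symmetrisation of the form matters, and by polarisation only its
values on the diagonal `(h, …, h)` with `h(0) = 1` (`sum_exponents_eq_zero`). There it is the trace
of `f ↦ h⁻¹ T (h f)` on truncated series, an explicit sum of terms `binom(N, q + 1) [X^q] (1 + X)^k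
(D^p h / p!) h⁻¹` with `p + q = k`.

Now put `h = g f` with a reference series `g`. The terms where no derivative falls on `f` form a
deterministic main term. In the others `f⁻¹` may be replaced modulo `X^(k+1)` by a polynomial of
degree `k` in `f`, so they are the diagonal of a form in only `k + 1` variables
(`traceForm_diag_eq`). After averaging over the measure, the expectation therefore involves only
`S(u_1, …, u_{k+1}, 1^{N-k-1})` (`hasSum_binom`). The coefficients are extracted by Cauchy integrals
over a torus; positivity of the monomial expansion supplies the domination that lets sum and
integral be exchanged.

Take `g = exp (N Ψ + Φ)`. By hypothesis `S / ∏ g(u_i)` tends to `1` uniformly, so the error is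
`o(N^k)`. Since `g' = (N Ψ' + Φ') g`, the main term has a two-term expansion in `N`
(`hasExp_mainTerm`). Passing from binomial coefficients to powers adds `(k - 1) / 2` to a
contribution `-k / 2` of the main term; their sum `-1/2` is the source of the summand `-1 / (2x)` in
the correction. -/

/-! ### Schur functions as sums of Laurent monomials. -/

theorem sub_one_mul_sum_zpow {x : ℂ} (hx : x ≠ 0) {a b : ℤ} (hab : a ≤ b) :
    (x - 1) * ∑ p ∈ Finset.Ico a b, x ^ p = x ^ b - x ^ a := by
  induction b, hab using Int.leInduction with
  | base => simp
  | succ b hab ih =>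
    have : Finset.Ico a (b + 1) = insert b (Finset.Ico a b) := by
      ext p; simp only [Finset.mem_Ico, Finset.mem_insert]; omega
    rw [this, Finset.sum_insert (by simp), mul_add, ih, zpow_add_one₀ hx]
    ring

theorem prod_zpow_eq_zpow_sum {ι : Type*} {x : ℂ} (hx : x ≠ 0) (s : Finset ι) (f : ι → ℤ) :
    ∏ i ∈ s, x ^ f i = x ^ ∑ i ∈ s, f i := by
  classical
  induction s using Finset.induction_on with
  | empty => simp
  | insert i s hi ih => rw [Finset.prod_insert hi, Finset.sum_insert hi, ih, zpow_add₀ hx]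

theorem det_vandermonde_succ {N : ℕ} (u : Fin (N + 1) → ℂ) :
    (Matrix.vandermonde u).det =
      (∏ i : Fin N, (u i.succ - u 0)) * (Matrix.vandermonde fun i : Fin N => u i.succ).det := by
  rw [Matrix.det_vandermonde, Matrix.det_vandermonde, Fin.prod_univ_succ, Fin.prod_Ioi_zero]
  congr 1
  exact Finset.prod_congr rfl fun i _ => Fin.prod_Ioi_succ (fun j => u j - u i.succ) i

/-- The branching step: a generalised Vandermonde determinant in `N + 1` variables, in terms of
those in the last `N` variables, over interlacing exponents. -/
theorem det_zpow_succ {N : ℕ} (m : Fin (N + 1) → ℤ) (hm : StrictMono m) (u : Fin (N + 1) → ℂ)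
    (hu : ∀ i, u i ≠ 0) :
    (Matrix.of fun i j => u i ^ m j).det =
      (∏ i : Fin N, (u i.succ - u 0)) *
        ∑ p ∈ Fintype.piFinset (fun j : Fin N => Finset.Ico (m j.castSucc) (m j.succ)),
          u 0 ^ ((∑ j, m j) - N - ∑ j, p j) *
            (Matrix.of fun i j : Fin N => u i.succ ^ p j).det := by
  set x := u 0 with hx
  have hx0 : x ≠ 0 := hu 0
  set v : Fin (N + 1) → ℂ := fun i => u i / x with hv
  have hv0 : ∀ i, v i ≠ 0 := fun i => div_ne_zero (hu i) hx0
  -- Dividing all variables by `u 0` makes the first row constant equal to `1`. Subtracting adjacent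
  -- columns then clears it, and each remaining difference is `v - 1` times a geometric sum over an
  -- interval.
  have h1 : (Matrix.of fun i j => u i ^ m j).det =
      x ^ (∑ j, m j) * (Matrix.of fun i j => v i ^ m j).det := by
    have : (Matrix.of fun i j => u i ^ m j) =
        Matrix.of fun i j => x ^ m j * (Matrix.of fun i j => v i ^ m j) i j := by
      ext i j
      simp only [Matrix.of_apply, hv, div_zpow]
      rw [mul_div_cancel₀ _ (zpow_ne_zero _ hx0)]
    rw [this, Matrix.det_mul_row]
    congr 1
    rw [prod_zpow_eq_zpow_sum hx0]
  have h2 : (Matrix.of fun i j => v i ^ m j).det =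
      (Matrix.of fun i j : Fin N => v i.succ ^ m j.succ - v i.succ ^ m j.castSucc).det := by
    rw [Matrix.det_eq_of_forall_col_eq_smul_add_pred (B := Matrix.of fun i j =>
      Fin.cases (v i ^ m 0) (fun j : Fin N => v i ^ m j.succ - v i ^ m j.castSucc) j)
      (fun _ => 1) (by simp) (by simp), Matrix.det_succ_row_zero, Fin.sum_univ_succ]
    have hv1 : v 0 = 1 := by simp [hv, ← hx, hx0]
    simp only [Matrix.of_apply, Fin.cases_zero, Fin.cases_succ, hv1, one_zpow, sub_self, mul_zero,
      zero_mul, Finset.sum_const_zero, add_zero]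
    simp only [Fin.val_zero, pow_zero, one_mul]
    rfl
  have h3 : (Matrix.of fun i j : Fin N => v i.succ ^ m j.succ - v i.succ ^ m j.castSucc) =
      Matrix.of fun i j => (v i.succ - 1) * (Matrix.of fun i j : Fin N =>
        ∑ p ∈ Finset.Ico (m j.castSucc) (m j.succ), v i.succ ^ p) i j := by
    ext i j
    exact (sub_one_mul_sum_zpow (hv0 _) (hm (Fin.castSucc_lt_succ)).le).symm
  have h4 : (Matrix.of fun i j : Fin N =>
        ∑ p ∈ Finset.Ico (m j.castSucc) (m j.succ), v i.succ ^ p).det =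
      ∑ p ∈ Fintype.piFinset (fun j : Fin N => Finset.Ico (m j.castSucc) (m j.succ)),
        (Matrix.of fun i j : Fin N => v i.succ ^ p j).det := by
    rw [← Matrix.det_transpose]
    have := (Matrix.detRowAlternating (R := ℂ) (n := Fin N)).toMultilinearMap.map_sum_finset
      (fun (j : Fin N) (p : ℤ) => (fun i : Fin N => v i.succ ^ p))
      (fun j : Fin N => Finset.Ico (m j.castSucc) (m j.succ))
    refine Eq.trans ?_ (this.trans ?_)
    · change Matrix.det _ = Matrix.det _
      congr 1
      ext i j
      simp [Finset.sum_apply]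
    · refine Finset.sum_congr rfl fun p _ => ?_
      change Matrix.det _ = Matrix.det _
      rw [← Matrix.det_transpose]
      rfl
  have h5 : ∀ p : Fin N → ℤ, (Matrix.of fun i j : Fin N => v i.succ ^ p j).det =
      x ^ (-∑ j, p j) * (Matrix.of fun i j : Fin N => u i.succ ^ p j).det := by
    intro p
    have : (Matrix.of fun i j : Fin N => v i.succ ^ p j) = Matrix.of fun i j =>
        x ^ (-p j) * (Matrix.of fun i j : Fin N => u i.succ ^ p j) i j := by
      ext i j
      simp only [Matrix.of_apply, hv, div_zpow, zpow_neg]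
      field_simp
    rw [this, Matrix.det_mul_row, ← Finset.sum_neg_distrib, prod_zpow_eq_zpow_sum hx0]
  have h6 : (∏ i : Fin N, (v i.succ - 1)) = x ^ (-(N : ℤ)) * ∏ i : Fin N, (u i.succ - x) := by
    have : ∀ i : Fin N, v i.succ - 1 = x⁻¹ * (u i.succ - x) := fun i => by
      simp only [hv]; field_simp
    simp [this, Finset.prod_mul_distrib]
  rw [h1, h2, h3, Matrix.det_mul_column, h4, h6]
  simp only [h5]
  rw [mul_comm (x ^ (-(N : ℤ))), mul_assoc, mul_left_comm, Finset.mul_sum, Finset.mul_sum]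
  congr 1
  refine Finset.sum_congr rfl fun p _ => ?_
  rw [sub_eq_add_neg, sub_eq_add_neg, zpow_add₀ hx0, zpow_add₀ hx0]
  ring

/-- Schur functions are sums of Laurent monomials. -/
theorem exists_laurent_expansion (N : ℕ) : ∀ m : Fin N → ℤ, StrictMono m →
    ∃ (ι : Type) (_ : Fintype ι) (_ : Nonempty ι) (a : ι → Fin N → ℤ),
      ∀ u : Fin N → ℂ, (∀ i, u i ≠ 0) → (Matrix.of fun i j => u i ^ m j).det =
        (Matrix.vandermonde u).det * ∑ s, ∏ i, u i ^ a s i := by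
  induction N with
  | zero =>
    intro m _
    exact ⟨Unit, inferInstance, inferInstance, fun _ => 0, fun u _ => by simp⟩
  | succ N ih =>
    intro m hm
    set T := Fintype.piFinset (fun j : Fin N => Finset.Ico (m j.castSucc) (m j.succ)) with hT
    have hmono : ∀ p : T, StrictMono p.1 := by
      rintro ⟨p, hp⟩ i j hij
      rw [hT, Fintype.mem_piFinset] at hp
      -- The intervals are half-open, so interlacing exponents are again strictly increasing and the
      -- induction applies to them.
      have h1 := (Finset.mem_Ico.mp (hp i)).2
      have h2 := (Finset.mem_Ico.mp (hp j)).1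
      have h3 : m i.succ ≤ m j.castSucc := hm.monotone (by
        rw [Fin.le_iff_val_le_val]; exact hij)
      exact h1.trans_le (h3.trans h2)
    choose ι hι hne a ha using fun p : T => ih p.1 (hmono p)
    have hTne : Nonempty T := by
      refine ⟨⟨fun j => m j.castSucc, ?_⟩⟩
      rw [hT, Fintype.mem_piFinset]
      exact fun j => Finset.mem_Ico.mpr ⟨le_rfl, hm (Fin.castSucc_lt_succ)⟩
    refine ⟨Σ p : T, ι p, inferInstance, ?_,
      fun s => Fin.cons ((∑ j, m j) - N - ∑ j, s.1.1 j) (a s.1 s.2), fun u hu => ?_⟩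
    · obtain ⟨p⟩ := hTne
      obtain ⟨s⟩ := hne p
      exact ⟨⟨p, s⟩⟩
    · rw [det_zpow_succ m hm u hu, det_vandermonde_succ, Fintype.sum_sigma, mul_assoc,
        ← Finset.sum_coe_sort T, Finset.mul_sum (a := Matrix.det _)]
      congr 1
      refine Finset.sum_congr rfl fun p _ => ?_
      rw [ha p _ fun i => hu i.succ, mul_left_comm, Finset.mul_sum]
      congr 1
      refine Finset.sum_congr rfl fun s _ => ?_
      rw [Fin.prod_univ_succ]
      simp

/-- A linear relation between Laurent monomials, as functions, is a formal one. -/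
theorem sum_eq_zero_of_sum_monomials_eq_zero {N : ℕ} {ι : Type*} [Fintype ι] (c : ι → ℂ)
    (e : ι → Fin N → ℤ)
    (h : ∀ u : Fin N → ℂ, (∀ i, u i ≠ 0) → ∑ s, c s * ∏ i, u i ^ e s i = 0)
    (φ : (Fin N → ℤ) → ℂ) : ∑ s, c s * φ (e s) = 0 := by
  -- Monomials are characters of the torus, distinct because evaluation at `2` in one coordinate
  -- separates them; distinct characters are linearly independent.
  let mono : (Fin N → ℤ) → ((Fin N → ℂˣ) →* ℂ) := fun a =>
    { toFun := fun u => ((∏ i, u i ^ a i : ℂˣ) : ℂ)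
      map_one' := by simp
      map_mul' := fun u v => by simp [mul_zpow, Finset.prod_mul_distrib] }
  have hinj : Function.Injective mono := by
    intro a b hab
    ext i
    have h2 : (2 : ℂ) ≠ 0 := two_ne_zero
    have := DFunLike.congr_fun hab (Pi.mulSingle i (Units.mk0 2 h2))
    have key : ∀ a : Fin N → ℤ, mono a (Pi.mulSingle i (Units.mk0 2 h2)) = (2 : ℂ) ^ a i := by
      intro a
      change ((∏ j, (Pi.mulSingle i (Units.mk0 2 h2) : Fin N → ℂˣ) j ^ a j : ℂˣ) : ℂ) = _
      rw [Finset.prod_eq_single i (fun j _ hj => by simp [Pi.mulSingle_eq_of_ne hj]) (by simp)]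
      simp
    rw [key, key] at this
    have h3 := congrArg (fun z : ℂ => ‖z‖) this
    simp only [norm_zpow, Complex.norm_ofNat] at h3
    exact zpow_right_injective₀ (by norm_num) (by norm_num) h3
  have hli : LinearIndependent ℂ (fun a => (mono a : (Fin N → ℂˣ) → ℂ)) :=
    (linearIndependent_monoidHom (Fin N → ℂˣ) ℂ).comp mono hinj
  let F : (Fin N → ℤ) →₀ ℂ := ∑ s, Finsupp.single (e s) (c s)
  have hF : F = 0 := by
    rw [linearIndependent_iff] at hli
    apply hli
    rw [map_sum]
    ext u
    have := h (fun i => (u i : ℂ)) (fun i => (u i).ne_zero)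
    simp only [Finsupp.linearCombination_single, Finset.sum_apply, Pi.smul_apply, smul_eq_mul,
      Pi.zero_apply]
    rw [← this]
    refine Finset.sum_congr rfl fun s _ => ?_
    congr 1
    change ((∏ i, u i ^ e s i : ℂˣ) : ℂ) = _
    simp
  have := congrArg (Finsupp.linearCombination ℂ φ) hF
  simpa [F, map_sum] using this

/-- Moving `u_i` to `u_i + t i` separates all coordinates for small `t ≠ 0`. Identities obtained by
cancelling a Vandermonde determinant thus extend by continuity to coinciding coordinates. -/
theorem eq_of_eq_on_injective {N : ℕ} {f g : (Fin N → ℂ) → ℂ}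
    (hf : ∀ u, (∀ i, u i ≠ 0) → ContinuousAt f u) (hg : ∀ u, (∀ i, u i ≠ 0) → ContinuousAt g u)
    (h : ∀ u, (∀ i, u i ≠ 0) → Function.Injective u → f u = g u) {u : Fin N → ℂ}
    (hu : ∀ i, u i ≠ 0) : f u = g u := by
  let p : ℂ → Fin N → ℂ := fun t i => u i + t * (i : ℕ)
  have hp : Continuous p := by fun_prop
  have hp0 : p 0 = u := by ext i; simp [p]
  have h1 : ∀ᶠ t in 𝓝[≠] (0 : ℂ), ∀ i, p t i ≠ 0 := by
    refine nhdsWithin_le_nhds (eventually_all.mpr fun i => ?_)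
    have : ContinuousAt (fun t => p t i) 0 := ((continuous_apply i).comp hp).continuousAt
    exact this.eventually_ne (by simpa [p] using hu i)
  have h2 : ∀ᶠ t in 𝓝[≠] (0 : ℂ), Function.Injective (p t) := by
    have : ∀ i j : Fin N, i ≠ j → ∀ᶠ t in 𝓝[≠] (0 : ℂ), p t i ≠ p t j := by
      intro i j hij
      by_cases huij : u i = u j
      · filter_upwards [self_mem_nhdsWithin] with t ht heq
        simp only [p, huij, add_right_inj] at heq
        have := mul_left_cancel₀ ht heq
        exact hij (Fin.ext (by exact_mod_cast this))
      · refine nhdsWithin_le_nhds ?_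
        have : ContinuousAt (fun t => p t i - p t j) 0 := by
          exact (((continuous_apply i).comp hp).sub ((continuous_apply j).comp hp)).continuousAt
        have h0 : p 0 i - p 0 j ≠ 0 := by simpa [p] using sub_ne_zero.mpr huij
        filter_upwards [this.eventually_ne h0] with t ht
        exact sub_ne_zero.mp ht
    have h3 : ∀ᶠ t in 𝓝[≠] (0 : ℂ), ∀ i j : Fin N, i ≠ j → p t i ≠ p t j :=
      eventually_all.mpr fun i => eventually_all.mpr fun j => by
        by_cases hij : i = j
        · simp [hij]
        · simpa [hij] using this i j hij
    filter_upwards [h3] with t ht i j hij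
    by_contra hne
    exact ht i j hne hij
  have hf' : Tendsto (fun t => f (p t)) (𝓝[≠] 0) (𝓝 (f u)) := by
    have := (hf u hu)
    rw [← hp0] at this ⊢
    exact (ContinuousAt.comp (f := p) this hp.continuousAt).tendsto.mono_left nhdsWithin_le_nhds
  have hg' : Tendsto (fun t => g (p t)) (𝓝[≠] 0) (𝓝 (g u)) := by
    have := (hg u hu)
    rw [← hp0] at this ⊢
    exact (ContinuousAt.comp (f := p) this hp.continuousAt).tendsto.mono_left nhdsWithin_le_nhds
  refine tendsto_nhds_unique (hf'.congr' ?_) hg'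
  filter_upwards [h1, h2] with t ht1 ht2 using h _ ht1 ht2

theorem continuousAt_prod_zpow {N : ℕ} (a : Fin N → ℤ) {u : Fin N → ℂ} (hu : ∀ i, u i ≠ 0) :
    ContinuousAt (fun u : Fin N → ℂ => ∏ i, u i ^ a i) u :=
  tendsto_finsetProd _ fun i _ => ContinuousAt.zpow₀ (continuous_apply i).continuousAt _ (.inl (hu i))

theorem continuousAt_schurFun {N : ℕ} (l : Signature N) {u : Fin N → ℂ} (hu : ∀ i, u i ≠ 0) :
    ContinuousAt (schurFun l) u := by
  unfold schurFun
  refine ContinuousAt.mul (ContinuousAt.zpow₀ ?_ _ (.inl ?_)) ?_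
  · exact (continuous_finsetProd _ fun i _ => continuous_apply i).continuousAt
  · exact Finset.prod_ne_zero_iff.mpr fun i _ => hu i
  · exact (MvPolynomial.continuous_eval _).continuousAt

theorem Signature.strictMono_coord_rev {N : ℕ} (l : Signature N) :
    StrictMono fun j : Fin N => l.coord j.rev := by
  intro i j hij
  have h1 := l.2 (Fin.rev_le_rev.mpr hij.le)
  have h2 : (j.rev : ℕ) < (i.rev : ℕ) := Fin.rev_lt_rev.mpr hij
  change l.1 i.rev ≤ l.1 j.rev at h1
  simp only [Signature.coord]
  omega

/-- Reversing the columns makes the exponents increasing, as the branching step needs; both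
determinants change by the same sign. -/
theorem vandermonde_mul_schurFun {N : ℕ} (l : Signature N) (u : Fin N → ℂ) (hu : ∀ i, u i ≠ 0) :
    (Matrix.vandermonde u).det * schurFun l u =
      (Matrix.of fun i j : Fin N => u i ^ l.coord j.rev).det := by
  have h := prod_sub_mul_schurFun l u hu
  rw [← det_rev_vandermonde] at h
  have e1 : (Matrix.of fun i j : Fin N => u i ^ (Fin.rev j : ℕ)) =
      (Matrix.vandermonde u).submatrix id Fin.revPerm := by
    ext i j; simp [Matrix.vandermonde]
  have e2 : (Matrix.of fun i j : Fin N => u i ^ l.coord j) =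
      (Matrix.of fun i j : Fin N => u i ^ l.coord j.rev).submatrix id Fin.revPerm := by
    ext i j; simp
  rw [e1, e2, Matrix.det_permute', Matrix.det_permute', mul_assoc] at h
  refine mul_left_cancel₀ ?_ h
  exact_mod_cast (Units.ne_zero (Equiv.Perm.sign (Fin.revPerm (n := N))))

/-- A finite, nonempty, symmetric family of exponents whose monomials sum to the Schur function. -/
theorem exists_schurFun_eq_sum {N : ℕ} (l : Signature N) :
    ∃ (ι : Type) (_ : Fintype ι) (_ : Nonempty ι) (a : ι → Fin N → ℤ),
      ∀ u : Fin N → ℂ, (∀ i, u i ≠ 0) → schurFun l u = ∑ s, ∏ i, u i ^ a s i := by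
  obtain ⟨ι, hι, hne, a, ha⟩ := exists_laurent_expansion N _ l.strictMono_coord_rev
  refine ⟨ι, hι, hne, a, fun u hu => eq_of_eq_on_injective
    (fun u hu => continuousAt_schurFun l hu)
    (fun u hu => tendsto_finsetSum _ fun s _ => continuousAt_prod_zpow _ hu) ?_ hu⟩
  intro u hu hinj
  have h := ha u hu
  rw [← vandermonde_mul_schurFun l u hu] at h
  exact mul_left_cancel₀ (Matrix.det_vandermonde_ne_zero_iff.mpr hinj) h

theorem schurFun_comp_perm {N : ℕ} (l : Signature N) (σ : Equiv.Perm (Fin N)) {u : Fin N → ℂ}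
    (hu : ∀ i, u i ≠ 0) : schurFun l (u ∘ σ) = schurFun l u := by
  refine eq_of_eq_on_injective (f := fun u => schurFun l (u ∘ σ)) (g := schurFun l) ?_
    (fun u hu => continuousAt_schurFun l hu) ?_ hu
  · intro u hu
    have hc : ContinuousAt (fun u : Fin N → ℂ => u ∘ σ) u := by
      apply Continuous.continuousAt
      fun_prop
    exact ContinuousAt.comp (f := fun u : Fin N → ℂ => u ∘ σ)
      (continuousAt_schurFun l (fun i => hu (σ i))) hc
  · intro u hu hinj
    have h1 := vandermonde_mul_schurFun l u hu
    have h2 := vandermonde_mul_schurFun l (u ∘ σ) fun i => hu (σ i)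
    have e1 : Matrix.vandermonde (u ∘ σ) = (Matrix.vandermonde u).submatrix σ id := by
      ext i j; simp [Matrix.vandermonde]
    have e2 : (Matrix.of fun i j : Fin N => (u ∘ σ) i ^ l.coord j.rev) =
      (Matrix.of fun i j : Fin N => u i ^ l.coord j.rev).submatrix σ id := by
      ext i j; simp
    rw [e1, e2, Matrix.det_permute, Matrix.det_permute, ← h1, mul_assoc] at h2
    refine mul_left_cancel₀ (Matrix.det_vandermonde_ne_zero_iff.mpr hinj) (mul_left_cancel₀ ?_ h2)
    exact_mod_cast (Units.ne_zero (Equiv.Perm.sign σ))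

theorem padOne_ne_zero {r N : ℕ} {u : Fin r → ℂ} (hu : ∀ i, u i ≠ 0) (i : Fin N) :
    padOne N u i ≠ 0 := by
  unfold padOne
  split_ifs
  · exact hu _
  · exact one_ne_zero

theorem prod_padOne_zpow {r N : ℕ} (h : r ≤ N) (u : Fin r → ℂ) (a : Fin N → ℤ) :
    ∏ i, padOne N u i ^ a i = ∏ i, u i ^ a (Fin.castLE h i) := by
  obtain ⟨d, rfl⟩ := Nat.exists_eq_add_of_le h
  rw [Fin.prod_univ_add]
  have h1 : ∀ i : Fin d, padOne (r + d) u (Fin.natAdd r i) = 1 := fun i => by simp [padOne]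
  have h2 : ∀ i : Fin r, padOne (r + d) u (Fin.castAdd d i) = u i := fun i => by simp [padOne]
  simp only [h1, h2, one_zpow, Finset.prod_const_one, mul_one]
  rfl

/-! ### Domination by finitely many real points. -/

theorem zpow_le_zpow_add_zpow {x₁ x₂ x : ℝ} (h₀ : 0 < x₁) (h₁ : x₁ ≤ x) (h₂ : x ≤ x₂) (a : ℤ) :
    x ^ a ≤ x₁ ^ a + x₂ ^ a := by
  have hx : 0 < x := h₀.trans_le h₁
  have hx₂ : 0 < x₂ := hx.trans_le h₂
  rcases le_total 0 a with ha | ha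
  · have := zpow_le_zpow_left₀ ha hx.le h₂
    have := zpow_pos h₀ a
    linarith
  · have : x ^ a ≤ x₁ ^ a := by
      have := zpow_le_zpow_left₀ (neg_nonneg.mpr ha) h₀.le h₁
      rw [zpow_neg, zpow_neg] at this
      exact (inv_le_inv₀ (zpow_pos h₀ a) (zpow_pos hx a)).mp this
    have := zpow_pos hx₂ a
    linarith

/-- The real point with coordinates among `x₁` and `x₂`. -/
def corner {r : ℕ} (x₁ x₂ : ℝ) (b : Fin r → Bool) : Fin r → ℂ :=
  fun i => ((if b i then x₁ else x₂ : ℝ) : ℂ)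

/-- Each monomial is bounded by `∏ (x₁ ^ a + x₂ ^ a)`, which expands into its values at the corners.
As all monomials have coefficient `1`, no cancellation occurs at the positive corners. Absolute
convergence at finitely many points thus dominates the series on a whole polyannulus. -/
theorem norm_schurFun_le {r N : ℕ} (h : r ≤ N) (l : Signature N) {x₁ x₂ : ℝ} (h₀ : 0 < x₁)
    {u : Fin r → ℂ} (h₁ : ∀ i, x₁ ≤ ‖u i‖) (h₂ : ∀ i, ‖u i‖ ≤ x₂) :
    ‖schurFun l (padOne N u)‖ ≤
      ∑ b : Fin r → Bool, ‖schurFun l (padOne N (corner x₁ x₂ b))‖ := by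
  -- With no variables nothing forces `x₂` to be positive.
  rcases Nat.eq_zero_or_pos r with rfl | hr
  · have : u = corner x₁ x₂ (fun _ => true) := Subsingleton.elim _ _
    rw [this]
    exact Finset.single_le_sum (f := fun b => ‖schurFun l (padOne N (corner x₁ x₂ b))‖)
      (fun _ _ => norm_nonneg _) (Finset.mem_univ _)
  have hx₂ : 0 < x₂ := h₀.trans_le ((h₁ ⟨0, hr⟩).trans (h₂ ⟨0, hr⟩))
  obtain ⟨ι, hι, hne, a, ha⟩ := exists_schurFun_eq_sum l
  have hc : ∀ b : Fin r → Bool, ‖schurFun l (padOne N (corner x₁ x₂ b))‖ =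
      ∑ s, ∏ i : Fin r, (if b i then x₁ else x₂) ^ a s (Fin.castLE h i) := by
    intro b
    have hp : ∀ i, 0 < (if b i then x₁ else x₂) := fun i => by split_ifs <;> assumption
    rw [ha _ (padOne_ne_zero fun i => by
      unfold corner; exact_mod_cast (hp i).ne')]
    simp only [prod_padOne_zpow h, corner]
    rw [← Complex.norm_of_nonneg (Finset.sum_nonneg fun s _ => Finset.prod_nonneg fun i _ =>
      zpow_nonneg (hp i).le _)]
    push_cast
    rfl
  have hu0 : ∀ i, u i ≠ 0 := fun i => norm_pos_iff.mp (h₀.trans_le (h₁ i))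
  rw [ha _ (padOne_ne_zero hu0)]
  simp only [hc, prod_padOne_zpow h]
  rw [Finset.sum_comm]
  refine (norm_sum_le _ _).trans (Finset.sum_le_sum fun s _ => ?_)
  rw [norm_prod]
  simp only [norm_zpow]
  refine (Finset.prod_le_prod (fun i _ => zpow_nonneg (norm_nonneg _) _)
    fun i _ => zpow_le_zpow_add_zpow h₀ (h₁ i) (h₂ i) _).trans (le_of_eq ?_)
  have := Finset.prod_univ_sum (fun _ : Fin r => (Finset.univ : Finset Bool))
    (fun i b => (if b then x₁ else x₂) ^ a s (Fin.castLE h i))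
  rw [Fintype.piFinset_univ] at this
  simpa only [Fintype.sum_bool, if_true, Bool.false_eq_true, if_false] using this

/-! ### Normalised derivatives and Taylor series at 1. -/

open PowerSeries in
/-- The normalised `k`-th derivative `D ^ k / k!` of power series. -/
def hasseD (k : ℕ) : PowerSeries ℂ →ₗ[ℂ] PowerSeries ℂ where
  toFun f := mk fun n => ((n + k).choose k : ℂ) * coeff (n + k) f
  map_add' f g := by ext n; simp [mul_add]
  map_smul' c f := by ext n; simp [mul_left_comm]

theorem coeff_hasseD (k n : ℕ) (f : PowerSeries ℂ) :
    PowerSeries.coeff n (hasseD k f) =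
      ((n + k).choose k : ℂ) * PowerSeries.coeff (n + k) f := by
  simp [hasseD]

theorem hasseD_zero (f : PowerSeries ℂ) : hasseD 0 f = f := by
  ext n; simp [coeff_hasseD]

theorem derivative_hasseD (k : ℕ) (f : PowerSeries ℂ) :
    PowerSeries.derivative ℂ (hasseD k f) = ((k + 1 : ℕ) : ℂ) • hasseD (k + 1) f := by
  ext n
  simp only [PowerSeries.coeff_derivative, coeff_hasseD, map_smul, smul_eq_mul]
  have h : (n + 1 + k).choose k * (n + 1) = (k + 1) * (n + (k + 1)).choose (k + 1) := by
    have := Nat.choose_succ_right_eq (n + 1 + k) k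
    rw [show n + 1 + k - k = n + 1 by omega] at this
    rw [← this, show n + (k + 1) = n + 1 + k by omega]
    ring
  have h' : (((n + 1 + k).choose k : ℕ) : ℂ) * (n + 1) =
      (k + 1) * (((n + (k + 1)).choose (k + 1) : ℕ) : ℂ) := by exact_mod_cast h
  rw [show n + 1 + k = n + (k + 1) by omega] at h' ⊢
  push_cast
  rw [mul_right_comm, h']
  ring

theorem hasseD_mul (k : ℕ) (f g : PowerSeries ℂ) :
    hasseD k (f * g) = ∑ p ∈ Finset.HasAntidiagonal.antidiagonal k, hasseD p.1 f * hasseD p.2 g := by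
  induction k with
  | zero => simp [hasseD_zero]
  | succ k ih =>
    have h := derivative_hasseD k (f * g)
    rw [ih, map_sum] at h
    simp only [Derivation.leibniz, derivative_hasseD, smul_eq_mul] at h
    -- The factor `k + 1` splits as `p.1 + p.2`; each half is an index shift of the differentiated
    -- sum.
    have h2 : ((k + 1 : ℕ) : ℂ) • ∑ p ∈ Finset.HasAntidiagonal.antidiagonal (k + 1), hasseD p.1 f * hasseD p.2 g =
        ∑ p ∈ Finset.HasAntidiagonal.antidiagonal k, (hasseD p.1 f * (((p.2 + 1 : ℕ) : ℂ) • hasseD (p.2 + 1) g) +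
          hasseD p.2 g * (((p.1 + 1 : ℕ) : ℂ) • hasseD (p.1 + 1) f)) := by
      rw [Finset.smul_sum, Finset.sum_add_distrib]
      have e : ∀ p ∈ Finset.HasAntidiagonal.antidiagonal (k + 1),
          ((k + 1 : ℕ) : ℂ) • (hasseD p.1 f * hasseD p.2 g) =
            hasseD p.1 f * ((p.2 : ℂ) • hasseD p.2 g) + hasseD p.2 g * ((p.1 : ℂ) • hasseD p.1 f) := by
        intro p hp
        rw [← Finset.HasAntidiagonal.mem_antidiagonal.mp hp]
        simp only [Algebra.smul_def]
        simp only [Nat.cast_add, map_add]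
        ring
      rw [Finset.sum_congr rfl e, Finset.sum_add_distrib]
      congr 1
      · rw [Finset.Nat.sum_antidiagonal_succ']
        simp
      · rw [Finset.Nat.sum_antidiagonal_succ]
        simp
    rw [← h2] at h
    have hk : ((k + 1 : ℕ) : ℂ) ≠ 0 := by exact_mod_cast Nat.succ_ne_zero k
    exact (smul_right_injective _ hk h).symm

theorem hasseD_X_pow (n i : ℕ) :
    hasseD n (PowerSeries.X ^ i : PowerSeries ℂ) =
      PowerSeries.C (i.choose n : ℂ) * PowerSeries.X ^ (i - n) := by
  ext m
  rw [coeff_hasseD, PowerSeries.coeff_C_mul, PowerSeries.coeff_X_pow, PowerSeries.coeff_X_pow]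
  by_cases h : m + n = i
  · subst h; simp
  · rw [if_neg h]
    by_cases hn : i < n
    · simp [Nat.choose_eq_zero_of_lt hn]
    · rw [if_neg (by omega)]; simp

/-- The Taylor series at `1`. -/
def taylorOne (f : ℂ → ℂ) : PowerSeries ℂ :=
  PowerSeries.mk fun n => iteratedDeriv n f 1 / (n.factorial : ℂ)

theorem coeff_taylorOne (n : ℕ) (f : ℂ → ℂ) :
    PowerSeries.coeff n (taylorOne f) = iteratedDeriv n f 1 / (n.factorial : ℂ) := by
  simp [taylorOne]

theorem constantCoeff_taylorOne (f : ℂ → ℂ) :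
    PowerSeries.constantCoeff (taylorOne f) = f 1 := by
  rw [← PowerSeries.coeff_zero_eq_constantCoeff_apply, coeff_taylorOne]; simp

theorem taylorOne_congr {f g : ℂ → ℂ} (h : f =ᶠ[𝓝 1] g) : taylorOne f = taylorOne g := by
  ext n; rw [coeff_taylorOne, coeff_taylorOne, h.iteratedDeriv_eq n]

theorem taylorOne_mul {f g : ℂ → ℂ} (hf : AnalyticAt ℂ f 1) (hg : AnalyticAt ℂ g 1) :
    taylorOne (fun z => f z * g z) = taylorOne f * taylorOne g := by
  ext n
  have h := iteratedDeriv_mul (n := n) hf.contDiffAt hg.contDiffAt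
  rw [coeff_taylorOne, PowerSeries.coeff_mul, Finset.Nat.sum_antidiagonal_eq_sum_range_succ_mk]
  change iteratedDeriv n (f * g) 1 / _ = _
  rw [h, Finset.sum_div]
  refine Finset.sum_congr rfl fun i hi => ?_
  have hi' : i ≤ n := Nat.lt_succ_iff.mp (Finset.mem_range.mp hi)
  rw [coeff_taylorOne, coeff_taylorOne, Nat.cast_choose ℂ hi']
  have h1 := Nat.cast_ne_zero (R := ℂ).mpr (Nat.factorial_ne_zero n)
  have h2 := Nat.cast_ne_zero (R := ℂ).mpr (Nat.factorial_ne_zero i)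
  have h3 := Nat.cast_ne_zero (R := ℂ).mpr (Nat.factorial_ne_zero (n - i))
  field_simp

theorem taylorOne_add {f g : ℂ → ℂ} (hf : AnalyticAt ℂ f 1) (hg : AnalyticAt ℂ g 1) :
    taylorOne (fun z => f z + g z) = taylorOne f + taylorOne g := by
  ext n
  have h := iteratedDeriv_add (n := n) hf.contDiffAt hg.contDiffAt
  rw [map_add, coeff_taylorOne, coeff_taylorOne, coeff_taylorOne, ← add_div, ← h]
  rfl

theorem taylorOne_const (c : ℂ) : taylorOne (fun _ => c) = PowerSeries.C c := by
  ext n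
  rw [coeff_taylorOne, iteratedDeriv_const, PowerSeries.coeff_C]
  split_ifs with h <;> simp [h]

theorem taylorOne_const_mul (c : ℂ) {f : ℂ → ℂ} (hf : AnalyticAt ℂ f 1) :
    taylorOne (fun z => c * f z) = PowerSeries.C c * taylorOne f := by
  rw [taylorOne_mul (f := fun _ => c) analyticAt_const hf, taylorOne_const]

theorem taylorOne_id : taylorOne (fun z => z) = 1 + PowerSeries.X := by
  ext n
  rw [coeff_taylorOne]
  change iteratedDeriv n id 1 / _ = _
  rw [iteratedDeriv_id, map_add, PowerSeries.coeff_one, PowerSeries.coeff_X]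
  rcases n with _ | _ | n <;> simp

theorem taylorOne_pow {f : ℂ → ℂ} (hf : AnalyticAt ℂ f 1) (n : ℕ) :
    taylorOne (fun z => f z ^ n) = taylorOne f ^ n := by
  induction n with
  | zero => simpa using taylorOne_const 1
  | succ n ih =>
    simp only [pow_succ]
    rw [taylorOne_mul (hf.fun_pow n) hf, ih]

theorem taylorOne_prod {ι : Type*} (s : Finset ι) {f : ι → ℂ → ℂ}
    (hf : ∀ i ∈ s, AnalyticAt ℂ (f i) 1) :
    taylorOne (fun z => ∏ i ∈ s, f i z) = ∏ i ∈ s, taylorOne (f i) := by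
  classical
  induction s using Finset.induction_on with
  | empty => simpa using taylorOne_const 1
  | insert i s hi ih =>
    simp only [Finset.prod_insert hi]
    rw [taylorOne_mul (hf i (Finset.mem_insert_self _ _))
      (Finset.analyticAt_fun_prod s fun j hj => hf j (Finset.mem_insert_of_mem hj)),
      ih fun j hj => hf j (Finset.mem_insert_of_mem hj)]

theorem taylorOne_inv {f : ℂ → ℂ} (hf : AnalyticAt ℂ f 1) (h0 : f 1 ≠ 0) :
    taylorOne (fun z => (f z)⁻¹) = (taylorOne f)⁻¹ := by
  rw [PowerSeries.eq_inv_iff_mul_eq_one (by rwa [constantCoeff_taylorOne]),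
    ← taylorOne_mul (hf.fun_inv h0) hf]
  have : (fun z => (f z)⁻¹ * f z) =ᶠ[𝓝 1] fun _ => 1 := by
    filter_upwards [hf.continuousAt.eventually_ne h0] with z hz using inv_mul_cancel₀ hz
  rw [taylorOne_congr this, taylorOne_const, map_one]

theorem hasseD_taylorOne (k : ℕ) (f : ℂ → ℂ) :
    hasseD k (taylorOne f) = taylorOne fun z => iteratedDeriv k f z / (k.factorial : ℂ) := by
  ext n
  rw [coeff_hasseD, coeff_taylorOne, coeff_taylorOne, iteratedDeriv_div_const, add_comm n k,
    Nat.cast_add_choose, add_comm k n]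
  have : iteratedDeriv n (iteratedDeriv k f) = iteratedDeriv (n + k) f := by
    simp only [iteratedDeriv_eq_iterate, Function.iterate_add_apply]
  rw [this]
  have h1 := Nat.cast_ne_zero (R := ℂ).mpr (Nat.factorial_ne_zero (n + k))
  have h2 := Nat.cast_ne_zero (R := ℂ).mpr (Nat.factorial_ne_zero k)
  have h3 := Nat.cast_ne_zero (R := ℂ).mpr (Nat.factorial_ne_zero n)
  field_simp

theorem derivative_taylorOne (f : ℂ → ℂ) :
    PowerSeries.derivative ℂ (taylorOne f) = taylorOne (deriv f) := by
  have h := derivative_hasseD 0 (taylorOne f)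
  rw [hasseD_zero, hasseD_taylorOne] at h
  simpa using h

/-- The Taylor series of `z ^ a` at `1`. -/
def powSeries (a : ℤ) : PowerSeries ℂ := taylorOne fun z => z ^ a

theorem analyticAt_zpow_one (a : ℤ) : AnalyticAt ℂ (fun z : ℂ => z ^ a) 1 :=
  analyticAt_id.fun_zpow one_ne_zero

theorem constantCoeff_powSeries (a : ℤ) : PowerSeries.constantCoeff (powSeries a) = 1 := by
  rw [powSeries, constantCoeff_taylorOne, one_zpow]

theorem powSeries_add (a b : ℤ) : powSeries (a + b) = powSeries a * powSeries b := by
  rw [powSeries, powSeries, powSeries, ← taylorOne_mul (analyticAt_zpow_one a)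
    (analyticAt_zpow_one b)]
  refine taylorOne_congr ?_
  filter_upwards [eventually_ne_nhds (one_ne_zero (α := ℂ))] with z hz using zpow_add₀ hz a b

theorem powSeries_natCast (n : ℕ) : powSeries n = (1 + PowerSeries.X) ^ n := by
  rw [powSeries, ← taylorOne_id, ← taylorOne_pow (f := fun z => z) analyticAt_id n]
  simp

/-- The binomial coefficient `x (x - 1) ⋯ (x - k + 1) / k!`. -/
def binom (x : ℂ) (k : ℕ) : ℂ := (∏ i ∈ Finset.range k, (x - i)) / (k.factorial : ℂ)

/-- The Euler-type operators `(1 + X)^k D^k / k!` have the series `(1 + X)^a` as eigenvectors, so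
they read off binomial coefficients of the exponents. -/
theorem hasseD_powSeries (k : ℕ) (a : ℤ) :
    (1 + PowerSeries.X) ^ k * hasseD k (powSeries a) = PowerSeries.C (binom a k) * powSeries a := by
  have h : ∀ z : ℂ, iteratedDeriv k (fun z : ℂ => z ^ a) z / (k.factorial : ℂ) =
      binom a k * z ^ (a - k) := fun z => by
    rw [iteratedDeriv_eq_iterate, iter_deriv_zpow, binom]
    ring
  rw [powSeries, hasseD_taylorOne]
  simp only [h]
  rw [taylorOne_const_mul _ (analyticAt_zpow_one _), ← powSeries_natCast, mul_left_comm]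
  change _ * (powSeries _ * powSeries _) = _
  rw [← powSeries_add, powSeries]
  simp

/-! ### Determinants of functionals of the exponents. -/

theorem det_apply_row {N : ℕ} (M : Matrix (Fin N) (Fin N) ℂ) :
    M.det = ∑ σ : Equiv.Perm (Fin N), ((Equiv.Perm.sign σ : ℤ) : ℂ) * ∏ i, M i (σ i) := by
  rw [← Matrix.det_transpose, Matrix.det_apply']
  rfl

/-- The determinantal formula for a Schur function, with the monomials in each variable replaced by
arbitrary functionals of the exponent. -/
theorem det_functional {N : ℕ} (l : Signature N) {ι : Type*} [Fintype ι] (a : ι → Fin N → ℤ)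
    (ha : ∀ u : Fin N → ℂ, (∀ i, u i ≠ 0) → schurFun l u = ∑ s, ∏ i, u i ^ a s i)
    (φ : Fin N → ℤ → ℂ) :
    (Matrix.of fun i j : Fin N => φ i (l.coord j.rev)).det =
      ∑ s, (Matrix.of fun i j : Fin N => φ i (a s i + (j : ℕ))).det := by
  -- Alternant minus Vandermonde times Schur function, as one vanishing combination of monomials:
  -- permutations index the former, pairs of a monomial and a permutation the latter.
  have h := sum_eq_zero_of_sum_monomials_eq_zero (ι := Equiv.Perm (Fin N) ⊕ ι × Equiv.Perm (Fin N))
    (Sum.elim (fun σ => ((Equiv.Perm.sign σ : ℤ) : ℂ)) (fun p => -((Equiv.Perm.sign p.2 : ℤ) : ℂ)))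
    (Sum.elim (fun σ i => l.coord (σ i).rev) (fun p i => a p.1 i + (p.2 i : ℕ))) ?_
    (fun e => ∏ i, φ i (e i))
  · simp only [Fintype.sum_sum_type, Sum.elim_inl, Sum.elim_inr, Fintype.sum_prod_type, neg_mul,
      Finset.sum_neg_distrib] at h
    simp only [det_apply_row, Matrix.of_apply]
    exact sub_eq_zero.mp (by rw [sub_eq_add_neg]; exact h)
  · intro u hu
    have h := vandermonde_mul_schurFun l u hu
    simp only [Fintype.sum_sum_type, Sum.elim_inl, Sum.elim_inr, Fintype.sum_prod_type, neg_mul,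
      Finset.sum_neg_distrib]
    rw [ha u hu, Finset.mul_sum] at h
    simp only [det_apply_row, Matrix.of_apply, Matrix.vandermonde_apply] at h
    rw [← h, ← sub_eq_add_neg, sub_eq_zero]
    refine Finset.sum_congr rfl fun s _ => ?_
    rw [Finset.sum_mul]
    refine Finset.sum_congr rfl fun σ _ => ?_
    rw [mul_assoc, ← Finset.prod_mul_distrib]
    congr 1
    refine Finset.prod_congr rfl fun i _ => ?_
    rw [zpow_add₀ (hu i), zpow_natCast, mul_comm]

/-- Symmetry of the Schur function as a function passes to its multiset of exponents by independence
of monomials. -/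
theorem sum_exponents_comp_perm {N : ℕ} (l : Signature N) {ι : Type*} [Fintype ι]
    (a : ι → Fin N → ℤ)
    (ha : ∀ u : Fin N → ℂ, (∀ i, u i ≠ 0) → schurFun l u = ∑ s, ∏ i, u i ^ a s i)
    (σ : Equiv.Perm (Fin N)) (φ : (Fin N → ℤ) → ℂ) : ∑ s, φ (a s ∘ σ) = ∑ s, φ (a s) := by
  have h := sum_eq_zero_of_sum_monomials_eq_zero (ι := ι ⊕ ι)
    (Sum.elim (fun _ => 1) (fun _ => -1)) (Sum.elim (fun s => a s ∘ σ) a) ?_ φ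
  · simpa [← sub_eq_add_neg, sub_eq_zero] using h
  · intro u hu
    have h := schurFun_comp_perm l σ⁻¹ hu
    rw [ha u hu, ha (u ∘ ⇑σ⁻¹) fun i => hu (σ⁻¹ i)] at h
    simp only [Fintype.sum_sum_type, Sum.elim_inl, Sum.elim_inr, one_mul, neg_mul,
      Finset.sum_neg_distrib, ← sub_eq_add_neg, sub_eq_zero]
    rw [← h]
    refine Finset.sum_congr rfl fun s _ => ?_
    refine Eq.trans ?_ (Equiv.prod_comp σ fun i => (u ∘ ⇑σ⁻¹) i ^ a s i)
    simp

/-- A coefficient of degree `i` of the product sees `F` only up to degree `i`, so truncation to `N`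
coefficients is compatible with multiplication. -/
theorem sum_coeff_mul_X_pow {N : ℕ} (f F : PowerSeries ℂ) (i : Fin N) :
    ∑ s : Fin N, PowerSeries.coeff i (f * PowerSeries.X ^ (s : ℕ)) * PowerSeries.coeff s F =
      PowerSeries.coeff i (f * F) := by
  rw [mul_comm f F, PowerSeries.coeff_mul, Finset.Nat.sum_antidiagonal_eq_sum_range_succ_mk,
    Fin.sum_univ_eq_sum_range
      (fun s => PowerSeries.coeff i (f * PowerSeries.X ^ s) * PowerSeries.coeff s F) N]
  refine (Finset.sum_subset_zero_on_sdiff (Finset.range_subset_range.mpr i.isLt) ?_ ?_).symm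
  · intro s hs
    simp only [Finset.mem_sdiff, Finset.mem_range, not_lt, Nat.succ_le_iff] at hs
    rw [PowerSeries.coeff_mul_X_pow', if_neg (by omega), zero_mul]
  · intro s hs
    have := Finset.mem_range.mp hs
    rw [PowerSeries.coeff_mul_X_pow', if_pos (by omega), mul_comm]

/-- Jacobi's formula for the derivative of the determinant at `A` in the direction `B`, by cofactor
expansion along each row. -/
theorem sum_det_updateRow {N : ℕ} (A B : Matrix (Fin N) (Fin N) ℂ) :
    ∑ p, (A.updateRow p (B p)).det = (A.adjugate * B).trace := by
  have h : ∀ p, (A.updateRow p (B p)).det = ∑ j, B p j * A.adjugate j p := by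
    intro p
    rw [← Matrix.cramer_transpose_apply, Matrix.cramer_eq_adjugate_mulVec,
      ← Matrix.adjugate_transpose]
    simp [Matrix.mulVec, dotProduct, mul_comm]
  simp only [h, Matrix.trace, Matrix.diag_apply, Matrix.mul_apply]
  rw [Finset.sum_comm]
  simp only [mul_comm]

/-- Jacobi's formula with `B = A * diagonal d`, where `adjugate A * A` is scalar. -/
theorem sum_det_updateRow_mul {N : ℕ} (A : Matrix (Fin N) (Fin N) ℂ) (d : Fin N → ℂ) :
    ∑ p, (A.updateRow p fun j => A p j * d j).det = (∑ j, d j) * A.det := by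
  have h := sum_det_updateRow A (A * Matrix.diagonal d)
  rw [← mul_assoc, Matrix.adjugate_mul, Matrix.smul_mul, one_mul, Matrix.trace_smul,
    Matrix.trace_diagonal, smul_eq_mul, mul_comm] at h
  rw [← h]
  refine Finset.sum_congr rfl fun p _ => ?_
  congr
  ext j
  rw [Matrix.mul_diagonal]

/-- The matrix `binom(j, s)`, the coefficients of `(1 + X) ^ j`. -/
def chooseMatrix (N : ℕ) : Matrix (Fin N) (Fin N) ℂ :=
  Matrix.of fun s j => ((j : ℕ).choose s : ℂ)

theorem det_chooseMatrix (N : ℕ) : (chooseMatrix N).det = 1 := by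
  rw [Matrix.det_of_isUpperTriangular]
  · simp [chooseMatrix]
  · intro s j hsj
    simp only [chooseMatrix, Matrix.of_apply]
    exact_mod_cast Nat.choose_eq_zero_of_lt hsj

theorem one_add_X_pow_eq {N : ℕ} (j : Fin N) :
    (1 + PowerSeries.X : PowerSeries ℂ) ^ (j : ℕ) =
      ∑ s : Fin N, ((j : ℕ).choose s : ℂ) • (PowerSeries.X : PowerSeries ℂ) ^ (s : ℕ) := by
  rw [Fin.sum_univ_eq_sum_range (fun s => ((j : ℕ).choose s : ℂ) •
    (PowerSeries.X : PowerSeries ℂ) ^ s) N, add_comm, add_pow]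
  refine Finset.sum_subset_zero_on_sdiff (Finset.range_subset_range.mpr j.isLt) ?_ ?_
  · intro s hs
    simp only [Finset.mem_sdiff, Finset.mem_range, not_lt, Nat.succ_le_iff] at hs
    rw [Nat.choose_eq_zero_of_lt (by omega)]
    simp
  · intro s _
    simp [Algebra.smul_def, mul_comm]

theorem matrix_mul_one_add_X_pow {N : ℕ} (T : PowerSeries ℂ →ₗ[ℂ] PowerSeries ℂ)
    (h : PowerSeries ℂ) :
    (Matrix.of fun i j : Fin N => PowerSeries.coeff i (T (h * (1 + PowerSeries.X) ^ (j : ℕ)))) =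
      (Matrix.of fun i s : Fin N => PowerSeries.coeff i (T (h * PowerSeries.X ^ (s : ℕ)))) *
        chooseMatrix N := by
  ext i j
  rw [Matrix.of_apply, one_add_X_pow_eq, Finset.mul_sum, map_sum, map_sum, Matrix.mul_apply]
  refine Finset.sum_congr rfl fun s _ => ?_
  simp only [mul_smul_comm, map_smul, smul_eq_mul, Matrix.of_apply, chooseMatrix]
  ring

/-- The matrix of the multiplication by `f` on truncated power series. -/
def toeplitz (N : ℕ) (f : PowerSeries ℂ) : Matrix (Fin N) (Fin N) ℂ :=
  Matrix.of fun i s => PowerSeries.coeff i (f * PowerSeries.X ^ (s : ℕ))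

theorem det_toeplitz {N : ℕ} {f : PowerSeries ℂ} (hf : PowerSeries.constantCoeff f = 1) :
    (toeplitz N f).det = 1 := by
  rw [Matrix.det_of_isLowerTriangular]
  · simp [toeplitz, PowerSeries.coeff_mul_X_pow', hf]
  · intro i s his
    have : (i : ℕ) < s := his
    simp only [toeplitz, Matrix.of_apply]
    rw [PowerSeries.coeff_mul_X_pow', if_neg (by omega)]

theorem adjugate_toeplitz {N : ℕ} {f : PowerSeries ℂ} (hf : PowerSeries.constantCoeff f = 1) :
    (toeplitz N f).adjugate = toeplitz N f⁻¹ := by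
  have h : toeplitz N f * toeplitz N f⁻¹ = 1 := by
    ext i j
    have := sum_coeff_mul_X_pow f (f⁻¹ * PowerSeries.X ^ (j : ℕ)) i
    rw [← mul_assoc, PowerSeries.mul_inv_cancel _ (by rw [hf]; exact one_ne_zero), one_mul,
      PowerSeries.coeff_X_pow] at this
    simp only [Matrix.mul_apply, toeplitz, Matrix.of_apply, this, Matrix.one_apply, Fin.ext_iff]
  calc (toeplitz N f).adjugate = (toeplitz N f).adjugate * (toeplitz N f * toeplitz N f⁻¹) := by
        rw [h, mul_one]
    _ = toeplitz N f⁻¹ := by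
        rw [← mul_assoc, Matrix.adjugate_mul, det_toeplitz hf, one_smul, one_mul]

/-- The multilinear form `det ([X^i] T_i (h_i (1 + X)^j))`. -/
def detForm {N : ℕ} (T : Fin N → PowerSeries ℂ →ₗ[ℂ] PowerSeries ℂ) :
    MultilinearMap ℂ (fun _ : Fin N => PowerSeries ℂ) ℂ :=
  (Matrix.detRowAlternating (R := ℂ) (n := Fin N)).toMultilinearMap.compLinearMap fun i =>
    LinearMap.pi fun j : Fin N => (PowerSeries.coeff (R := ℂ) (i : ℕ)) ∘ₗ T i ∘ₗ
      LinearMap.mulRight ℂ ((1 + PowerSeries.X : PowerSeries ℂ) ^ (j : ℕ))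

theorem detForm_apply {N : ℕ} (T : Fin N → PowerSeries ℂ →ₗ[ℂ] PowerSeries ℂ)
    (h : Fin N → PowerSeries ℂ) : detForm T h = (Matrix.of fun i j : Fin N =>
      PowerSeries.coeff i (T i (h i * (1 + PowerSeries.X) ^ (j : ℕ)))).det := rfl

/-- The form `∑_p detForm`, with the operator `T` applied to the `p`-th argument. -/
def traceForm (N : ℕ) (T : PowerSeries ℂ →ₗ[ℂ] PowerSeries ℂ) :
    MultilinearMap ℂ (fun _ : Fin N => PowerSeries ℂ) ℂ :=
  ∑ p, detForm fun i => if i = p then T else LinearMap.id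

theorem traceForm_apply {N : ℕ} (T : PowerSeries ℂ →ₗ[ℂ] PowerSeries ℂ)
    (h : Fin N → PowerSeries ℂ) : traceForm N T h =
      ∑ p, ((Matrix.of fun i j : Fin N =>
        PowerSeries.coeff i (h i * (1 + PowerSeries.X) ^ (j : ℕ))).updateRow p fun j : Fin N =>
          PowerSeries.coeff p (T (h p * (1 + PowerSeries.X) ^ (j : ℕ)))).det := by
  rw [traceForm, sum_apply]
  refine Finset.sum_congr rfl fun p _ => ?_
  rw [detForm_apply]
  congr 1
  ext i j
  by_cases hip : i = p
  · subst hip; simp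
  · simp [hip]

theorem detForm_id_diag {N : ℕ} {h : PowerSeries ℂ} (hh : PowerSeries.constantCoeff h = 1) :
    detForm (fun _ : Fin N => LinearMap.id) (fun _ => h) = 1 := by
  rw [detForm_apply]
  rw [matrix_mul_one_add_X_pow, Matrix.det_mul, det_chooseMatrix, mul_one]
  exact det_toeplitz hh

/-- On the diagonal the matrix is `toeplitz N h * chooseMatrix N`. In Jacobi's trace the unimodular
`chooseMatrix N` cancels by cyclicity, and the adjugate of `toeplitz N h` is multiplication by
`h⁻¹`; what remains is the trace of `f ↦ h⁻¹ T (h f)` in the basis `X^i`. -/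
theorem traceForm_diag {N : ℕ} (T : PowerSeries ℂ →ₗ[ℂ] PowerSeries ℂ) {h : PowerSeries ℂ}
    (hh : PowerSeries.constantCoeff h = 1) :
    traceForm N T (fun _ => h) =
      ∑ i : Fin N, PowerSeries.coeff i (h⁻¹ * T (h * PowerSeries.X ^ (i : ℕ))) := by
  rw [traceForm_apply]
  have h1 := matrix_mul_one_add_X_pow (N := N) LinearMap.id h
  have h2 := matrix_mul_one_add_X_pow (N := N) T h
  have h3 := sum_det_updateRow (Matrix.of fun i j : Fin N =>
    PowerSeries.coeff i (h * (1 + PowerSeries.X) ^ (j : ℕ))) (Matrix.of fun i j : Fin N =>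
    PowerSeries.coeff i (T (h * (1 + PowerSeries.X) ^ (j : ℕ))))
  refine h3.trans ?_
  change (Matrix.of fun i j : Fin N =>
    PowerSeries.coeff i (h * (1 + PowerSeries.X) ^ (j : ℕ))) = toeplitz N h * _ at h1
  rw [h1, h2, Matrix.adjugate_mul_distrib, adjugate_toeplitz hh, ← mul_assoc, Matrix.trace_mul_comm,
    ← mul_assoc, ← mul_assoc, Matrix.mul_adjugate, det_chooseMatrix, one_smul, one_mul, Matrix.trace]
  refine Finset.sum_congr rfl fun i _ => ?_
  rw [Matrix.diag_apply, Matrix.mul_apply, ← sum_coeff_mul_X_pow]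
  rfl

/-! ### Polarisation, and the reduction to diagonal values. -/

/-- Polarisation: a multilinear form on power series that vanishes on the diagonal at series with
constant coefficient `1` has zero symmetrisation at such series. -/
theorem sum_perm_eq_zero_of_diag_eq_zero {N : ℕ} (hN : 0 < N)
    (C : MultilinearMap ℂ (fun _ : Fin N => PowerSeries ℂ) ℂ)
    (hC : ∀ h : PowerSeries ℂ, PowerSeries.constantCoeff h = 1 → C (fun _ => h) = 0)
    (x : Fin N → PowerSeries ℂ) (hx : ∀ i, PowerSeries.constantCoeff (x i) = 1) :
    ∑ σ : Equiv.Perm (Fin N), C (fun i => x (σ i)) = 0 := by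
  -- The average of the `x j` over a nonempty `J` has constant coefficient `1`, and `C` is
  -- homogeneous. For empty `J` an argument vanishes, which uses that `N` is positive.
  have hdiag : ∀ J : Finset (Fin N), C (fun _ => ∑ j ∈ J, x j) = 0 := by
    intro J
    rcases J.eq_empty_or_nonempty with rfl | hJ
    · exact C.map_coord_zero ⟨0, hN⟩ (by simp)
    · have hc : ((J.card : ℕ) : ℂ) ≠ 0 := by exact_mod_cast hJ.card_pos.ne'
      have h1 : (fun _ : Fin N => ∑ j ∈ J, x j) = fun _ : Fin N =>
          (J.card : ℂ) • ((J.card : ℂ)⁻¹ • ∑ j ∈ J, x j) := by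
        ext1; rw [smul_smul, mul_inv_cancel₀ hc, one_smul]
      rw [h1, C.map_smul_univ (fun _ => (J.card : ℂ)), hC _ (by
        rw [← PowerSeries.coeff_zero_eq_constantCoeff_apply, map_smul, map_sum]
        simp [hx, hc]), smul_zero]
  -- Inclusion–exclusion: expanding multilinearly over index maps `r`, the alternating sum over the
  -- sets `J` that `r` avoids is zero unless `r` is surjective, that is, a permutation.
  have key : ∑ J : Finset (Fin N), ((-1 : ℤ) : ℂ) ^ J.card * C (fun _ => ∑ j ∈ Jᶜ, x j) =
      ∑ σ : Equiv.Perm (Fin N), C (fun i => x (σ i)) := by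
    have h1 : ∀ J : Finset (Fin N), C (fun _ => ∑ j ∈ Jᶜ, x j) =
        ∑ r : Fin N → Fin N, if J ⊆ (Finset.univ.image r)ᶜ then C (fun i => x (r i)) else 0 := by
      intro J
      rw [C.map_sum_finset (fun _ j => x j) (fun _ => Jᶜ), ← Finset.sum_filter]
      refine Finset.sum_congr ?_ fun _ _ => rfl
      ext r
      simp only [Fintype.mem_piFinset, Finset.mem_compl, Finset.mem_filter, Finset.mem_univ,
        true_and, Finset.subset_iff, Finset.mem_image, not_exists]
      exact ⟨fun h j hj i hij => h i (hij ▸ hj), fun h i hi => h hi i rfl⟩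
    simp only [h1, Finset.mul_sum]
    rw [Finset.sum_comm]
    have h2 : ∀ r : Fin N → Fin N, (∑ J : Finset (Fin N), ((-1 : ℤ) : ℂ) ^ J.card *
        if J ⊆ (Finset.univ.image r)ᶜ then C (fun i => x (r i)) else 0) =
        if Function.Bijective r then C (fun i => x (r i)) else 0 := by
      intro r
      have h3 := Finset.sum_powerset_neg_one_pow_card (x := (Finset.univ.image r)ᶜ)
      have h4 : (Finset.univ.image r)ᶜ = ∅ ↔ Function.Bijective r := by
        rw [Finset.compl_eq_empty_iff, Finset.eq_univ_iff_forall,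
          ← Finite.surjective_iff_bijective]
        simp [Function.Surjective]
      simp only [mul_ite, mul_zero, ← Finset.sum_filter, ← Finset.sum_mul]
      have h5 : (Finset.univ.filter fun J : Finset (Fin N) => J ⊆ (Finset.univ.image r)ᶜ) =
          ((Finset.univ.image r)ᶜ).powerset := by ext; simp
      rw [h5]
      have h6 := congrArg (Int.cast (R := ℂ)) h3
      simp only [Int.cast_sum, Int.cast_pow] at h6
      rw [h6]
      simp only [h4]
      split_ifs <;> simp
    simp only [h2, ← Finset.sum_filter]
    refine (Finset.sum_bij' (fun (σ : Equiv.Perm (Fin N)) _ => ⇑σ) (fun r hr => Equiv.ofBijective r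
      (Finset.mem_filter.mp hr).2) ?_ ?_ ?_ ?_ ?_).symm
    · exact fun σ _ => Finset.mem_filter.mpr ⟨Finset.mem_univ _, σ.bijective⟩
    · exact fun _ _ => Finset.mem_univ _
    · intro σ _; ext; rfl
    · intro r _; rfl
    · intro σ _; rfl
  rw [← key]
  exact Finset.sum_eq_zero fun J _ => by rw [hdiag, mul_zero]

/-- Averaging over permutations of the variables does not change the sum over the symmetric family
of exponents, and polarisation kills every average. Two multilinear forms may thus be exchanged once
they agree on the diagonal. -/
theorem sum_exponents_eq_zero {N : ℕ} (hN : 0 < N) (l : Signature N) {ι : Type*} [Fintype ι]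
    (a : ι → Fin N → ℤ)
    (ha : ∀ u : Fin N → ℂ, (∀ i, u i ≠ 0) → schurFun l u = ∑ s, ∏ i, u i ^ a s i)
    (C : MultilinearMap ℂ (fun _ : Fin N => PowerSeries ℂ) ℂ)
    (hC : ∀ h : PowerSeries ℂ, PowerSeries.constantCoeff h = 1 → C (fun _ => h) = 0) :
    ∑ s, C (fun i => powSeries (a s i)) = 0 := by
  have h1 : ∑ σ : Equiv.Perm (Fin N), ∑ s, C (fun i => powSeries (a s (σ i))) = 0 := by
    rw [Finset.sum_comm]
    exact Finset.sum_eq_zero fun s _ => sum_perm_eq_zero_of_diag_eq_zero hN C hC _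
      fun i => constantCoeff_powSeries _
  have h2 : ∀ σ : Equiv.Perm (Fin N), ∑ s, C (fun i => powSeries (a s (σ i))) =
      ∑ s, C (fun i => powSeries (a s i)) := fun σ =>
    sum_exponents_comp_perm l a ha σ fun e => C fun i => powSeries (e i)
  simp only [h2, Finset.sum_const, nsmul_eq_mul] at h1
  refine (mul_eq_zero.mp h1).resolve_left ?_
  rw [Finset.card_univ, Fintype.card_perm]
  exact_mod_cast Nat.factorial_ne_zero _

/-- The form `∏ h_i(0)`. -/
def constForm (N : ℕ) : MultilinearMap ℂ (fun _ : Fin N => PowerSeries ℂ) ℂ :=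
  (MultilinearMap.mkPiAlgebra ℂ (Fin N) ℂ).compLinearMap fun _ => PowerSeries.coeff 0

theorem constForm_apply {N : ℕ} {h : Fin N → PowerSeries ℂ}
    (hh : ∀ i, PowerSeries.constantCoeff (h i) = 1) : constForm N h = 1 := by
  simp [constForm, hh]

/-- The operator `(1 + X) ^ k D ^ k / k!`. -/
def fallD (k : ℕ) : PowerSeries ℂ →ₗ[ℂ] PowerSeries ℂ :=
  LinearMap.mulLeft ℂ ((1 + PowerSeries.X : PowerSeries ℂ) ^ k) ∘ₗ hasseD k

theorem fallD_apply (k : ℕ) (f : PowerSeries ℂ) :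
    fallD k f = (1 + PowerSeries.X) ^ k * hasseD k f := rfl

/-- Compares the determinant `A` of coefficients of `(1 + X)^(l_j + N - j)`, whose value is the
dimension, with its versions having `fallD k` applied in one row. -/
theorem sum_binom_mul_card {N : ℕ} (hN : 0 < N) (l : Signature N) {ι : Type*} [Fintype ι]
    (a : ι → Fin N → ℤ)
    (ha : ∀ u : Fin N → ℂ, (∀ i, u i ≠ 0) → schurFun l u = ∑ s, ∏ i, u i ^ a s i) (k : ℕ) :
    (∑ j, binom (l.coord j) k) * (Fintype.card ι : ℂ) =
      ∑ s, traceForm N (fallD k) (fun i => powSeries (a s i)) := by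
  set A : Matrix (Fin N) (Fin N) ℂ :=
    Matrix.of fun i j : Fin N => PowerSeries.coeff i (powSeries (l.coord j.rev)) with hA
  have hadd : ∀ (e : ℤ) (j : Fin N), powSeries (e + (j : ℕ)) =
      powSeries e * (1 + PowerSeries.X) ^ (j : ℕ) := fun e j => by
    rw [powSeries_add, powSeries_natCast]
  have hdet : A.det = (Fintype.card ι : ℂ) := by
    have h1 := det_functional l a ha fun i e => PowerSeries.coeff (i : ℕ) (powSeries e)
    -- Both forms equal `1` on the normalised diagonal; `constForm` plays the role of the constant
    -- `1` among multilinear forms.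
    have h2 := sum_exponents_eq_zero hN l a ha
      (detForm (fun _ : Fin N => LinearMap.id) - constForm N) fun h hh => by
        rw [sub_apply, detForm_id_diag hh, constForm_apply fun _ => hh, sub_self]
    simp only [sub_apply, constForm_apply fun _ => constantCoeff_powSeries _,
      Finset.sum_sub_distrib, sub_eq_zero] at h2
    simp only [hadd] at h1
    rw [hA, h1]
    refine Eq.trans ?_ (h2.trans ?_)
    · rfl
    · simp
  have hrow : ∀ p : Fin N, (A.updateRow p fun j => A p j * binom (l.coord j.rev) k).det =
      ∑ s, detForm (fun i => if i = p then fallD k else LinearMap.id)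
        (fun i => powSeries (a s i)) := by
    intro p
    have h1 := det_functional l a ha fun i e =>
      PowerSeries.coeff (i : ℕ) ((if i = p then fallD k else LinearMap.id) (powSeries e))
    simp only [hadd] at h1
    refine Eq.trans ?_ h1
    congr 1
    ext i j
    by_cases hip : i = p
    · subst hip
      simp only [Matrix.updateRow_self, Matrix.of_apply, if_true, fallD_apply, hasseD_powSeries,
        hA, PowerSeries.coeff_C_mul]
      ring
    · simp [hip, hA]
  have h3 := sum_det_updateRow_mul A fun j => binom (l.coord j.rev) k
  have h4 : ∑ j : Fin N, binom (l.coord j.rev) k = ∑ j, binom (l.coord j) k :=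
    Equiv.sum_comp Fin.revPerm fun j => binom (l.coord j) k
  rw [hdet, h4] at h3
  rw [← h3]
  simp only [hrow, traceForm, sum_apply]
  rw [Finset.sum_comm]

/-! ### Splitting off a reference series and reducing to k + 1 variables. -/

theorem mul_sum_neg_one_pow_choose {R : Type*} [CommRing R] (k : ℕ) (f : R) :
    f * ∑ j ∈ Finset.range (k + 1), ((-1) ^ j * ((k + 1).choose (j + 1) : R)) * f ^ j =
      1 - (1 - f) ^ (k + 1) := by
  rw [sub_eq_neg_add 1 f, add_pow, Finset.sum_range_succ' _ (k + 1), Finset.mul_sum]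
  simp only [one_pow, mul_one, pow_zero, Nat.choose_zero_right, Nat.cast_one]
  rw [sub_add_cancel_right, ← Finset.sum_neg_distrib]
  refine Finset.sum_congr rfl fun j _ => ?_
  rw [neg_pow f]
  ring

/-- As `X` divides `1 - f`, the inverse of `f` agrees up to degree `k` with `(1 - (1 - f)^(k+1)) /
f`, a polynomial of degree `k` in `f`. This is what makes `k + 1` variables enough. -/
theorem coeff_mul_inv_eq {k n : ℕ} (hn : n ≤ k) (P : PowerSeries ℂ) {f : PowerSeries ℂ}
    (hf : PowerSeries.constantCoeff f = 1) :
    PowerSeries.coeff n (P * f⁻¹) = PowerSeries.coeff n (P * ∑ j ∈ Finset.range (k + 1),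
      ((-1) ^ j * ((k + 1).choose (j + 1) : PowerSeries ℂ)) * f ^ j) := by
  have hf' : f⁻¹ * f = 1 := PowerSeries.inv_mul_cancel _ (by rw [hf]; exact one_ne_zero)
  set S := ∑ j ∈ Finset.range (k + 1),
      ((-1) ^ j * ((k + 1).choose (j + 1) : PowerSeries ℂ)) * f ^ j with hS
  have h1 : S = f⁻¹ - f⁻¹ * (1 - f) ^ (k + 1) := by
    have := mul_sum_neg_one_pow_choose k f
    rw [← hS] at this
    calc S = f⁻¹ * (f * S) := by rw [← mul_assoc, hf', one_mul]
      _ = _ := by rw [this, mul_sub, mul_one]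
  have h2 : (PowerSeries.X : PowerSeries ℂ) ^ (k + 1) ∣ P * (f⁻¹ * (1 - f) ^ (k + 1)) := by
    refine Dvd.dvd.mul_left (Dvd.dvd.mul_left (pow_dvd_pow_of_dvd ?_ _) _) _
    rw [PowerSeries.X_dvd_iff, map_sub, map_one, hf, sub_self]
  rw [h1, mul_sub, map_sub, PowerSeries.X_pow_dvd_iff.mp h2 n (by omega), sub_zero]

/-- Leibniz on `h * X ^ i` yields `binom(i, p.2)` times a coefficient that does not depend on `i`;
summing over `i` is the hockey-stick identity. -/
theorem traceForm_fallD_diag (N k : ℕ) {h : PowerSeries ℂ}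
    (hh : PowerSeries.constantCoeff h = 1) :
    traceForm N (fallD k) (fun _ => h) = ∑ p ∈ Finset.HasAntidiagonal.antidiagonal k,
      (N.choose (p.2 + 1) : ℂ) *
        PowerSeries.coeff p.2 ((1 + PowerSeries.X) ^ k * (hasseD p.1 h * h⁻¹)) := by
  rw [traceForm_diag _ hh]
  have h1 : ∀ i : ℕ, PowerSeries.coeff i (h⁻¹ * fallD k (h * PowerSeries.X ^ i)) =
      ∑ p ∈ Finset.HasAntidiagonal.antidiagonal k, (i.choose p.2 : ℂ) *
        PowerSeries.coeff p.2 ((1 + PowerSeries.X) ^ k * (hasseD p.1 h * h⁻¹)) := by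
    intro i
    rw [fallD_apply, hasseD_mul, Finset.mul_sum, Finset.mul_sum, map_sum]
    refine Finset.sum_congr rfl fun p _ => ?_
    have e : h⁻¹ * ((1 + PowerSeries.X) ^ k *
        (hasseD p.1 h * hasseD p.2 (PowerSeries.X ^ i : PowerSeries ℂ))) =
        PowerSeries.C (i.choose p.2 : ℂ) * ((1 + PowerSeries.X) ^ k * (hasseD p.1 h * h⁻¹) *
          PowerSeries.X ^ (i - p.2)) := by
      rw [hasseD_X_pow]; ring
    rw [e, PowerSeries.coeff_C_mul]
    by_cases hp : p.2 ≤ i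
    · rw [PowerSeries.coeff_mul_X_pow', if_pos (by omega), Nat.sub_sub_self hp]
    · rw [Nat.choose_eq_zero_of_lt (by omega)]; simp
  simp only [h1]
  rw [Finset.sum_comm]
  refine Finset.sum_congr rfl fun p _ => ?_
  rw [← Finset.sum_mul, Fin.sum_univ_eq_sum_range (fun i => (i.choose p.2 : ℂ)) N]
  congr 1
  rw [← Nat.cast_sum]
  congr 1
  induction N with
  | zero => simp
  | succ N ih => rw [Finset.sum_range_succ, ih, Nat.choose_succ_succ' N p.2, add_comm]

/-- The factor attached to the `s`-th variable. -/
def slotMap {N : ℕ} (G : PowerSeries ℂ) (b j : ℕ) (s : Fin N) :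
    PowerSeries ℂ →ₗ[ℂ] PowerSeries ℂ :=
  if (s : ℕ) = 0 then fallD b ∘ₗ LinearMap.mulRight ℂ G
  else if (s : ℕ) ≤ j then LinearMap.mulRight ℂ G
  else (Algebra.linearMap ℂ (PowerSeries ℂ)) ∘ₗ PowerSeries.coeff 0

/-- The form `∑_j (-1)^j binom(k+1, j+1) ∏_s slotMap_s (h_s)`, for `G = g⁻¹`. -/
def slotForm (N k : ℕ) (G : PowerSeries ℂ) (b : ℕ) :
    MultilinearMap ℂ (fun _ : Fin N => PowerSeries ℂ) (PowerSeries ℂ) :=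
  ∑ j ∈ Finset.range (k + 1), ((-1) ^ j * ((k + 1).choose (j + 1) : ℂ)) •
    (MultilinearMap.mkPiAlgebra ℂ (Fin N) (PowerSeries ℂ)).compLinearMap (slotMap G b j)

theorem slotForm_apply (N k : ℕ) (G : PowerSeries ℂ) (b : ℕ) (h : Fin N → PowerSeries ℂ) :
    slotForm N k G b h = ∑ j ∈ Finset.range (k + 1),
      ((-1) ^ j * ((k + 1).choose (j + 1) : ℂ)) • ∏ s, slotMap G b j s (h s) := by
  simp [slotForm, sum_apply]

/-- Slot `0` contributes `fallD b (h * G)`, slots `1` to `j` contribute `h * G`, the others the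
constant coefficient `1`. With `f = h * G` the sum over `j` is `fallD b f` times the truncated
inverse of `f`; the slots `0, …, k` must exist, whence `k + 1 ≤ N`. -/
theorem slotForm_diag {N k : ℕ} (hk : k + 1 ≤ N) (G : PowerSeries ℂ) (b : ℕ) {h : PowerSeries ℂ}
    (hh : PowerSeries.constantCoeff h = 1) :
    slotForm N k G b (fun _ => h) = fallD b (h * G) * ∑ j ∈ Finset.range (k + 1),
      ((-1) ^ j * ((k + 1).choose (j + 1) : PowerSeries ℂ)) * (h * G) ^ j := by
  rw [slotForm_apply, Finset.mul_sum]
  refine Finset.sum_congr rfl fun j hj => ?_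
  have hj' := Finset.mem_range.mp hj
  have hprod : ∏ s : Fin N, slotMap G b j s h = fallD b (h * G) * (h * G) ^ j := by
    obtain ⟨d, rfl⟩ := Nat.exists_eq_add_of_le (show 1 + j ≤ N by omega)
    rw [Fin.prod_univ_add, Fin.prod_univ_add]
    have h1 : ∀ i : Fin 1, slotMap G b j (Fin.castAdd d (Fin.castAdd j i)) h = fallD b (h * G) := by
      intro i
      simp [slotMap]
    have h2 : ∀ i : Fin j, slotMap G b j (Fin.castAdd d (Fin.natAdd 1 i)) h = h * G := by
      intro i
      have : 1 + (i : ℕ) ≤ j := by omega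
      simp [slotMap, this]
    have h3 : ∀ i : Fin d, slotMap G b j (Fin.natAdd (1 + j) i) h = 1 := by
      intro i
      have : ¬ (1 + j + (i : ℕ) ≤ j) := by omega
      simp [slotMap, this, hh]
    simp [h1, h2, h3]
  rw [hprod, Algebra.smul_def]
  simp only [map_mul, map_pow, map_neg, map_one, map_natCast]
  ring

/-- The deterministic main term, for the series `g`. -/
def mainTerm (N k : ℕ) (g : PowerSeries ℂ) : ℂ :=
  ∑ p ∈ Finset.HasAntidiagonal.antidiagonal k, (N.choose (p.2 + 1) : ℂ) *
    PowerSeries.coeff p.2 ((1 + PowerSeries.X) ^ k * (hasseD p.1 g * g⁻¹))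

/-- The error term, as a linear function of the series `B 1, B 2, …`. -/
def errorTerm (N k : ℕ) (g : PowerSeries ℂ) (B : ℕ → PowerSeries ℂ) : ℂ :=
  ∑ p ∈ Finset.HasAntidiagonal.antidiagonal k, (N.choose (p.2 + 1) : ℂ) *
    ∑ q ∈ Finset.HasAntidiagonal.antidiagonal p.1, if q.2 = 0 then 0 else
      PowerSeries.coeff p.2
        ((1 + PowerSeries.X) ^ (p.2 + q.1) * (hasseD q.1 g * g⁻¹) * B q.2)

/-- With `h = g f`, Leibniz gives `D^p h / h` as a sum of products of such quotients for `g` and for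
`f`. The terms with no derivative on `f` are independent of `h` and form the main term; in the
others `f⁻¹` is truncated. -/
theorem traceForm_diag_eq {N k : ℕ} (hk : k + 1 ≤ N) {g h : PowerSeries ℂ}
    (hg : PowerSeries.constantCoeff g = 1) (hh : PowerSeries.constantCoeff h = 1) :
    traceForm N (fallD k) (fun _ => h) =
      mainTerm N k g + errorTerm N k g fun b => slotForm N k g⁻¹ b fun _ => h := by
  rw [traceForm_fallD_diag N k hh, mainTerm, errorTerm, ← Finset.sum_add_distrib]
  refine Finset.sum_congr rfl fun p hp => ?_
  rw [← mul_add]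
  congr 1
  have hp' := Finset.HasAntidiagonal.mem_antidiagonal.mp hp
  have hgg : g⁻¹ * g = 1 := PowerSeries.inv_mul_cancel _ (by rw [hg]; exact one_ne_zero)
  set f := h * g⁻¹ with hf
  have hf1 : PowerSeries.constantCoeff f = 1 := by
    rw [hf, map_mul, hh, PowerSeries.constantCoeff_inv, hg]; simp
  have hff : f⁻¹ * f = 1 := PowerSeries.inv_mul_cancel _ (by rw [hf1]; exact one_ne_zero)
  have hhf : h = g * f := by
    rw [hf, mul_left_comm, mul_comm g, hgg, mul_one]
  have hinv : h⁻¹ = g⁻¹ * f⁻¹ := by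
    rw [hhf, PowerSeries.mul_inv_rev, mul_comm]
  have hexp : hasseD p.1 h * h⁻¹ = ∑ q ∈ Finset.HasAntidiagonal.antidiagonal p.1,
      (hasseD q.1 g * g⁻¹) * (hasseD q.2 f * f⁻¹) := by
    rw [hinv, hhf, hasseD_mul, Finset.sum_mul]
    exact Finset.sum_congr rfl fun q _ => by ring
  have hmain : hasseD p.1 g * g⁻¹ = ∑ q ∈ Finset.HasAntidiagonal.antidiagonal p.1,
      if q.2 = 0 then hasseD q.1 g * g⁻¹ else 0 := by
    rw [Finset.sum_eq_single (p.1, 0)]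
    · simp
    · rintro ⟨q1, q2⟩ hq hne
      have := Finset.HasAntidiagonal.mem_antidiagonal.mp hq
      rw [if_neg]
      rintro rfl
      simp only [add_zero] at this
      exact hne (by rw [this])
    · intro h
      simp at h
  rw [hexp, hmain, Finset.mul_sum, Finset.mul_sum, map_sum, map_sum, ← Finset.sum_add_distrib]
  refine Finset.sum_congr rfl fun q hq => ?_
  have hq' := Finset.HasAntidiagonal.mem_antidiagonal.mp hq
  by_cases hq2 : q.2 = 0
  · rw [if_pos hq2, if_pos hq2, hq2, hasseD_zero, mul_comm f, hff, mul_one, add_zero]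
  · rw [if_neg hq2, if_neg hq2, mul_zero, map_zero, zero_add, slotForm_diag hk _ _ hh, ← hf,
      fallD_apply]
    have e1 : (1 + PowerSeries.X : PowerSeries ℂ) ^ k * (hasseD q.1 g * g⁻¹ *
        (hasseD q.2 f * f⁻¹)) = ((1 + PowerSeries.X : PowerSeries ℂ) ^ k * (hasseD q.1 g * g⁻¹ *
        hasseD q.2 f)) * f⁻¹ := by ring
    rw [e1, coeff_mul_inv_eq (show p.2 ≤ k by omega) _ hf1]
    congr 1
    -- The factor `(1 + X) ^ q.2` goes into `fallD q.2`; the rest stays outside.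
    rw [show k = p.2 + q.1 + q.2 by omega, pow_add _ (p.2 + q.1)]
    ring

/-- The error term as a multilinear form. -/
def errorForm (N k : ℕ) (g : PowerSeries ℂ) :
    MultilinearMap ℂ (fun _ : Fin N => PowerSeries ℂ) ℂ :=
  ∑ p ∈ Finset.HasAntidiagonal.antidiagonal k, (N.choose (p.2 + 1) : ℂ) •
    ∑ q ∈ Finset.HasAntidiagonal.antidiagonal p.1, if q.2 = 0 then 0 else
      (PowerSeries.coeff (R := ℂ) p.2 ∘ₗ LinearMap.mulLeft ℂ
        ((1 + PowerSeries.X) ^ (p.2 + q.1) * (hasseD q.1 g * g⁻¹))).compMultilinearMap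
          (slotForm N k g⁻¹ q.2)

theorem errorForm_apply (N k : ℕ) (g : PowerSeries ℂ) (h : Fin N → PowerSeries ℂ) :
    errorForm N k g h = errorTerm N k g fun b => slotForm N k g⁻¹ b h := by
  simp only [errorForm, errorTerm, sum_apply, smul_apply, smul_eq_mul]
  refine Finset.sum_congr rfl fun p _ => ?_
  congr 1
  refine Finset.sum_congr rfl fun q _ => ?_
  split_ifs
  · rfl
  · rfl

theorem errorTerm_sum {ι : Type*} (N k : ℕ) (g : PowerSeries ℂ) (t : Finset ι)
    (B : ι → ℕ → PowerSeries ℂ) :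
    ∑ s ∈ t, errorTerm N k g (B s) = errorTerm N k g fun b => ∑ s ∈ t, B s b := by
  simp only [errorTerm]
  rw [Finset.sum_comm]
  refine Finset.sum_congr rfl fun p _ => ?_
  rw [← Finset.mul_sum, Finset.sum_comm]
  congr 1
  refine Finset.sum_congr rfl fun q _ => ?_
  split_ifs
  · simp
  · rw [Finset.mul_sum, map_sum]

theorem sum_binom_mul_card_eq {N k : ℕ} (hk : k + 1 ≤ N) (l : Signature N) {ι : Type*} [Fintype ι]
    (a : ι → Fin N → ℤ)
    (ha : ∀ u : Fin N → ℂ, (∀ i, u i ≠ 0) → schurFun l u = ∑ s, ∏ i, u i ^ a s i)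
    {g : PowerSeries ℂ} (hg : PowerSeries.constantCoeff g = 1) :
    (∑ j, binom (l.coord j) k) * (Fintype.card ι : ℂ) =
      (Fintype.card ι : ℂ) * mainTerm N k g +
        errorTerm N k g fun b => ∑ s, slotForm N k g⁻¹ b fun i => powSeries (a s i) := by
  have h := sum_exponents_eq_zero (by omega) l a ha
    (traceForm N (fallD k) - mainTerm N k g • constForm N - errorForm N k g) fun h hh => by
      rw [sub_apply, sub_apply, smul_apply,
        constForm_apply fun _ => hh, errorForm_apply, traceForm_diag_eq hk hg hh]
      simp
  simp only [sub_apply, smul_apply,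
    constForm_apply fun _ => constantCoeff_powSeries _, Finset.sum_sub_distrib, errorForm_apply,
    errorTerm_sum, ← sum_binom_mul_card (show 0 < N by omega) l a ha, smul_eq_mul, mul_one,
    Finset.sum_const, Finset.card_univ, nsmul_eq_mul] at h
  linear_combination h

/-! ### Cauchy coefficients on circles and tori. -/

open Metric in
/-- The `n`-th Laurent coefficient of `f` on the circle of radius `R` about `c`. -/
def circleCoeff (c : ℂ) (R : ℝ) (n : ℕ) (f : ℂ → ℂ) : ℂ :=
  ((2 * Real.pi : ℝ) : ℂ)⁻¹ *
    ∫ θ in (0 : ℝ)..2 * Real.pi, f (circleMap c R θ) / (circleMap 0 R θ) ^ n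

section circleCoeff
open Metric

variable {c : ℂ} {R : ℝ}

/-- Cauchy's formula links the integral to formal coefficients for the analytic factors. The
integral form itself needs no analyticity of the generating function: it is bounded by the supremum
norm and passes through dominated sums. -/
theorem circleCoeff_eq (hR : 0 < R) (n : ℕ) {f : ℂ → ℂ}
    (hf : DifferentiableOn ℂ f (closedBall c R)) :
    circleCoeff c R n f = iteratedDeriv n f c / (n.factorial : ℂ) := by
  have h := hf.circleIntegral_one_div_sub_center_pow_smul hR n
  have hpi : (2 * Real.pi * Complex.I : ℂ) ≠ 0 := Complex.two_pi_I_ne_zero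
  have h2 : circleIntegral (fun z => (1 / (z - c) ^ (n + 1)) • f z) c R =
      Complex.I * ∫ θ in (0 : ℝ)..2 * Real.pi, f (circleMap c R θ) / (circleMap 0 R θ) ^ n := by
    rw [circleIntegral, ← intervalIntegral.integral_const_mul]
    refine intervalIntegral.integral_congr fun θ _ => ?_
    have h0 : circleMap 0 R θ ≠ 0 := circleMap_ne_center hR.ne'
    simp only [deriv_circleMap, circleMap_sub_center, smul_eq_mul]
    field_simp
    ring
  rw [h2, smul_eq_mul] at h
  rw [circleCoeff]
  have hpi' : ((2 * Real.pi : ℝ) : ℂ) ≠ 0 := by exact_mod_cast Real.two_pi_pos.ne'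
  rw [inv_mul_eq_iff_eq_mul₀ hpi']
  refine mul_left_cancel₀ Complex.I_ne_zero (h.trans ?_)
  push_cast
  ring

theorem circleCoeff_congr (hR : 0 ≤ R) (n : ℕ) {f g : ℂ → ℂ} (h : ∀ z ∈ sphere c R, f z = g z) :
    circleCoeff c R n f = circleCoeff c R n g := by
  rw [circleCoeff, circleCoeff]
  congr 1
  refine intervalIntegral.integral_congr fun θ _ => ?_
  simp only [h _ (circleMap_mem_sphere c hR θ)]

theorem norm_circleCoeff_le (hR : 0 < R) (n : ℕ) {f : ℂ → ℂ} {B : ℝ}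
    (h : ∀ z ∈ sphere c R, ‖f z‖ ≤ B) : ‖circleCoeff c R n f‖ ≤ B / R ^ n := by
  have h1 : ‖∫ θ in (0 : ℝ)..2 * Real.pi, f (circleMap c R θ) / (circleMap 0 R θ) ^ n‖ ≤
      B / R ^ n * |2 * Real.pi - 0| := by
    refine intervalIntegral.norm_integral_le_of_norm_le_const fun θ _ => ?_
    rw [norm_div, norm_pow, norm_circleMap_zero, abs_of_pos hR]
    gcongr
    exact h _ (circleMap_mem_sphere c hR.le θ)
  rw [sub_zero, abs_of_pos Real.two_pi_pos] at h1
  rw [circleCoeff, norm_mul, norm_inv, Complex.norm_of_nonneg Real.two_pi_pos.le,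
    inv_mul_le_iff₀ Real.two_pi_pos]
  linarith

theorem continuous_circleCoeff_integrand (hR : 0 < R) (n : ℕ) {f : ℂ → ℂ}
    (hf : ContinuousOn f (sphere c R)) :
    Continuous fun θ : ℝ => f (circleMap c R θ) / (circleMap 0 R θ) ^ n :=
  (hf.comp_continuous (continuous_circleMap c R) (circleMap_mem_sphere c hR.le)).div₀
    ((continuous_circleMap 0 R).pow n) fun _ => pow_ne_zero _ (circleMap_ne_center hR.ne')

theorem circleCoeff_sub (hR : 0 < R) (n : ℕ) {f g : ℂ → ℂ}
    (hf : ContinuousOn f (sphere c R)) (hg : ContinuousOn g (sphere c R)) :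
    circleCoeff c R n (fun z => f z - g z) = circleCoeff c R n f - circleCoeff c R n g := by
  rw [circleCoeff, circleCoeff, circleCoeff, ← mul_sub, ← intervalIntegral.integral_sub
    ((continuous_circleCoeff_integrand hR n hf).intervalIntegrable _ _)
    ((continuous_circleCoeff_integrand hR n hg).intervalIntegrable _ _)]
  simp only [sub_div]

theorem circleCoeff_const_mul (n : ℕ) (a : ℂ) (f : ℂ → ℂ) :
    circleCoeff c R n (fun z => a * f z) = a * circleCoeff c R n f := by
  rw [circleCoeff, circleCoeff, mul_left_comm]
  congr 1
  rw [← intervalIntegral.integral_const_mul]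
  simp only [mul_div_assoc]

theorem circleCoeff_sum (hR : 0 < R) (n : ℕ) {ι : Type*} (t : Finset ι) {f : ι → ℂ → ℂ}
    (hf : ∀ i ∈ t, ContinuousOn (f i) (sphere c R)) :
    circleCoeff c R n (fun z => ∑ i ∈ t, f i z) = ∑ i ∈ t, circleCoeff c R n (f i) := by
  simp only [circleCoeff]
  rw [← Finset.mul_sum, ← intervalIntegral.integral_finsetSum fun i hi =>
    (continuous_circleCoeff_integrand hR n (hf i hi)).intervalIntegrable _ _]
  simp only [Finset.sum_div]

theorem hasSum_circleCoeff (hR : 0 < R) (n : ℕ) {ι : Type*} [Countable ι] {f : ι → ℂ → ℂ}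
    {g : ℂ → ℂ} {B : ι → ℝ} (hf : ∀ i, ContinuousOn (f i) (sphere c R))
    (hB : ∀ i, ∀ z ∈ sphere c R, ‖f i z‖ ≤ B i) (hBs : Summable B)
    (hs : ∀ z ∈ sphere c R, HasSum (fun i => f i z) (g z)) :
    HasSum (fun i => circleCoeff c R n (f i)) (circleCoeff c R n g) := by
  refine HasSum.mul_left _ ?_
  refine intervalIntegral.hasSum_integral_of_dominated_convergence
    (fun i _ => B i / R ^ n) (fun i => ?_) (fun i => ?_) ?_ ?_ ?_
  · exact (continuous_circleCoeff_integrand hR n (hf i)).aestronglyMeasurable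
  · refine .of_forall fun θ _ => ?_
    rw [norm_div, norm_pow, norm_circleMap_zero, abs_of_pos hR]
    gcongr
    exact hB i _ (circleMap_mem_sphere c hR.le θ)
  · exact .of_forall fun _ _ => hBs.div_const _
  · exact intervalIntegrable_const
  · exact .of_forall fun θ _ => (hs _ (circleMap_mem_sphere c hR.le θ)).div_const _

theorem continuousOn_circleCoeff (hR : 0 < R) (n : ℕ) {c' : ℂ} {F : ℂ → ℂ → ℂ}
    (hF : ContinuousOn (Function.uncurry F) (sphere c R ×ˢ sphere c' R)) :
    ContinuousOn (fun z => circleCoeff c R n fun w => F w z) (sphere c' R) := by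
  rw [continuousOn_iff_continuous_domRestrict]
  refine continuous_const.mul ?_
  refine intervalIntegral.continuous_parametric_intervalIntegral_of_continuous'
    (f := fun (z : sphere c' R) θ => F (circleMap c R θ) z / (circleMap 0 R θ) ^ n) ?_ _ _
  have h1 : Continuous fun p : sphere c' R × ℝ => ((circleMap c R p.2, (p.1 : ℂ)) : ℂ × ℂ) :=
    ((continuous_circleMap c R).comp continuous_snd).prodMk (continuous_subtype_val.comp continuous_fst)
  refine (hF.comp_continuous h1 fun p => ?_).div₀
    (((continuous_circleMap 0 R).comp continuous_snd).pow n)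
      fun _ => pow_ne_zero _ (circleMap_ne_center hR.ne')
  exact ⟨circleMap_mem_sphere c hR.le p.2, p.1.2⟩

end circleCoeff

/-- The coefficient of `w ^ b (z - 1) ^ q` of `F`, as an integral over a torus. -/
def torusCoeff (R : ℝ) (b q : ℕ) (F : ℂ → ℂ → ℂ) : ℂ :=
  circleCoeff 1 R q fun z => circleCoeff 0 R b fun w => F w z

section torusCoeff
open Metric

variable {R : ℝ}

theorem continuousOn_left {F : ℂ → ℂ → ℂ}
    (hF : ContinuousOn (Function.uncurry F) (sphere 0 R ×ˢ sphere 1 R)) {z : ℂ}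
    (hz : z ∈ sphere (1 : ℂ) R) : ContinuousOn (fun w => F w z) (sphere 0 R) :=
  hF.comp (f := fun w : ℂ => (w, z)) (by fun_prop) fun _ hw => ⟨hw, hz⟩

theorem torusCoeff_congr (hR : 0 ≤ R) (b q : ℕ) {F G : ℂ → ℂ → ℂ}
    (h : ∀ w ∈ sphere (0 : ℂ) R, ∀ z ∈ sphere (1 : ℂ) R, F w z = G w z) :
    torusCoeff R b q F = torusCoeff R b q G :=
  circleCoeff_congr hR q fun z hz => circleCoeff_congr hR b fun w hw => h w hw z hz

theorem norm_torusCoeff_le (hR : 0 < R) (b q : ℕ) {F : ℂ → ℂ → ℂ} {B : ℝ}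
    (h : ∀ w ∈ sphere (0 : ℂ) R, ∀ z ∈ sphere (1 : ℂ) R, ‖F w z‖ ≤ B) :
    ‖torusCoeff R b q F‖ ≤ B / R ^ b / R ^ q :=
  norm_circleCoeff_le hR q fun z hz => norm_circleCoeff_le hR b fun w hw => h w hw z hz

theorem torusCoeff_const_mul (b q : ℕ) (a : ℂ) (F : ℂ → ℂ → ℂ) :
    torusCoeff R b q (fun w z => a * F w z) = a * torusCoeff R b q F := by
  simp only [torusCoeff, circleCoeff_const_mul]

theorem torusCoeff_sub (hR : 0 < R) (b q : ℕ) {F G : ℂ → ℂ → ℂ}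
    (hF : ContinuousOn (Function.uncurry F) (sphere 0 R ×ˢ sphere 1 R))
    (hG : ContinuousOn (Function.uncurry G) (sphere 0 R ×ˢ sphere 1 R)) :
    torusCoeff R b q (fun w z => F w z - G w z) = torusCoeff R b q F - torusCoeff R b q G := by
  rw [torusCoeff, torusCoeff, torusCoeff, ← circleCoeff_sub hR q
    (continuousOn_circleCoeff hR b hF) (continuousOn_circleCoeff hR b hG)]
  exact circleCoeff_congr hR.le q fun z hz =>
    circleCoeff_sub hR b (continuousOn_left hF hz) (continuousOn_left hG hz)

theorem torusCoeff_sum (hR : 0 < R) (b q : ℕ) {ι : Type*} (t : Finset ι) {F : ι → ℂ → ℂ → ℂ}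
    (hF : ∀ i ∈ t, ContinuousOn (Function.uncurry (F i)) (sphere 0 R ×ˢ sphere 1 R)) :
    torusCoeff R b q (fun w z => ∑ i ∈ t, F i w z) = ∑ i ∈ t, torusCoeff R b q (F i) := by
  simp only [torusCoeff]
  rw [← circleCoeff_sum hR q t fun i hi => continuousOn_circleCoeff hR b (hF i hi)]
  exact circleCoeff_congr hR.le q fun z hz =>
    circleCoeff_sum hR b t fun i hi => continuousOn_left (hF i hi) hz

theorem hasSum_torusCoeff (hR : 0 < R) (b q : ℕ) {ι : Type*} [Countable ι] {F : ι → ℂ → ℂ → ℂ}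
    {G : ℂ → ℂ → ℂ} {B : ι → ℝ}
    (hF : ∀ i, ContinuousOn (Function.uncurry (F i)) (sphere 0 R ×ˢ sphere 1 R))
    (hB : ∀ i, ∀ w ∈ sphere (0 : ℂ) R, ∀ z ∈ sphere (1 : ℂ) R, ‖F i w z‖ ≤ B i) (hBs : Summable B)
    (hs : ∀ w ∈ sphere (0 : ℂ) R, ∀ z ∈ sphere (1 : ℂ) R, HasSum (fun i => F i w z) (G w z)) :
    HasSum (fun i => torusCoeff R b q (F i)) (torusCoeff R b q G) :=
  hasSum_circleCoeff hR q (fun i => continuousOn_circleCoeff hR b (hF i))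
    (fun i z hz => norm_circleCoeff_le hR b fun w hw => hB i w hw z hz) (hBs.div_const _)
    fun z hz => hasSum_circleCoeff hR b (fun i => continuousOn_left (hF i) hz)
      (fun i w hw => hB i w hw z hz) hBs fun w hw => hs w hw z hz

theorem torusCoeff_one (hR : 0 < R) {b : ℕ} (hb : b ≠ 0) (q : ℕ) :
    torusCoeff R b q (fun _ _ => 1) = 0 := by
  have h : ∀ z ∈ sphere (1 : ℂ) R, (circleCoeff 0 R b fun _ => 1) = (0 : ℂ) * 1 := fun z _ => by
    rw [circleCoeff_eq hR b (differentiableOn_const _), iteratedDeriv_const, if_neg hb]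
    simp
  rw [torusCoeff, circleCoeff_congr hR.le q h, circleCoeff_const_mul, zero_mul]

theorem iteratedDeriv_comp_one_add_mul (f : ℂ → ℂ) (z : ℂ) (b : ℕ) :
    iteratedDeriv b (fun w => f ((1 + w) * z)) =
      fun w => z ^ b * iteratedDeriv b f ((1 + w) * z) := by
  induction b with
  | zero => simp
  | succ b ih =>
    ext w
    rw [iteratedDeriv_succ, ih, deriv_const_mul_field, iteratedDeriv_succ]
    rw [deriv_comp_const_add (f := fun y => iteratedDeriv b f (y * z)) 1 w]
    have : (fun y => iteratedDeriv b f (y * z)) = fun y => iteratedDeriv b f (z * y) := by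
      ext y; rw [mul_comm]
    rw [this, deriv_comp_mul_left z (iteratedDeriv b f), smul_eq_mul, mul_comm z (1 + w)]
    ring

theorem one_add_mul_mem_ball {η : ℝ} (hη : 0 < η) (hη1 : η ≤ 1) {w z : ℂ}
    (hw : w ∈ closedBall (0 : ℂ) (η / 4)) (hz : z ∈ closedBall (1 : ℂ) (η / 4)) :
    (1 + w) * z ∈ closedBall (1 : ℂ) (3 * η / 4) := by
  rw [mem_closedBall, dist_eq_norm] at *
  rw [sub_zero] at hw
  have h1 : (1 + w) * z - 1 = (z - 1) + w + w * (z - 1) := by ring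
  rw [h1]
  have h2 := norm_add_le ((z - 1) + w) (w * (z - 1))
  have h3 := norm_add_le (z - 1) w
  have h4 : ‖w * (z - 1)‖ ≤ η / 4 * (1 / 4) := by
    rw [norm_mul]
    exact mul_le_mul hw (hz.trans (by linarith)) (norm_nonneg _) (by linarith)
  linarith

theorem differentiableOn_iteratedDeriv {U : Set ℂ} (hU : IsOpen U) {f : ℂ → ℂ}
    (hf : DifferentiableOn ℂ f U) (b : ℕ) : DifferentiableOn ℂ (iteratedDeriv b f) U := by
  intro z hz
  rw [iteratedDeriv_eq_iterate]
  exact ((hf.analyticAt (hU.mem_nhds hz)).iterated_deriv b).differentiableAt.differentiableWithinAt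

/-- The coefficient of `w ^ b` in `f ((1 + w) z)` is `z ^ b` times the normalised `b`-th derivative
of `f`, the analytic counterpart of `fallD b`. -/
theorem torusCoeff_mul {η : ℝ} (hη : 0 < η) (hη1 : η ≤ 1) (b q : ℕ) {f ψ : ℂ → ℂ}
    (hf : DifferentiableOn ℂ f (ball 1 η)) (hψ : DifferentiableOn ℂ ψ (ball 1 η)) :
    torusCoeff (η / 4) b q (fun w z => f ((1 + w) * z) * ψ z) =
      PowerSeries.coeff q (fallD b (taylorOne f) * taylorOne ψ) := by
  have hδ : 0 < η / 4 := by linarith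
  have hsub : closedBall (1 : ℂ) (η / 4) ⊆ ball 1 η := closedBall_subset_ball (by linarith)
  have hsub' : closedBall (1 : ℂ) (3 * η / 4) ⊆ ball 1 η := closedBall_subset_ball (by linarith)
  have h1 : ∀ z ∈ sphere (1 : ℂ) (η / 4),
      (circleCoeff 0 (η / 4) b fun w => f ((1 + w) * z) * ψ z) =
        z ^ b * (iteratedDeriv b f z / (b.factorial : ℂ)) * ψ z := by
    intro z hz
    have hz' := sphere_subset_closedBall hz
    have h2 : (fun w => f ((1 + w) * z) * ψ z) = fun w => ψ z * f ((1 + w) * z) := by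
      ext; rw [mul_comm]
    rw [h2, circleCoeff_const_mul, circleCoeff_eq hδ b, iteratedDeriv_comp_one_add_mul]
    · simp only [add_zero, one_mul]; ring
    · refine hf.comp (f := fun w => (1 + w) * z) (by fun_prop) fun w hw => ?_
      exact hsub' (one_add_mul_mem_ball hη hη1 hw hz')
  have hball : (1 : ℂ) ∈ ball (1 : ℂ) η := mem_ball_self hη
  have hfb := differentiableOn_iteratedDeriv isOpen_ball hf b
  have ha1 : AnalyticAt ℂ (fun z : ℂ => z ^ b) 1 := by fun_prop
  have ha2 : AnalyticAt ℂ (fun z => iteratedDeriv b f z / (b.factorial : ℂ)) 1 :=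
    (hfb.analyticAt (isOpen_ball.mem_nhds hball)).div analyticAt_const
      (by exact_mod_cast Nat.factorial_ne_zero b)
  have ha3 : AnalyticAt ℂ ψ 1 := hψ.analyticAt (isOpen_ball.mem_nhds hball)
  rw [torusCoeff, circleCoeff_congr hδ.le q h1, circleCoeff_eq hδ q, ← coeff_taylorOne,
    taylorOne_mul (ha1.fun_mul ha2) ha3, taylorOne_mul ha1 ha2, fallD_apply, hasseD_taylorOne,
    taylorOne_pow (f := fun z => z) analyticAt_id b, ← taylorOne_id]
  · refine DifferentiableOn.mul (DifferentiableOn.mul (by fun_prop) ?_) (hψ.mono hsub)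
    exact (hfb.mono hsub).div_const _

end torusCoeff

/-! ### The slot forms as torus coefficients. -/

open Metric

/-- The point `((1 + w) z, z, …, z, 1, …, 1)` with `j` coordinates `z`. -/
def slotPoint (k j : ℕ) (w z : ℂ) : Fin (k + 1) → ℂ :=
  fun s => if (s : ℕ) = 0 then (1 + w) * z else if (s : ℕ) ≤ j then z else 1

/-- The alternating sum over `j` of the values of `S / ∏ g` at the points `slotPoint k j w z`. -/
def slotFun (k : ℕ) (g : ℂ → ℂ) (S : (Fin (k + 1) → ℂ) → ℂ) (w z : ℂ) : ℂ :=
  ∑ j ∈ Finset.range (k + 1), ((-1) ^ j * ((k + 1).choose (j + 1) : ℂ)) *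
    (S (slotPoint k j w z) / (g ((1 + w) * z) * g z ^ j))

/-- The factors in the variable `z` of a monomial at `slotPoint k j w z`. -/
def slotProd {N : ℕ} (g : ℂ → ℂ) (a : Fin N → ℤ) (j : ℕ) (z : ℂ) : ℂ :=
  ∏ i : Fin N, if (i : ℕ) = 0 then 1 else if (i : ℕ) ≤ j then z ^ a i * (g z)⁻¹ else 1

theorem prod_slotPoint {N k j : ℕ} (hk : k + 1 ≤ N) (hj : j ≤ k) (g : ℂ → ℂ) (a : Fin N → ℤ)
    (w z : ℂ) :
    (∏ i, padOne N (slotPoint k j w z) i ^ a i) / (g ((1 + w) * z) * g z ^ j) =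
      (((1 + w) * z) ^ a ⟨0, by omega⟩ * (g ((1 + w) * z))⁻¹) * slotProd g a j z := by
  have hv : ∀ i : Fin N, padOne N (slotPoint k j w z) i =
      if (i : ℕ) = 0 then (1 + w) * z else if (i : ℕ) ≤ j then z else 1 := by
    intro i
    unfold padOne slotPoint
    split_ifs <;> first | rfl | omega
  simp only [hv, slotProd]
  obtain ⟨d, rfl⟩ := Nat.exists_eq_add_of_le (show 1 + j ≤ N by omega)
  simp only [Fin.prod_univ_add]
  have h2 : ∀ i : Fin j, 1 + (i : ℕ) ≤ j := fun i => by omega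
  have h3 : ∀ i : Fin d, ¬ (1 + j + (i : ℕ) ≤ j) := fun i => by omega
  have h0 : ∀ i : Fin 1, Fin.castAdd d (Fin.castAdd j i) = ⟨0, by omega⟩ := fun i => by
    ext; simp
  simp only [Fin.val_castAdd, Fin.val_natAdd, h2, h3, if_true, if_false,
    Nat.add_eq_zero_iff, one_ne_zero, false_and, one_zpow, Finset.prod_const_one, mul_one,
    Finset.univ_unique, Finset.card_singleton, pow_one, Finset.prod_mul_distrib, Finset.prod_const,
    Finset.card_univ, Fintype.card_fin, one_mul, h0]
  rw [div_eq_mul_inv, mul_inv, inv_pow]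
  ring

section slotProd
variable {η : ℝ} {g : ℂ → ℂ}

theorem differentiableOn_zpow_mul_inv (hη1 : η ≤ 1) (hg : DifferentiableOn ℂ g (ball 1 η))
    (hg0 : ∀ x ∈ ball (1 : ℂ) η, g x ≠ 0) (e : ℤ) :
    DifferentiableOn ℂ (fun x => x ^ e * (g x)⁻¹) (ball 1 η) := by
  intro x hx
  have hx0 : x ≠ 0 := by
    rintro rfl
    simp only [mem_ball, dist_eq_norm, zero_sub, norm_neg, norm_one] at hx
    linarith
  have h1 : DifferentiableAt ℂ (fun x : ℂ => x ^ e) x := differentiableAt_zpow.mpr (.inl hx0)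
  exact h1.differentiableWithinAt.mul ((hg x hx).inv (hg0 x hx))

theorem differentiableOn_slotProd (hη1 : η ≤ 1) (hg : DifferentiableOn ℂ g (ball 1 η))
    (hg0 : ∀ x ∈ ball (1 : ℂ) η, g x ≠ 0) {N : ℕ} (a : Fin N → ℤ) (j : ℕ) :
    DifferentiableOn ℂ (slotProd g a j) (ball 1 η) := by
  refine DifferentiableOn.fun_finsetProd fun i _ => ?_
  split_ifs
  · exact differentiableOn_const _
  · exact differentiableOn_zpow_mul_inv hη1 hg hg0 _
  · exact differentiableOn_const _

theorem taylorOne_zpow_mul_inv (hη : 0 < η) (hg : DifferentiableOn ℂ g (ball 1 η))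
    (hg0 : ∀ x ∈ ball (1 : ℂ) η, g x ≠ 0) (e : ℤ) :
    taylorOne (fun x => x ^ e * (g x)⁻¹) = powSeries e * (taylorOne g)⁻¹ := by
  have hga : AnalyticAt ℂ g 1 := hg.analyticAt (isOpen_ball.mem_nhds (mem_ball_self hη))
  have hg1 := hg0 1 (mem_ball_self hη)
  rw [taylorOne_mul (analyticAt_zpow_one e) (hga.fun_inv hg1), taylorOne_inv hga hg1]
  rfl

theorem prod_slotMap (hη : 0 < η) (hη1 : η ≤ 1) (hg : DifferentiableOn ℂ g (ball 1 η))
    (hg0 : ∀ x ∈ ball (1 : ℂ) η, g x ≠ 0) {N : ℕ} (hN : 0 < N) (b j : ℕ) (a : Fin N → ℤ) :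
    ∏ i, slotMap (taylorOne g)⁻¹ b j i (powSeries (a i)) =
      fallD b (taylorOne fun x => x ^ a ⟨0, hN⟩ * (g x)⁻¹) * taylorOne (slotProd g a j) := by
  have h1 : ∀ i, slotMap (taylorOne g)⁻¹ b j i (powSeries (a i)) =
      (if i = ⟨0, hN⟩ then fallD b (taylorOne fun x => x ^ a ⟨0, hN⟩ * (g x)⁻¹) else 1) *
        taylorOne (fun z => if (i : ℕ) = 0 then 1 else if (i : ℕ) ≤ j then z ^ a i * (g z)⁻¹
          else 1) := by
    intro i
    by_cases hi : (i : ℕ) = 0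
    · have hi' : i = ⟨0, hN⟩ := Fin.ext hi
      subst hi'
      simp [slotMap, taylorOne_const, taylorOne_zpow_mul_inv hη hg hg0]
    · have hi' : i ≠ ⟨0, hN⟩ := fun h => hi (by rw [h])
      simp only [slotMap, if_neg hi, if_neg hi', one_mul]
      split_ifs
      · simp [taylorOne_zpow_mul_inv hη hg hg0]
      · simp [taylorOne_const, constantCoeff_powSeries]
  simp only [h1, Finset.prod_mul_distrib, Finset.prod_ite_eq', Finset.mem_univ, if_true]
  congr 1
  unfold slotProd
  rw [taylorOne_prod]
  intro i _
  split_ifs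
  · exact analyticAt_const
  · exact (differentiableOn_zpow_mul_inv hη1 hg hg0 _).analyticAt
      (isOpen_ball.mem_nhds (mem_ball_self hη))
  · exact analyticAt_const

theorem continuousOn_comp_mul (hη : 0 < η) (hη1 : η ≤ 1) {f ψ : ℂ → ℂ}
    (hf : ContinuousOn f (ball 1 η)) (hψ : ContinuousOn ψ (ball 1 η)) :
    ContinuousOn (Function.uncurry fun w z => f ((1 + w) * z) * ψ z)
      (sphere 0 (η / 4) ×ˢ sphere 1 (η / 4)) := by
  refine ContinuousOn.mul ?_ ?_
  · refine hf.comp (f := fun p : ℂ × ℂ => (1 + p.1) * p.2) (by fun_prop) fun p hp => ?_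
    exact closedBall_subset_ball (by linarith) (one_add_mul_mem_ball hη hη1
      (sphere_subset_closedBall hp.1) (sphere_subset_closedBall hp.2))
  · refine hψ.comp (f := fun p : ℂ × ℂ => p.2) (by fun_prop) fun p hp => ?_
    exact closedBall_subset_ball (by linarith) (sphere_subset_closedBall hp.2)

theorem slotFun_eq_sum (hη : 0 < η) (hη1 : η ≤ 1) {N k : ℕ} (hk : k + 1 ≤ N) {l : Signature N}
    {ι : Type*} [Fintype ι] {a : ι → Fin N → ℤ}
    (ha : ∀ u : Fin N → ℂ, (∀ i, u i ≠ 0) → schurFun l u = ∑ s, ∏ i, u i ^ a s i)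
    {w z : ℂ} (hw : w ∈ sphere (0 : ℂ) (η / 4)) (hz : z ∈ sphere (1 : ℂ) (η / 4)) :
    slotFun k g (fun u => schurFun l (padOne N u)) w z = ∑ s, ∑ j ∈ Finset.range (k + 1),
      ((-1) ^ j * ((k + 1).choose (j + 1) : ℂ)) *
        ((fun x => x ^ a s ⟨0, by omega⟩ * (g x)⁻¹) ((1 + w) * z) * slotProd g (a s) j z) := by
  have hne : ∀ x ∈ closedBall (1 : ℂ) (3 * η / 4), x ≠ 0 := by
    rintro x hx rfl
    simp only [mem_closedBall, dist_eq_norm, zero_sub, norm_neg, norm_one] at hx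
    linarith
  have hw' := sphere_subset_closedBall hw
  have hz' := sphere_subset_closedBall hz
  have h1 := hne _ (one_add_mul_mem_ball hη hη1 hw' hz')
  have h2 := hne z (closedBall_subset_closedBall (by linarith) hz')
  rw [slotFun, Finset.sum_comm]
  refine Finset.sum_congr rfl fun j hj => ?_
  have hj' : j ≤ k := Nat.lt_succ_iff.mp (Finset.mem_range.mp hj)
  rw [ha _ (padOne_ne_zero fun i => by unfold slotPoint; split_ifs <;> first | assumption | simp),
    Finset.sum_div, Finset.mul_sum]
  exact Finset.sum_congr rfl fun s _ => by rw [prod_slotPoint hk hj']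

theorem continuousOn_slotFun_schurFun (hη : 0 < η) (hη1 : η ≤ 1)
    (hg : DifferentiableOn ℂ g (ball 1 η)) (hg0 : ∀ x ∈ ball (1 : ℂ) η, g x ≠ 0) {N k : ℕ}
    (hk : k + 1 ≤ N) (l : Signature N) :
    ContinuousOn (Function.uncurry (slotFun k g fun u => schurFun l (padOne N u)))
      (sphere 0 (η / 4) ×ˢ sphere 1 (η / 4)) := by
  obtain ⟨ι, hι, hne, a, ha⟩ := exists_schurFun_eq_sum l
  have h : ContinuousOn (fun p : ℂ × ℂ => ∑ s, ∑ j ∈ Finset.range (k + 1),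
      ((-1) ^ j * ((k + 1).choose (j + 1) : ℂ)) *
        (Function.uncurry fun w z => (fun x => x ^ a s ⟨0, by omega⟩ * (g x)⁻¹) ((1 + w) * z) *
          slotProd g (a s) j z) p) (sphere 0 (η / 4) ×ˢ sphere 1 (η / 4)) := by
    refine continuousOn_finsetSum _ fun s _ => continuousOn_finsetSum _ fun j _ => ?_
    exact continuousOn_const.mul (continuousOn_comp_mul hη hη1
      (differentiableOn_zpow_mul_inv hη1 hg hg0 _).continuousOn
      (differentiableOn_slotProd hη1 hg hg0 _ _).continuousOn)
  exact h.congr fun p hp => slotFun_eq_sum hη hη1 hk ha hp.1 hp.2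

/-- Matches the formal and the analytic side monomial by monomial: the variable `w` in slot `0`
generates the operators `fallD b`, and setting the remaining slots to `z` or `1` corresponds to
`slotMap`. -/
theorem torusCoeff_slotFun_schurFun (hη : 0 < η) (hη1 : η ≤ 1)
    (hg : DifferentiableOn ℂ g (ball 1 η)) (hg0 : ∀ x ∈ ball (1 : ℂ) η, g x ≠ 0) {N k : ℕ}
    (hk : k + 1 ≤ N) {l : Signature N} {ι : Type*} [Fintype ι] {a : ι → Fin N → ℤ}
    (ha : ∀ u : Fin N → ℂ, (∀ i, u i ≠ 0) → schurFun l u = ∑ s, ∏ i, u i ^ a s i) (b q : ℕ) :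
    torusCoeff (η / 4) b q (slotFun k g fun u => schurFun l (padOne N u)) =
      PowerSeries.coeff q (∑ s, slotForm N k (taylorOne g)⁻¹ b fun i => powSeries (a s i)) := by
  have hδ : 0 < η / 4 := by linarith
  have hcont : ∀ s j, ContinuousOn (Function.uncurry fun w z =>
      ((-1) ^ j * ((k + 1).choose (j + 1) : ℂ)) *
        ((fun x => x ^ a s ⟨0, by omega⟩ * (g x)⁻¹) ((1 + w) * z) * slotProd g (a s) j z))
        (sphere 0 (η / 4) ×ˢ sphere 1 (η / 4)) := fun s j =>
    continuousOn_const.mul (continuousOn_comp_mul hη hη1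
      (differentiableOn_zpow_mul_inv hη1 hg hg0 _).continuousOn
      (differentiableOn_slotProd hη1 hg hg0 _ _).continuousOn)
  have hcont' : ∀ s, ContinuousOn (Function.uncurry fun w z => ∑ j ∈ Finset.range (k + 1),
      ((-1) ^ j * ((k + 1).choose (j + 1) : ℂ)) *
        ((fun x => x ^ a s ⟨0, by omega⟩ * (g x)⁻¹) ((1 + w) * z) * slotProd g (a s) j z))
        (sphere 0 (η / 4) ×ˢ sphere 1 (η / 4)) := fun s =>
    continuousOn_finsetSum _ fun j _ => hcont s j
  rw [torusCoeff_congr hδ.le b q fun w hw z hz => slotFun_eq_sum hη hη1 hk ha hw hz,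
    torusCoeff_sum hδ b q _ fun s _ => hcont' s, map_sum]
  refine Finset.sum_congr rfl fun s _ => ?_
  rw [torusCoeff_sum hδ b q _ fun j _ => hcont s j, slotForm_apply, map_sum]
  refine Finset.sum_congr rfl fun j _ => ?_
  rw [torusCoeff_const_mul, torusCoeff_mul hη hη1 b q (differentiableOn_zpow_mul_inv hη1 hg hg0 _)
    (differentiableOn_slotProd hη1 hg hg0 _ _), map_smul, smul_eq_mul,
    prod_slotMap hη hη1 hg hg0 (by omega)]

theorem slotPoint_mem (hη : 0 < η) (hη1 : η ≤ 1) (k j : ℕ) {w z : ℂ}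
    (hw : w ∈ sphere (0 : ℂ) (η / 4)) (hz : z ∈ sphere (1 : ℂ) (η / 4)) (i : Fin (k + 1)) :
    slotPoint k j w z i ∈ closedBall (1 : ℂ) (3 * η / 4) := by
  have hz' := sphere_subset_closedBall hz
  unfold slotPoint
  split_ifs
  · exact one_add_mul_mem_ball hη hη1 (sphere_subset_closedBall hw) hz'
  · exact closedBall_subset_closedBall (by linarith) hz'
  · exact mem_closedBall_self (by linarith)

theorem norm_slotFun_le (hη : 0 < η) (hη1 : η ≤ 1) {M : ℝ} (hM0 : 0 ≤ M)
    (hM : ∀ x ∈ closedBall (1 : ℂ) (3 * η / 4), ‖(g x)⁻¹‖ ≤ M) {k : ℕ}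
    {S : (Fin (k + 1) → ℂ) → ℂ} {w z : ℂ} (hw : w ∈ sphere (0 : ℂ) (η / 4))
    (hz : z ∈ sphere (1 : ℂ) (η / 4)) {B : ℝ} (hB0 : 0 ≤ B)
    (hB : ∀ j ≤ k, ‖S (slotPoint k j w z)‖ ≤ B) :
    ‖slotFun k g S w z‖ ≤
      (∑ j ∈ Finset.range (k + 1), ((k + 1).choose (j + 1) : ℝ) * M ^ (j + 1)) * B := by
  have h1 := hM _ (one_add_mul_mem_ball hη hη1 (sphere_subset_closedBall hw)
    (sphere_subset_closedBall hz))
  have h2 := hM z (closedBall_subset_closedBall (by linarith) (sphere_subset_closedBall hz))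
  rw [Finset.sum_mul]
  refine (norm_sum_le _ _).trans (Finset.sum_le_sum fun j hj => ?_)
  have hj' : j ≤ k := Nat.lt_succ_iff.mp (Finset.mem_range.mp hj)
  rw [norm_mul, norm_mul, norm_pow, norm_neg, norm_one, one_pow, one_mul, Complex.norm_natCast,
    mul_assoc, div_eq_mul_inv, mul_inv, ← inv_pow, norm_mul, norm_mul, norm_pow]
  refine mul_le_mul_of_nonneg_left ?_ (Nat.cast_nonneg _)
  rw [mul_comm (M ^ (j + 1)), pow_succ' M]
  refine mul_le_mul (hB j hj') (mul_le_mul h1 ?_ (by positivity) hM0) (by positivity) hB0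
  exact pow_le_pow_left₀ (norm_nonneg _) h2 j

end slotProd

/-! ### Summation over signatures. -/

instance (N : ℕ) : Countable (Signature N) :=
  inferInstanceAs (Countable {l : Fin N → ℤ // Antitone l})

theorem hasSum_toReal_pmf {N : ℕ} (ρ : PMF (Signature N)) :
    HasSum (fun l => (ρ l).toReal) 1 := by
  have h := ENNReal.hasSum_toReal (f := ρ) (by rw [PMF.tsum_coe]; exact ENNReal.one_ne_top)
  rw [← ENNReal.tsum_toReal_eq (fun l => ρ.apply_ne_top l), PMF.tsum_coe] at h
  simpa using h

theorem schurGenTerm_eq {N : ℕ} (ρ : PMF (Signature N)) (u : Fin N → ℂ) (l : Signature N) :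
    schurGenTerm ρ u l = (((ρ l).toReal : ℂ) / schurFun l 1) * schurFun l u := by
  rw [schurGenTerm]; ring

theorem norm_schurGenTerm_le {N r : ℕ} (hr : r ≤ N) (ρ : PMF (Signature N)) {δ : ℝ}
    (hδ : δ < 1) {u : Fin r → ℂ} (hu : ∀ i, u i ∈ closedBall (1 : ℂ) δ) (l : Signature N) :
    ‖schurGenTerm ρ (padOne N u) l‖ ≤
      ∑ b : Fin r → Bool, ‖schurGenTerm ρ (padOne N (corner (1 - δ) (1 + δ) b)) l‖ := by
  simp only [schurGenTerm_eq, norm_mul]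
  rw [← Finset.mul_sum]
  refine mul_le_mul_of_nonneg_left (norm_schurFun_le hr l (by linarith) (fun i => ?_)
    fun i => ?_) (norm_nonneg _)
  · have h1 := hu i
    have h2 := norm_sub_norm_le (1 : ℂ) (u i)
    rw [mem_closedBall, dist_eq_norm, norm_sub_rev] at h1
    rw [norm_one] at h2
    linarith
  · have h1 := hu i
    have h2 := norm_sub_norm_le (u i) (1 : ℂ)
    rw [mem_closedBall, dist_eq_norm] at h1
    rw [norm_one] at h2
    linarith

theorem corner_mem_ball {r : ℕ} {δ η : ℝ} (hδ0 : 0 ≤ δ) (hδ : δ < η) (b : Fin r → Bool) :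
    corner (1 - δ) (1 + δ) b ∈ ball (1 : Fin r → ℂ) η := by
  rw [mem_ball, dist_pi_lt_iff (hδ0.trans_lt hδ)]
  intro i
  have : corner (1 - δ) (1 + δ) b i - 1 = ((if b i then -δ else δ : ℝ) : ℂ) := by
    unfold corner
    split_ifs <;> push_cast <;> ring
  rw [Pi.one_apply, dist_eq_norm, this, Complex.norm_real, Real.norm_eq_abs]
  split_ifs
  · rwa [abs_neg, abs_of_nonneg hδ0]
  · rwa [abs_of_nonneg hδ0]

section slotFun
variable {η : ℝ} {g : ℂ → ℂ} {N k : ℕ} {ρ : PMF (Signature N)}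

theorem slotFun_const_mul (c : ℂ) (S : (Fin (k + 1) → ℂ) → ℂ) (w z : ℂ) :
    slotFun k g (fun u => c * S u) w z = c * slotFun k g S w z := by
  rw [slotFun, slotFun, Finset.mul_sum]
  exact Finset.sum_congr rfl fun j _ => by ring

/-- The inverse of `g` is bounded on a compact ball, and all slot points lie in the polydisc of
radius `3 * η / 4`, whose corner values dominate and are summable. -/
theorem exists_slotFun_bound (hη : 0 < η) (hη1 : η ≤ 1) (hg : DifferentiableOn ℂ g (ball 1 η))
    (hg0 : ∀ x ∈ ball (1 : ℂ) η, g x ≠ 0) (hk : k + 1 ≤ N)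
    (hs : ∀ u ∈ ball (1 : Fin (k + 1) → ℂ) η, Summable (schurGenTerm ρ (padOne N u))) :
    ∃ B : Signature N → ℝ, Summable B ∧ ∀ l, ∀ w ∈ sphere (0 : ℂ) (η / 4),
      ∀ z ∈ sphere (1 : ℂ) (η / 4),
        ‖slotFun k g (fun u => schurGenTerm ρ (padOne N u) l) w z‖ ≤ B l := by
  have hsub : closedBall (1 : ℂ) (3 * η / 4) ⊆ ball 1 η := closedBall_subset_ball (by linarith)
  obtain ⟨M, hM⟩ := (isCompact_closedBall (1 : ℂ) (3 * η / 4)).exists_bound_of_continuousOn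
    ((hg.continuousOn.mono hsub).inv₀ fun x hx => hg0 x (hsub hx))
  have hM0 : 0 ≤ M := (norm_nonneg _).trans (hM 1 (mem_closedBall_self (by linarith)))
  refine ⟨fun l => (∑ j ∈ Finset.range (k + 1), ((k + 1).choose (j + 1) : ℝ) * M ^ (j + 1)) *
    ∑ b : Fin (k + 1) → Bool,
      ‖schurGenTerm ρ (padOne N (corner (1 - 3 * η / 4) (1 + 3 * η / 4) b)) l‖, ?_, ?_⟩
  · refine Summable.mul_left _ (summable_sum fun b _ => ?_)
    exact (hs _ (corner_mem_ball (by linarith) (by linarith) b)).norm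
  · intro l w hw z hz
    refine norm_slotFun_le hη hη1 hM0 hM hw hz (Finset.sum_nonneg fun _ _ => norm_nonneg _) ?_
    intro j _
    exact norm_schurGenTerm_le hk ρ (by linarith) (fun i => slotPoint_mem hη hη1 k j hw hz i) l

theorem hasSum_slotFun (hη : 0 < η) (hη1 : η ≤ 1)
    (hs : ∀ u ∈ ball (1 : Fin (k + 1) → ℂ) η, Summable (schurGenTerm ρ (padOne N u)))
    {w z : ℂ} (hw : w ∈ sphere (0 : ℂ) (η / 4)) (hz : z ∈ sphere (1 : ℂ) (η / 4)) :
    HasSum (fun l => slotFun k g (fun u => schurGenTerm ρ (padOne N u) l) w z)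
      (slotFun k g (fun u => schurGen ρ (padOne N u)) w z) := by
  refine hasSum_sum fun j _ => HasSum.mul_left _ (HasSum.div_const ?_ _)
  refine (hs _ ?_).hasSum
  rw [mem_ball, dist_pi_lt_iff hη]
  exact fun i => mem_ball.mp (closedBall_subset_ball (by linarith)
    (slotPoint_mem hη hη1 k j hw hz i))

theorem continuousOn_slotFun_schurGenTerm (hη : 0 < η) (hη1 : η ≤ 1)
    (hg : DifferentiableOn ℂ g (ball 1 η)) (hg0 : ∀ x ∈ ball (1 : ℂ) η, g x ≠ 0)
    (hk : k + 1 ≤ N) (l : Signature N) :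
    ContinuousOn (Function.uncurry (slotFun k g fun u => schurGenTerm ρ (padOne N u) l))
      (sphere 0 (η / 4) ×ˢ sphere 1 (η / 4)) := by
  simp only [schurGenTerm_eq]
  have : (slotFun k g fun u => ((ρ l).toReal : ℂ) / schurFun l 1 * schurFun l (padOne N u)) =
      fun w z => ((ρ l).toReal : ℂ) / schurFun l 1 *
        slotFun k g (fun u => schurFun l (padOne N u)) w z := by
    ext w z; rw [slotFun_const_mul]
  rw [this]
  exact continuousOn_const.mul (continuousOn_slotFun_schurFun hη hη1 hg hg0 hk l)

/-- Subtracting the constant `ρ l` from each term does not affect coefficients with `b ≠ 0`; in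
total it subtracts `1`, so that the limit becomes small when `S / ∏ g` is close to `1`. -/
theorem hasSum_torusCoeff_slotFun (hη : 0 < η) (hη1 : η ≤ 1)
    (hg : DifferentiableOn ℂ g (ball 1 η)) (hg0 : ∀ x ∈ ball (1 : ℂ) η, g x ≠ 0) (hk : k + 1 ≤ N)
    (hs : ∀ u ∈ ball (1 : Fin (k + 1) → ℂ) η, Summable (schurGenTerm ρ (padOne N u))) {b : ℕ}
    (hb : b ≠ 0) (q : ℕ) :
    HasSum (fun l => torusCoeff (η / 4) b q
        (slotFun k g fun u => schurGenTerm ρ (padOne N u) l))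
      (torusCoeff (η / 4) b q
        fun w z => slotFun k g (fun u => schurGen ρ (padOne N u)) w z - 1) := by
  have hδ : 0 < η / 4 := by linarith
  obtain ⟨B, hB, hBl⟩ := exists_slotFun_bound hη hη1 hg hg0 hk hs
  have hρ := hasSum_toReal_pmf ρ
  have hρ' : HasSum (fun l => ((ρ l).toReal : ℂ)) 1 := by
    simpa using Complex.hasSum_ofReal.mpr hρ
  have hc := fun l => continuousOn_slotFun_schurGenTerm (ρ := ρ) hη hη1 hg hg0 hk l
  have hc1 : ∀ l, ContinuousOn (Function.uncurry fun _ _ : ℂ => ((ρ l).toReal : ℂ) * 1)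
      (sphere (0 : ℂ) (η / 4) ×ˢ sphere (1 : ℂ) (η / 4)) := fun l => continuousOn_const
  have h1 := hasSum_torusCoeff hδ b q
    (F := fun l w z => slotFun k g (fun u => schurGenTerm ρ (padOne N u) l) w z -
      ((ρ l).toReal : ℂ) * 1)
    (G := fun w z => slotFun k g (fun u => schurGen ρ (padOne N u)) w z - 1)
    (B := fun l => B l + (ρ l).toReal)
    (fun l => (hc l).sub (hc1 l)) (fun l w hw z hz => ?_) (hB.add hρ.summable)
    (fun w hw z hz => (hasSum_slotFun hη hη1 hs hw hz).sub (by simpa using hρ'))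
  · have h2 : ∀ l, torusCoeff (η / 4) b q (fun w z =>
        slotFun k g (fun u => schurGenTerm ρ (padOne N u) l) w z - ((ρ l).toReal : ℂ) * 1) =
        torusCoeff (η / 4) b q (slotFun k g fun u => schurGenTerm ρ (padOne N u) l) := fun l => by
      rw [torusCoeff_sub hδ b q (hc l) (hc1 l), torusCoeff_const_mul, torusCoeff_one hδ hb,
        mul_zero, sub_zero]
    simpa only [h2] using h1
  · refine (norm_sub_le _ _).trans (add_le_add (hBl l w hw z hz) ?_)
    rw [mul_one, Complex.norm_of_nonneg ENNReal.toReal_nonneg]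

theorem hasSum_errorTerm {ι : Type*} (N k : ℕ) (g : PowerSeries ℂ) {B : ι → ℕ → PowerSeries ℂ}
    {B' : ℕ → PowerSeries ℂ} (h : ∀ b ≠ 0, ∀ q,
      HasSum (fun l => PowerSeries.coeff q (B l b)) (PowerSeries.coeff q (B' b))) :
    HasSum (fun l => errorTerm N k g (B l)) (errorTerm N k g B') := by
  refine hasSum_sum fun p _ => HasSum.mul_left _ (hasSum_sum fun q _ => ?_)
  split_ifs with hq
  · exact hasSum_zero
  · simp only [PowerSeries.coeff_mul _ _ (B' _), PowerSeries.coeff_mul _ _ (B _ _)]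
    exact hasSum_sum fun r _ => HasSum.mul_left _ (h _ hq _)

theorem errorTerm_const_mul (N k : ℕ) (g : PowerSeries ℂ) (c : ℂ) {B B' : ℕ → PowerSeries ℂ}
    (h : ∀ b q, PowerSeries.coeff q (B b) = c * PowerSeries.coeff q (B' b)) :
    errorTerm N k g B = c * errorTerm N k g B' := by
  have h' : ∀ b, B b = PowerSeries.C c * B' b := fun b => by
    ext q; rw [h, PowerSeries.coeff_C_mul]
  simp only [errorTerm, Finset.mul_sum, h']
  refine Finset.sum_congr rfl fun p _ => Finset.sum_congr rfl fun q _ => ?_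
  split_ifs
  · simp
  · rw [mul_left_comm _ (PowerSeries.C c), PowerSeries.coeff_C_mul]
    ring

/-- The identity for one signature, multiplied by `ρ l` and divided by the dimension, which is the
number of monomials. -/
theorem mul_sum_binom_eq (hη : 0 < η) (hη1 : η ≤ 1) (hg : DifferentiableOn ℂ g (ball 1 η))
    (hg0 : ∀ x ∈ ball (1 : ℂ) η, g x ≠ 0) (hg1 : g 1 = 1) (hk : k + 1 ≤ N) (l : Signature N) :
    ((ρ l).toReal : ℂ) * ∑ j, binom (l.coord j) k =
      ((ρ l).toReal : ℂ) * mainTerm N k (taylorOne g) +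
        errorTerm N k (taylorOne g) fun b => PowerSeries.mk fun q => torusCoeff (η / 4) b q
          (slotFun k g fun u => schurGenTerm ρ (padOne N u) l) := by
  obtain ⟨ι, hι, hne, a, ha⟩ := exists_schurFun_eq_sum l
  have hcard : schurFun l 1 = (Fintype.card ι : ℂ) := by
    rw [ha 1 (by simp)]; simp
  have hcard0 : (Fintype.card ι : ℂ) ≠ 0 := by exact_mod_cast Fintype.card_ne_zero
  have h1 := sum_binom_mul_card_eq hk l a ha (g := taylorOne g)
    (by rw [constantCoeff_taylorOne, hg1])
  have h2 := errorTerm_const_mul N k (taylorOne g) (((ρ l).toReal : ℂ) / schurFun l 1)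
    (B := fun b => PowerSeries.mk fun q => torusCoeff (η / 4) b q
          (slotFun k g fun u => schurGenTerm ρ (padOne N u) l))
    (B' := fun b => ∑ s, slotForm N k (taylorOne g)⁻¹ b fun i => powSeries (a s i))
    (fun b q => by
      rw [← torusCoeff_slotFun_schurFun hη hη1 hg hg0 hk ha, PowerSeries.coeff_mk,
        ← torusCoeff_const_mul]
      congr 1
      ext w z
      rw [← slotFun_const_mul]
      simp only [schurGenTerm_eq])
  rw [h2, hcard, eq_sub_of_add_eq' h1.symm]
  field_simp
  ring

/-- The expectation of `∑_j binom(l_j + N - j, k)` in terms of the Schur generating function. -/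
theorem hasSum_binom (hη : 0 < η) (hη1 : η ≤ 1) (hg : DifferentiableOn ℂ g (ball 1 η))
    (hg0 : ∀ x ∈ ball (1 : ℂ) η, g x ≠ 0) (hg1 : g 1 = 1) (hk : k + 1 ≤ N)
    (hs : ∀ u ∈ ball (1 : Fin (k + 1) → ℂ) η, Summable (schurGenTerm ρ (padOne N u))) :
    HasSum (fun l => ((ρ l).toReal : ℂ) * ∑ j, binom (l.coord j) k)
      (mainTerm N k (taylorOne g) + errorTerm N k (taylorOne g) fun b => PowerSeries.mk fun q =>
        torusCoeff (η / 4) b q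
          fun w z => slotFun k g (fun u => schurGen ρ (padOne N u)) w z - 1) := by
  have hρ' : HasSum (fun l => ((ρ l).toReal : ℂ)) 1 := by
    simpa using Complex.hasSum_ofReal.mpr (hasSum_toReal_pmf ρ)
  simp only [mul_sum_binom_eq hη hη1 hg hg0 hg1 hk]
  refine HasSum.add ?_ (hasSum_errorTerm N k _ fun b hb q => ?_)
  · simpa using hρ'.mul_right (mainTerm N k (taylorOne g))
  · simpa only [PowerSeries.coeff_mk] using hasSum_torusCoeff_slotFun hη hη1 hg hg0 hk hs hb q

end slotFun

/-! ### Two-term asymptotic expansions in N. -/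

/-- `f N = α N ^ d + β N ^ (d - 1) + o(N ^ (d - 1))`. -/
def HasExp (f : ℕ → ℂ) (d : ℕ) (α β : ℂ) : Prop :=
  Tendsto (fun N : ℕ => (N : ℂ) * (f N / (N : ℂ) ^ d - α)) atTop (𝓝 β)

namespace HasExp

variable {f g : ℕ → ℂ} {d e : ℕ} {α β α' β' : ℂ}

theorem congr' (h : HasExp f d α β) (hfg : f =ᶠ[atTop] g) : HasExp g d α β :=
  Tendsto.congr' (hfg.mono fun N hN => by rw [hN]) h

theorem tendsto (h : HasExp f d α β) :
    Tendsto (fun N : ℕ => f N / (N : ℂ) ^ d) atTop (𝓝 α) := by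
  have h1 := (tendsto_inv_atTop_nhds_zero_nat (𝕜 := ℂ)).mul h
  rw [zero_mul] at h1
  have h2 := h1.add_const α
  rw [zero_add] at h2
  refine h2.congr' ?_
  filter_upwards [eventually_ne_atTop 0] with N hN
  have : (N : ℂ) ≠ 0 := by exact_mod_cast hN
  rw [inv_mul_cancel_left₀ this, sub_add_cancel]

theorem add (hf : HasExp f d α β) (hg : HasExp g d α' β') :
    HasExp (fun N => f N + g N) d (α + α') (β + β') :=
  (Tendsto.add hf hg).congr fun N => by ring

theorem mul (hf : HasExp f d α β) (hg : HasExp g e α' β') :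
    HasExp (fun N => f N * g N) (d + e) (α * α') (β * α' + α * β') := by
  refine ((Tendsto.mul hf hg.tendsto).add (Tendsto.const_mul α hg)).congr fun N => ?_
  rw [pow_add, ← div_mul_div_comm]
  ring

theorem const (c : ℂ) : HasExp (fun _ => c) 0 c 0 := by
  simp [HasExp]

theorem const_mul (c : ℂ) (hf : HasExp f d α β) :
    HasExp (fun N => c * f N) d (c * α) (c * β) :=
  (Tendsto.const_mul c hf).congr fun N => by ring

theorem zero : HasExp (fun _ => 0) d 0 0 := by
  simp [HasExp]

theorem sum {ι : Type*} (s : Finset ι) {f : ι → ℕ → ℂ} {α β : ι → ℂ}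
    (h : ∀ i ∈ s, HasExp (f i) d (α i) (β i)) :
    HasExp (fun N => ∑ i ∈ s, f i N) d (∑ i ∈ s, α i) (∑ i ∈ s, β i) := by
  classical
  induction s using Finset.induction_on with
  | empty => simpa using HasExp.zero
  | insert i s hi ih =>
    simp only [Finset.sum_insert hi]
    exact (h i (Finset.mem_insert_self _ _)).add
      (ih fun j hj => h j (Finset.mem_insert_of_mem hj))

theorem succ (hf : HasExp f d α β) : HasExp f (d + 1) 0 α := by
  refine hf.tendsto.congr' ?_
  filter_upwards [eventually_ne_atTop 0] with N hN
  have : (N : ℂ) ≠ 0 := by exact_mod_cast hN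
  rw [pow_succ]
  field_simp
  ring

theorem of_lt (hf : HasExp f d α β) (h : d < e) :
    HasExp f e 0 (if e = d + 1 then α else 0) := by
  induction e, h using Nat.le_induction with
  | base => simpa using hf.succ
  | succ e he ih =>
    have := ih.succ
    rwa [if_neg (by omega)]

theorem zero_of_le (hf : HasExp f d 0 0) (h : d ≤ e) : HasExp f e 0 0 := by
  rcases h.eq_or_lt with rfl | h
  · exact hf
  · simpa using hf.of_lt h

theorem linear (a b : ℂ) : HasExp (fun N => (N : ℂ) * a + b) 1 a b := by
  refine tendsto_const_nhds.congr' ?_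
  filter_upwards [eventually_ne_atTop 0] with N hN
  have : (N : ℂ) ≠ 0 := by exact_mod_cast hN
  field_simp
  ring

theorem mul_little (hf : HasExp f d α β) {r : ℕ → ℂ} (hr : Tendsto r atTop (𝓝 0)) :
    HasExp (fun N => f N * r N) (d + 1) 0 0 := by
  have h := hf.tendsto.mul hr
  rw [mul_zero] at h
  refine h.congr' ?_
  filter_upwards [eventually_ne_atTop 0] with N hN
  have : (N : ℂ) ≠ 0 := by exact_mod_cast hN
  rw [pow_succ]
  field_simp
  ring

/-- The falling factorial has roots `0, …, n - 1`, with sum `n (n - 1) / 2`. -/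
theorem choose (n : ℕ) : HasExp (fun N => (N.choose n : ℂ)) n (1 / (n.factorial : ℂ))
    (-((n : ℂ) * (n - 1) / 2) / (n.factorial : ℂ)) := by
  induction n with
  | zero => simpa using const 1
  | succ n ih =>
    have hn : ((n : ℂ) + 1) ≠ 0 := by exact_mod_cast Nat.succ_ne_zero n
    have hf : ((n.factorial : ℕ) : ℂ) ≠ 0 := by exact_mod_cast Nat.factorial_ne_zero n
    have h := (ih.mul (linear 1 (-(n : ℂ)))).const_mul (1 / ((n : ℂ) + 1))
    have e : (fun N : ℕ => 1 / ((n : ℂ) + 1) * ((N.choose n : ℂ) * ((N : ℂ) * 1 + -(n : ℂ)))) =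
        fun N => (N.choose (n + 1) : ℂ) := by
      ext N
      have h1 := Nat.choose_succ_right_eq N n
      rw [one_div, inv_mul_eq_iff_eq_mul₀ hn]
      by_cases hnN : n ≤ N
      · have h2 : ((N.choose (n + 1) * (n + 1) : ℕ) : ℂ) = ((N.choose n * (N - n) : ℕ) : ℂ) := by
          rw [h1]
        push_cast [Nat.cast_sub hnN] at h2
        linear_combination -h2
      · rw [Nat.choose_eq_zero_of_lt (by omega), Nat.choose_eq_zero_of_lt (by omega)]
        simp
    rw [e] at h
    convert h using 1
    · rw [Nat.factorial_succ]; push_cast; field_simp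
    · rw [Nat.factorial_succ]; push_cast; field_simp; ring

end HasExp

/-- Coefficientwise `HasExp`. -/
def SeriesHasExp (F : ℕ → PowerSeries ℂ) (d : ℕ) (A B : PowerSeries ℂ) : Prop :=
  ∀ i, HasExp (fun N => PowerSeries.coeff i (F N)) d (PowerSeries.coeff i A)
    (PowerSeries.coeff i B)

namespace SeriesHasExp

variable {F G : ℕ → PowerSeries ℂ} {d e : ℕ} {A B A' B' : PowerSeries ℂ}

theorem add (hF : SeriesHasExp F d A B) (hG : SeriesHasExp G d A' B') :
    SeriesHasExp (fun N => F N + G N) d (A + A') (B + B') := fun i => by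
  simpa only [map_add] using (hF i).add (hG i)

theorem mul (hF : SeriesHasExp F d A B) (hG : SeriesHasExp G e A' B') :
    SeriesHasExp (fun N => F N * G N) (d + e) (A * A') (B * A' + A * B') := fun i => by
  simp only [map_add, PowerSeries.coeff_mul, ← Finset.sum_add_distrib]
  exact HasExp.sum _ fun p _ => (hF p.1).mul (hG p.2)

theorem const (A : PowerSeries ℂ) : SeriesHasExp (fun _ => A) 0 A 0 := fun i => by
  simpa using HasExp.const (PowerSeries.coeff i A)

theorem const_mul (A' : PowerSeries ℂ) (hF : SeriesHasExp F d A B) :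
    SeriesHasExp (fun N => A' * F N) d (A' * A) (A' * B) := by
  simpa using (const A').mul hF

theorem succ (hF : SeriesHasExp F d A B) : SeriesHasExp F (d + 1) 0 A := fun i => by
  simpa using (hF i).succ

theorem derivative (hF : SeriesHasExp F d A B) :
    SeriesHasExp (fun N => PowerSeries.derivative ℂ (F N)) d (PowerSeries.derivative ℂ A)
      (PowerSeries.derivative ℂ B) := fun i => by
  simp only [PowerSeries.coeff_derivative, mul_comm _ ((i : ℂ) + 1)]
  exact (hF (i + 1)).const_mul _

theorem linear (p q : PowerSeries ℂ) :
    SeriesHasExp (fun N => PowerSeries.C (N : ℂ) * p + q) 1 p q := fun i => by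
  simpa only [map_add, PowerSeries.coeff_C_mul] using HasExp.linear _ _

theorem coeff_mul_little (hF : SeriesHasExp F d A B) {E : ℕ → PowerSeries ℂ}
    (hE : ∀ i, Tendsto (fun N => PowerSeries.coeff i (E N)) atTop (𝓝 0)) (i : ℕ) :
    HasExp (fun N => PowerSeries.coeff i (F N * E N)) (d + 1) 0 0 := by
  simp only [PowerSeries.coeff_mul]
  simpa using HasExp.sum (Finset.HasAntidiagonal.antidiagonal i) fun p _ =>
    (hF p.1).mul_little (hE p.2)

end SeriesHasExp

theorem mul_derivative_pow (p : PowerSeries ℂ) (b : ℕ) :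
    ((b : PowerSeries ℂ) + 1) * (p * PowerSeries.derivative ℂ (p ^ b)) =
      b * PowerSeries.derivative ℂ (p ^ (b + 1)) := by
  rw [PowerSeries.derivative_pow, PowerSeries.derivative_pow]
  rcases b with _ | b
  · simp
  · simp only [Nat.add_sub_cancel]
    push_cast
    ring

/-- The expansion of the logarithmic-type derivatives of series with `G' = (N p + φ) G`. -/
theorem seriesHasExp_hasseD {G : ℕ → PowerSeries ℂ} {p φ : PowerSeries ℂ}
    (hG : ∀ N, PowerSeries.constantCoeff (G N) = 1)
    (hD : ∀ N, PowerSeries.derivative ℂ (G N) = (PowerSeries.C (N : ℂ) * p + φ) * G N) (b : ℕ) :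
    SeriesHasExp (fun N => hasseD b (G N) * (G N)⁻¹) b
      (PowerSeries.C (1 / (b.factorial : ℂ)) * p ^ b)
      (PowerSeries.C (b / (b.factorial : ℂ)) * (p ^ (b - 1) * φ +
        PowerSeries.C (1 / 2) * PowerSeries.derivative ℂ (p ^ (b - 1)))) := by
  have hGG : ∀ N, G N * (G N)⁻¹ = 1 := fun N =>
    PowerSeries.mul_inv_cancel _ (by rw [hG]; exact one_ne_zero)
  induction b with
  | zero => simpa [hasseD_zero, hGG] using SeriesHasExp.const 1
  | succ b ih =>
    have hb : ((b : ℂ) + 1) ≠ 0 := by exact_mod_cast Nat.succ_ne_zero b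
    -- Writing the `b`-th normalised derivative as `y * G` and differentiating, the equation for
    -- `G'` gives `(b + 1) y_{b+1} = y_b' + y_b (N p + φ)`. Here `y_b'` is one degree lower in `N`
    -- and enters only the subleading coefficient.
    have hrec : ∀ N, hasseD (b + 1) (G N) * (G N)⁻¹ = PowerSeries.C (1 / ((b : ℂ) + 1)) *
        (PowerSeries.derivative ℂ (hasseD b (G N) * (G N)⁻¹) +
          hasseD b (G N) * (G N)⁻¹ * (PowerSeries.C (N : ℂ) * p + φ)) := by
      intro N
      set y := hasseD b (G N) * (G N)⁻¹ with hy
      have h1 : hasseD b (G N) = y * G N := by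
        rw [hy, mul_assoc, mul_comm (G N)⁻¹, hGG, mul_one]
      have h2 := derivative_hasseD b (G N)
      rw [h1, Derivation.leibniz, hD, smul_eq_mul, smul_eq_mul] at h2
      have h3 : hasseD (b + 1) (G N) = PowerSeries.C (1 / ((b : ℂ) + 1)) *
          (y * ((PowerSeries.C (N : ℂ) * p + φ) * G N) +
            G N * PowerSeries.derivative ℂ y) := by
        rw [h2, Algebra.smul_def, ← mul_assoc]
        change _ = PowerSeries.C _ * PowerSeries.C _ * _
        rw [← map_mul]
        push_cast
        rw [one_div_mul_cancel hb, map_one, one_mul]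
      rw [h3]
      linear_combination (PowerSeries.C (1 / ((b : ℂ) + 1)) *
        (y * (PowerSeries.C (N : ℂ) * p + φ) + PowerSeries.derivative ℂ y)) * hGG N
    have h := ((ih.derivative.succ).add (ih.mul (SeriesHasExp.linear p φ))).const_mul
      (PowerSeries.C (1 / ((b : ℂ) + 1)))
    simp only [← hrec] at h
    have hf : ((b.factorial : ℕ) : ℂ) ≠ 0 := by exact_mod_cast Nat.factorial_ne_zero b
    have e1 : (1 / (((b + 1).factorial : ℕ) : ℂ)) = 1 / ((b : ℂ) + 1) * (1 / (b.factorial : ℂ)) := by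
      rw [Nat.factorial_succ]; push_cast; field_simp
    have e2 : (((b + 1 : ℕ) : ℂ) / (((b + 1).factorial : ℕ) : ℂ)) = 1 / (b.factorial : ℂ) := by
      rw [Nat.factorial_succ]; push_cast; field_simp
    convert h using 1
    · rw [e1, map_mul]; ring
    · rw [e2, Nat.add_sub_cancel]
      set c := PowerSeries.C (1 / (b.factorial : ℂ)) with hc
      set c' := PowerSeries.C (1 / ((b : ℂ) + 1)) with hc'
      have e3 : PowerSeries.C ((b : ℂ) / (b.factorial : ℂ)) = (b : PowerSeries ℂ) * c := by
        rw [hc, ← map_natCast (PowerSeries.C (R := ℂ)), ← map_mul]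
        congr 1; ring
      have e4 : c' * ((b : PowerSeries ℂ) + 1) = 1 := by
        rw [hc', ← map_natCast (PowerSeries.C (R := ℂ)), ← map_one (PowerSeries.C (R := ℂ)),
          ← map_add, ← map_mul, one_div_mul_cancel hb]
      have e5 : PowerSeries.derivative ℂ (c * p ^ b) = c * PowerSeries.derivative ℂ (p ^ b) := by
        rw [Derivation.leibniz, hc, PowerSeries.derivative_C]; simp
      have e6 : (2 : PowerSeries ℂ) * PowerSeries.C (1 / 2 : ℂ) = 1 := by
        rw [← map_ofNat (PowerSeries.C (R := ℂ)), ← map_mul]; norm_num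
      rw [e3, e5]
      rcases b with _ | b
      · simp only [pow_zero, Nat.cast_zero, zero_add, zero_mul, PowerSeries.derivative_one,
          mul_zero, add_zero, one_mul, mul_one] at e4 ⊢
        rw [e4, one_mul]
      · have e7 := mul_derivative_pow p b
        simp only [Nat.add_sub_cancel]
        push_cast at e4 e7 ⊢
        linear_combination (-(c * (p ^ (b + 1) * φ))- c * PowerSeries.C (1 / 2) *
          PowerSeries.derivative ℂ (p ^ (b + 1))) * e4 - (c * c' *
          PowerSeries.C (1 / 2)) * e7 + (c * c' * PowerSeries.derivative ℂ (p ^ (b + 1))) * e6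

/-! ### Expansion of the main term and size of the error term. -/

/-- The leading coefficient of the main term. -/
def leadCoeff (p : PowerSeries ℂ) (k : ℕ) : ℂ :=
  ∑ r ∈ Finset.HasAntidiagonal.antidiagonal k, 1 / ((r.2 + 1).factorial : ℂ) *
    PowerSeries.coeff r.2 ((1 + PowerSeries.X) ^ k *
      (PowerSeries.C (1 / (r.1.factorial : ℂ)) * p ^ r.1))

/-- The subleading coefficient of the main term. -/
def subleadCoeff (p φ : PowerSeries ℂ) (k : ℕ) : ℂ :=
  ∑ r ∈ Finset.HasAntidiagonal.antidiagonal k,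
    (-(((r.2 + 1 : ℕ) : ℂ) * (((r.2 + 1 : ℕ) : ℂ) - 1) / 2) / ((r.2 + 1).factorial : ℂ) *
      PowerSeries.coeff r.2 ((1 + PowerSeries.X) ^ k *
        (PowerSeries.C (1 / (r.1.factorial : ℂ)) * p ^ r.1)) +
    1 / ((r.2 + 1).factorial : ℂ) * PowerSeries.coeff r.2 ((1 + PowerSeries.X) ^ k *
      (PowerSeries.C (r.1 / (r.1.factorial : ℂ)) * (p ^ (r.1 - 1) * φ +
        PowerSeries.C (1 / 2) * PowerSeries.derivative ℂ (p ^ (r.1 - 1))))))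

theorem hasExp_mainTerm {G : ℕ → PowerSeries ℂ} {p φ : PowerSeries ℂ}
    (hG : ∀ N, PowerSeries.constantCoeff (G N) = 1)
    (hD : ∀ N, PowerSeries.derivative ℂ (G N) = (PowerSeries.C (N : ℂ) * p + φ) * G N) (k : ℕ) :
    HasExp (fun N => mainTerm N k (G N)) (k + 1) (leadCoeff p k) (subleadCoeff p φ k) := by
  refine HasExp.sum _ fun r hr => ?_
  have hr' := Finset.HasAntidiagonal.mem_antidiagonal.mp hr
  have h := (HasExp.choose (r.2 + 1)).mul
    ((seriesHasExp_hasseD hG hD r.1).const_mul ((1 + PowerSeries.X) ^ k) r.2)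
  rwa [show r.2 + 1 + r.1 = k + 1 by omega] at h

/-- Every summand has `q.2 ≥ 1`, so its growth is at most `N ^ (p.2 + 1 + q.1)` with exponent at
most `k`. The factor tending to zero makes it `o(N ^ k)`, below the subleading order. -/
theorem hasExp_errorTerm {G : ℕ → PowerSeries ℂ} {p φ : PowerSeries ℂ}
    (hG : ∀ N, PowerSeries.constantCoeff (G N) = 1)
    (hD : ∀ N, PowerSeries.derivative ℂ (G N) = (PowerSeries.C (N : ℂ) * p + φ) * G N)
    {B : ℕ → ℕ → PowerSeries ℂ}
    (hB : ∀ b q, Tendsto (fun N => PowerSeries.coeff q (B N b)) atTop (𝓝 0)) (k : ℕ) :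
    HasExp (fun N => errorTerm N k (G N) (B N)) (k + 1) 0 0 := by
  have h : HasExp (fun N => errorTerm N k (G N) (B N)) (k + 1)
      (∑ r ∈ Finset.HasAntidiagonal.antidiagonal k, 0)
      (∑ r ∈ Finset.HasAntidiagonal.antidiagonal k, 0) := by
    refine HasExp.sum _ fun r hr => ?_
    have hr' := Finset.HasAntidiagonal.mem_antidiagonal.mp hr
    have h1 : HasExp (fun N => ∑ q ∈ Finset.HasAntidiagonal.antidiagonal r.1, if q.2 = 0 then 0 else
      PowerSeries.coeff r.2
        ((1 + PowerSeries.X) ^ (r.2 + q.1) * (hasseD q.1 (G N) * (G N)⁻¹) * B N q.2)) r.1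
        (∑ q ∈ Finset.HasAntidiagonal.antidiagonal r.1, 0)
        (∑ q ∈ Finset.HasAntidiagonal.antidiagonal r.1, 0) := by
      refine HasExp.sum _ fun q hq => ?_
      have hq' := Finset.HasAntidiagonal.mem_antidiagonal.mp hq
      split_ifs with hq2
      · exact HasExp.zero
      · exact (((seriesHasExp_hasseD hG hD q.1).const_mul _).coeff_mul_little (hB q.2)
          r.2).zero_of_le (by omega)
    have h2 := (HasExp.choose (r.2 + 1)).mul h1
    rw [show r.2 + 1 + r.1 = k + 1 by omega] at h2
    simpa using h2
  simpa using h

/-! ### From binomial coefficients to powers. -/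

/-- The coefficients of `x ^ k` in the basis of binomial coefficients. -/
def powCoeff : ℕ → ℕ → ℂ
  | 0, i => if i = 0 then 1 else 0
  | k + 1, i => i * powCoeff k (i - 1) + i * powCoeff k i

theorem powCoeff_eq_zero {k i : ℕ} (h : k < i) : powCoeff k i = 0 := by
  induction k generalizing i with
  | zero => simp [powCoeff, h.ne']
  | succ k ih => rw [powCoeff, ih (by omega), ih (by omega)]; simp

theorem powCoeff_self (k : ℕ) : powCoeff k k = (k.factorial : ℂ) := by
  induction k with
  | zero => simp [powCoeff]
  | succ k ih =>
    rw [powCoeff, Nat.add_sub_cancel, ih, powCoeff_eq_zero (by omega), Nat.factorial_succ]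
    push_cast; ring

/-- `powCoeff k i` is `i!` times a Stirling number of the second kind, and `S(k + 1, k) = k (k + 1)
/ 2`. -/
theorem powCoeff_succ_self (k : ℕ) :
    powCoeff (k + 1) k = ((k : ℂ) + 1) * k / 2 * (k.factorial : ℂ) := by
  induction k with
  | zero => simp [powCoeff]
  | succ k ih =>
    rw [powCoeff, Nat.add_sub_cancel, ih, powCoeff_self, Nat.factorial_succ]
    push_cast; ring

theorem mul_binom (x : ℂ) (i : ℕ) :
    x * binom x i = ((i : ℂ) + 1) * binom x (i + 1) + i * binom x i := by
  have hi : ((i : ℂ) + 1) ≠ 0 := by exact_mod_cast Nat.succ_ne_zero i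
  have hf : ((i.factorial : ℕ) : ℂ) ≠ 0 := by exact_mod_cast Nat.factorial_ne_zero i
  rw [binom, binom, Finset.prod_range_succ, Nat.factorial_succ]
  push_cast
  field_simp
  ring

theorem pow_eq_sum_binom (x : ℂ) (k : ℕ) :
    x ^ k = ∑ i ∈ Finset.range (k + 1), powCoeff k i * binom x i := by
  induction k with
  | zero => simp [powCoeff, binom]
  | succ k ih =>
    rw [pow_succ', ih, Finset.mul_sum]
    have h1 : ∀ i, x * (powCoeff k i * binom x i) =
        ((i : ℂ) + 1) * powCoeff k i * binom x (i + 1) + i * powCoeff k i * binom x i := fun i => by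
      rw [mul_left_comm, mul_binom]; ring
    simp only [h1, powCoeff, add_mul, Finset.sum_add_distrib]
    congr 1
    -- The term of index `0` carries a factor `0`, so the truncated `i - 1` in the recursion does no
    -- harm.
    · rw [Finset.sum_range_succ' _ (k + 1)]
      simp [add_mul, Finset.sum_add_distrib]
    · rw [Finset.sum_range_succ _ (k + 1), powCoeff_eq_zero (Nat.lt_succ_self k)]
      simp

/-! ### Vanishing of the error under the asymptotic hypothesis. -/

theorem prod_apply_slotPoint {k j : ℕ} (hj : j ≤ k) {g : ℂ → ℂ} (hg1 : g 1 = 1) (w z : ℂ) :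
    ∏ i, g (slotPoint k j w z i) = g ((1 + w) * z) * g z ^ j := by
  rw [Fin.prod_univ_succ]
  have h : ∀ i : Fin k, g (slotPoint k j w z i.succ) = if (i : ℕ) < j then g z else 1 := fun i => by
    simp only [slotPoint, Fin.val_succ, Nat.add_eq_zero_iff, one_ne_zero, and_false, if_false,
      Nat.succ_le_iff, apply_ite g, hg1]
  simp only [h]
  rw [Fin.prod_univ_eq_prod_range (fun i => if i < j then g z else 1) k, ← Finset.prod_filter,
    Finset.prod_const]
  have hc : (Finset.range k).filter (· < j) = Finset.range j := by
    ext i; simp only [Finset.mem_filter, Finset.mem_range]; omega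
  rw [hc, Finset.card_range]
  simp [slotPoint]

/-- The coefficients of the alternating sum add up to `1`, so the deviation of `slotFun` from `1` is
controlled by that of `S / ∏ g`. -/
theorem slotFun_sub_one {k : ℕ} {g : ℂ → ℂ} (hg1 : g 1 = 1) (S : (Fin (k + 1) → ℂ) → ℂ)
    (w z : ℂ) :
    slotFun k g S w z - 1 = ∑ j ∈ Finset.range (k + 1), ((-1) ^ j * ((k + 1).choose (j + 1) : ℂ)) *
      (S (slotPoint k j w z) / ∏ i, g (slotPoint k j w z i) - 1) := by
  have h := mul_sum_neg_one_pow_choose k (1 : ℂ)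
  simp only [one_pow, mul_one, one_mul, sub_self, ne_eq, Nat.succ_ne_zero, not_false_eq_true,
    zero_pow, sub_zero] at h
  simp only [mul_sub, mul_one, Finset.sum_sub_distrib, h, slotFun]
  congr 1
  refine Finset.sum_congr rfl fun j hj => ?_
  rw [prod_apply_slotPoint (Nat.lt_succ_iff.mp (Finset.mem_range.mp hj)) hg1]

theorem tendsto_torusCoeff_slotFun {η : ℝ} (hη : 0 < η) (hη1 : η ≤ 1) {k : ℕ} {g : ℕ → ℂ → ℂ}
    (hg1 : ∀ N, g N 1 = 1) {S : ℕ → (Fin (k + 1) → ℂ) → ℂ}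
    (hS : TendstoUniformlyOn (fun N u => S N u / ∏ i, g N (u i)) (fun _ => 1) atTop
      (ball 1 η)) (b q : ℕ) :
    Tendsto (fun N => torusCoeff (η / 4) b q fun w z => slotFun k (g N) (S N) w z - 1) atTop
      (𝓝 0) := by
  have hR : 0 < η / 4 := by linarith
  set A : ℝ := ∑ j ∈ Finset.range (k + 1), ‖((-1) ^ j * ((k + 1).choose (j + 1) : ℂ))‖ with hA
  have hA0 : 0 ≤ A := Finset.sum_nonneg fun _ _ => norm_nonneg _
  rw [Metric.tendsto_atTop']
  intro ε hε
  set P : ℝ := (η / 4) ^ b * (η / 4) ^ q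
  have hP : 0 < P := by positivity
  obtain ⟨δ, hδ, hδε⟩ : ∃ δ : ℝ, 0 < δ ∧ A * δ / P < ε := by
    refine ⟨ε * P / (A + 1), by positivity, ?_⟩
    rw [div_lt_iff₀ hP, mul_div_assoc', div_lt_iff₀ (by linarith)]
    nlinarith [mul_pos hε hP]
  obtain ⟨M, hM⟩ := eventually_atTop.mp (Metric.tendstoUniformlyOn_iff.mp hS δ hδ)
  refine ⟨M, fun N hN => ?_⟩
  rw [dist_zero_right]
  refine lt_of_le_of_lt (norm_torusCoeff_le hR b q (B := A * δ) fun w hw z hz => ?_) ?_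
  · rw [slotFun_sub_one (hg1 N), hA, Finset.sum_mul]
    refine (norm_sum_le _ _).trans (Finset.sum_le_sum fun j _ => ?_)
    rw [norm_mul]
    refine mul_le_mul_of_nonneg_left ?_ (norm_nonneg _)
    have hu : slotPoint k j w z ∈ ball (1 : Fin (k + 1) → ℂ) η := by
      rw [mem_ball, dist_pi_lt_iff hη]
      intro i
      have := slotPoint_mem hη hη1 k j hw hz i
      rw [mem_closedBall] at this
      simpa using lt_of_le_of_lt this (by linarith)
    have h := hM N hN.le _ hu
    rw [dist_comm, dist_eq_norm] at h
    exact h.le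
  · rwa [div_div]

theorem tendstoUniformlyOn_div_prod_exp {r : ℕ} {U V : Set (Fin r → ℂ)} (hV : V ⊆ U)
    {S L : ℕ → (Fin r → ℂ) → ℂ} {Ψ Φ : ℂ → ℂ}
    (hL : ∀ᶠ N in atTop, ∀ u ∈ U, Complex.exp (L N u) = S N u)
    (h : TendstoUniformlyOn
        (fun (N : ℕ) (u : Fin r → ℂ) => (N : ℂ) * ((1 / (N : ℂ)) * L N u - ∑ i, Ψ (u i)))
        (fun u => ∑ i, Φ (u i)) atTop U) :
    TendstoUniformlyOn
      (fun (N : ℕ) u => S N u / ∏ i, Complex.exp ((N : ℂ) * Ψ (u i) + Φ (u i)))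
      (fun _ => 1) atTop V := by
  rw [Metric.tendstoUniformlyOn_iff] at h ⊢
  intro ε hε
  -- The bound `1` on the exponent allows `‖exp x - 1‖ ≤ 2 ‖x‖`, and `2 ε / 3 < ε`.
  have hδ : 0 < min 1 (ε / 3) := by positivity
  filter_upwards [h _ hδ, hL, eventually_gt_atTop (0 : ℕ)] with N h1 h2 hN u hu
  have hN' : (N : ℂ) ≠ 0 := by exact_mod_cast hN.ne'
  have h3 := h1 u (hV hu)
  rw [dist_comm, dist_eq_norm] at h3 ⊢
  set x := (N : ℂ) * ((1 / (N : ℂ)) * L N u - ∑ i, Ψ (u i)) - ∑ i, Φ (u i) with hx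
  have hx' : x = L N u - ∑ i, ((N : ℂ) * Ψ (u i) + Φ (u i)) := by
    rw [hx, Finset.sum_add_distrib, ← Finset.mul_sum]
    field_simp
    ring
  rw [← Complex.exp_sum, ← h2 u (hV hu), ← Complex.exp_sub, ← hx']
  have h3' : ‖x‖ < min 1 (ε / 3) := h3
  have h4 := Complex.norm_exp_sub_one_le (x := x) (h3'.le.trans (min_le_left _ _))
  have h5 : ‖x‖ < ε / 3 := h3'.trans_le (min_le_right _ _)
  linarith

/-- At `u = 1` in one variable the logarithm vanishes, so `-N Ψ(1)` converges to `Φ(1)`, which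
forces both to be zero. This normalises the reference function `exp (N Ψ + Φ)` to `1` at `1`. -/
theorem LogAsymptotics.map_one {ρ : (N : ℕ) → PMF (Signature N)} {Ψ Φ : ℂ → ℂ}
    (h : LogAsymptotics ρ Ψ Φ) : Ψ 1 = 0 ∧ Φ 1 = 0 := by
  obtain ⟨U, -, -, h1, L, hL, hu⟩ := h 1
  have h2 := hu.tendsto_at h1
  have h3 : Tendsto (fun N : ℕ => (N : ℂ) * -Ψ 1) atTop (𝓝 (Φ 1)) := by
    have h2' := h2.congr' (f₂ := fun N : ℕ => (N : ℂ) * -Ψ 1) (by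
      filter_upwards [hL] with N hN
      simp [hN.2.map_one])
    simpa using h2'
  have h4 : Ψ 1 = 0 := by
    have h5 := (tendsto_inv_atTop_nhds_zero_nat (𝕜 := ℂ)).mul h3
    rw [zero_mul] at h5
    have h6 : Tendsto (fun N : ℕ => (N : ℂ)⁻¹ * ((N : ℂ) * -Ψ 1)) atTop (𝓝 (-Ψ 1)) := by
      refine tendsto_const_nhds.congr' ?_
      filter_upwards [eventually_gt_atTop 0] with N hN
      have hN' : (N : ℂ) ≠ 0 := by exact_mod_cast hN.ne'
      field_simp
    simpa using tendsto_nhds_unique h6 h5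
  refine ⟨h4, ?_⟩
  simp only [h4, neg_zero, mul_zero] at h3
  exact (tendsto_nhds_unique h3 tendsto_const_nhds)

theorem derivative_taylorOne_exp {Ψ Φ : ℂ → ℂ} (hΨ : AnalyticAt ℂ Ψ 1) (hΦ : AnalyticAt ℂ Φ 1)
    (c : ℂ) :
    PowerSeries.derivative ℂ (taylorOne fun z => Complex.exp (c * Ψ z + Φ z)) =
      (PowerSeries.C c * taylorOne (deriv Ψ) + taylorOne (deriv Φ)) *
        taylorOne fun z => Complex.exp (c * Ψ z + Φ z) := by
  have hf : AnalyticAt ℂ (fun z => c * Ψ z + Φ z) 1 := (analyticAt_const.mul hΨ).add hΦ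
  have hc : AnalyticAt ℂ (fun z => c * deriv Ψ z) 1 := analyticAt_const.mul hΨ.deriv
  have hd : AnalyticAt ℂ (fun z => c * deriv Ψ z + deriv Φ z) 1 := hc.add hΦ.deriv
  have he : AnalyticAt ℂ (fun z => Complex.exp (c * Ψ z + Φ z)) 1 := hf.cexp
  rw [derivative_taylorOne, ← taylorOne_const_mul c hΨ.deriv, ← taylorOne_add hc hΦ.deriv,
    ← taylorOne_mul hd he]
  refine taylorOne_congr ?_
  filter_upwards [hΨ.eventually_analyticAt, hΦ.eventually_analyticAt] with z h1 h2
  have h3 := ((h1.differentiableAt.hasDerivAt.const_mul c).add h2.differentiableAt.hasDerivAt).cexp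
  rw [mul_comm]
  exact h3.deriv

theorem exists_hasExp_binom {ρ : (N : ℕ) → PMF (Signature N)} {Ψ Φ : ℂ → ℂ}
    (hΨ : AnalyticAt ℂ Ψ 1) (hΦ : AnalyticAt ℂ Φ 1) (h : LogAsymptotics ρ Ψ Φ) (k : ℕ) :
    ∃ E : ℕ → ℂ, HasExp E (k + 1) (leadCoeff (taylorOne (deriv Ψ)) k)
        (subleadCoeff (taylorOne (deriv Ψ)) (taylorOne (deriv Φ)) k) ∧
      ∀ᶠ N in atTop, HasSum (fun l : Signature N =>
        ((ρ N l).toReal : ℂ) * ∑ j, binom (l.coord j) k) (E N) := by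
  obtain ⟨hΨ1, hΦ1⟩ := h.map_one
  obtain ⟨U, hUo, -, h1U, L, hL, hu⟩ := h (k + 1)
  obtain ⟨ε, hε, hεU⟩ := Metric.isOpen_iff.mp hUo 1 h1U
  obtain ⟨δ, hδ, hδa⟩ := Metric.eventually_nhds_iff_ball.mp
    (hΨ.eventually_analyticAt.and hΦ.eventually_analyticAt)
  -- The bound `1` keeps the ball away from `0`, `ε` keeps the polydisc inside `U`, and `δ` ensures
  -- that `Ψ` and `Φ` are analytic.
  set η : ℝ := min 1 (min ε δ)
  have hη : 0 < η := by positivity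
  have hη1 : η ≤ 1 := min_le_left _ _
  have hVU : ball (1 : Fin (k + 1) → ℂ) η ⊆ U :=
    (ball_subset_ball ((min_le_right _ _).trans (min_le_left _ _))).trans hεU
  have hηδ : ball (1 : ℂ) η ⊆ ball 1 δ :=
    ball_subset_ball ((min_le_right _ _).trans (min_le_right _ _))
  set g : ℕ → ℂ → ℂ := fun N z => Complex.exp ((N : ℂ) * Ψ z + Φ z) with hg
  have hg1 : ∀ N, g N 1 = 1 := fun N => by simp [hg, hΨ1, hΦ1]
  have hgd : ∀ N, DifferentiableOn ℂ (g N) (ball 1 η) := fun N z hz =>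
    (((hδa z (hηδ hz)).1.differentiableAt.const_mul _).add
      (hδa z (hηδ hz)).2.differentiableAt).cexp.differentiableWithinAt
  have hg0 : ∀ N, ∀ x ∈ ball (1 : ℂ) η, g N x ≠ 0 := fun N x _ => Complex.exp_ne_zero _
  have hunif := tendstoUniformlyOn_div_prod_exp hVU (hL.mono fun N hN => hN.2.exp_eq) hu
  have hG : ∀ N, PowerSeries.constantCoeff (taylorOne (g N)) = 1 := fun N => by
    rw [constantCoeff_taylorOne, hg1]
  have hD := fun N : ℕ => derivative_taylorOne_exp hΨ hΦ (N : ℂ)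
  refine ⟨fun N => mainTerm N k (taylorOne (g N)) + errorTerm N k (taylorOne (g N)) fun b =>
    PowerSeries.mk fun q => torusCoeff (η / 4) b q fun w z =>
      slotFun k (g N) (fun u => schurGen (ρ N) (padOne N u)) w z - 1, ?_, ?_⟩
  · have hm := (hasExp_mainTerm hG hD k).add (hasExp_errorTerm hG hD
      (B := fun N b => PowerSeries.mk fun q => torusCoeff (η / 4) b q fun w z =>
        slotFun k (g N) (fun u => schurGen (ρ N) (padOne N u)) w z - 1)
      (fun b q => by
        simpa only [PowerSeries.coeff_mk] using
          tendsto_torusCoeff_slotFun hη hη1 hg1 hunif b q) k)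
    rw [add_zero, add_zero] at hm
    exact hm
  · filter_upwards [hL, eventually_ge_atTop (k + 1)] with N hN hk
    exact hasSum_binom hη hη1 (hgd N) (hg0 N) (hg1 N) hk fun u hu => hN.1 u (hVU hu)

theorem exists_hasExp_pow {ρ : (N : ℕ) → PMF (Signature N)} {Ψ Φ : ℂ → ℂ}
    (hΨ : AnalyticAt ℂ Ψ 1) (hΦ : AnalyticAt ℂ Φ 1) (h : LogAsymptotics ρ Ψ Φ) (k : ℕ) :
    ∃ E : ℕ → ℂ, HasExp E (k + 1) (powCoeff k k * leadCoeff (taylorOne (deriv Ψ)) k)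
        (powCoeff k k * subleadCoeff (taylorOne (deriv Ψ)) (taylorOne (deriv Φ)) k +
          ∑ i ∈ Finset.range k, powCoeff k i *
            if k + 1 = i + 1 + 1 then leadCoeff (taylorOne (deriv Ψ)) i else 0) ∧
      ∀ᶠ N in atTop, HasSum (fun l : Signature N =>
        ((ρ N l).toReal : ℂ) * ∑ j, (l.coord j : ℂ) ^ k) (E N) := by
  choose E hE hs using exists_hasExp_binom hΨ hΦ h
  refine ⟨fun N => ∑ i ∈ Finset.range (k + 1), powCoeff k i * E i N, ?_, ?_⟩
  -- The expectation with index `i` has degree `i + 1`, so among lower indices only `i = k - 1`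
  -- reaches the subleading order, through its leading coefficient.
  · have h1 : HasExp (fun N => ∑ i ∈ Finset.range k, powCoeff k i * E i N) (k + 1)
        (∑ i ∈ Finset.range k, powCoeff k i * 0) _ :=
      HasExp.sum _ fun i hi => ((hE i).of_lt
        (by have := Finset.mem_range.mp hi; omega)).const_mul (powCoeff k i)
    have h2 := ((hE k).const_mul (powCoeff k k)).add h1
    simp only [mul_zero, Finset.sum_const_zero, add_zero] at h2
    refine h2.congr' (Eventually.of_forall fun N => ?_)
    exact ((Finset.sum_range_succ _ _).trans (add_comm _ _)).symm
  · filter_upwards [(Finset.range (k + 1)).eventually_all.mpr fun i _ => hs i] with N hN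
    have h1 := hasSum_sum fun i hi => (hN i hi).mul_left (powCoeff k i)
    refine h1.congr_fun fun l => ?_
    simp only [pow_eq_sum_binom, Finset.mul_sum]
    rw [Finset.sum_comm]
    exact Finset.sum_congr rfl fun i _ => Finset.sum_congr rfl fun j _ => by ring

/-! ### Identification of the moments. -/

theorem iteratedDeriv_eq_coeff_taylorOne (n : ℕ) (f : ℂ → ℂ) :
    iteratedDeriv n f 1 = n.factorial * PowerSeries.coeff n (taylorOne f) := by
  rw [coeff_taylorOne, mul_div_cancel₀ _ (Nat.cast_ne_zero.mpr n.factorial_ne_zero)]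

theorem taylorOne_pow_mul {f : ℂ → ℂ} (hf : AnalyticAt ℂ f 1) (k : ℕ) :
    taylorOne (fun x => x ^ k * f x) = (1 + PowerSeries.X) ^ k * taylorOne f := by
  have h1 : AnalyticAt ℂ (fun x : ℂ => x ^ k) 1 := analyticAt_id.fun_pow k
  rw [taylorOne_mul h1 hf, taylorOne_pow (f := fun x => x) analyticAt_id, taylorOne_id]

theorem limitMoment_eq {Ψ : ℂ → ℂ} (hΨ : AnalyticAt ℂ Ψ 1) (k : ℕ) :
    limitMoment Ψ k = k.factorial * leadCoeff (taylorOne (deriv Ψ)) k := by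
  rw [limitMoment, leadCoeff, ← Finset.Nat.sum_antidiagonal_swap,
    Finset.Nat.sum_antidiagonal_eq_sum_range_succ_mk, Finset.mul_sum]
  refine Finset.sum_congr rfl fun m _ => ?_
  have h1 : AnalyticAt ℂ (fun x => deriv Ψ x ^ (k - m)) 1 := hΨ.deriv.fun_pow _
  have h2 := Nat.cast_ne_zero (R := ℂ).mpr m.factorial_ne_zero
  rw [iteratedDeriv_eq_coeff_taylorOne, taylorOne_pow_mul h1, taylorOne_pow hΨ.deriv,
    mul_left_comm _ (PowerSeries.C _), PowerSeries.coeff_C_mul]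
  simp only [Prod.fst_swap, Prod.snd_swap]
  field_simp

theorem taylorOne_correction {Ψ Φ : ℂ → ℂ} (hΨ : AnalyticAt ℂ Ψ 1) (hΦ : AnalyticAt ℂ Φ 1)
    (k b : ℕ) :
    taylorOne (fun x => x ^ (k + 1) * (deriv Φ x - 1 / (2 * x)) * deriv Ψ x ^ b) =
      (1 + PowerSeries.X) ^ (k + 1) * (taylorOne (deriv Ψ) ^ b * taylorOne (deriv Φ)) +
        PowerSeries.C (-1 / 2) * ((1 + PowerSeries.X) ^ k * taylorOne (deriv Ψ) ^ b) := by
  have h1 : AnalyticAt ℂ (fun x => deriv Ψ x ^ b) 1 := hΨ.deriv.fun_pow _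
  have h2 : AnalyticAt ℂ (fun x => deriv Ψ x ^ b * deriv Φ x) 1 := h1.mul hΦ.deriv
  have h3 : ∀ n, AnalyticAt ℂ (fun x : ℂ => x ^ n) 1 := fun n => analyticAt_id.fun_pow n
  have h4 : AnalyticAt ℂ (fun x => x ^ (k + 1) * (deriv Ψ x ^ b * deriv Φ x)) 1 := (h3 _).mul h2
  have h5 : AnalyticAt ℂ (fun x => x ^ k * deriv Ψ x ^ b) 1 := (h3 _).mul h1
  have h6 : AnalyticAt ℂ (fun x => -1 / 2 * (x ^ k * deriv Ψ x ^ b)) 1 := analyticAt_const.mul h5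
  rw [← taylorOne_pow hΨ.deriv, ← taylorOne_mul h1 hΦ.deriv, ← taylorOne_pow_mul h2,
    ← taylorOne_pow_mul h1, ← taylorOne_const_mul _ h5, ← taylorOne_add h4 h6]
  refine taylorOne_congr ?_
  filter_upwards [eventually_ne_nhds (one_ne_zero (α := ℂ))] with x hx
  field_simp
  ring

theorem derivative_one_add_X_pow_mul (k : ℕ) (F : PowerSeries ℂ) :
    PowerSeries.derivative ℂ ((1 + PowerSeries.X) ^ (k + 1) * F) =
      (1 + PowerSeries.X) ^ (k + 1) * PowerSeries.derivative ℂ F +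
        PowerSeries.C ((k : ℂ) + 1) * ((1 + PowerSeries.X) ^ k * F) := by
  rw [Derivation.leibniz, Derivation.leibniz_pow]
  simp
  ring

/-- The subleading part of `binom(N, q + 1)` involves a coefficient of degree one higher, which is
rewritten through a derivative. By the product rule the derivative of `p ^ b` cancels against the
one in the expansion of `hasseD`, leaving only the derivative of `(1 + X) ^ (k + 1)`. -/
theorem subleadCoeff_succ (p φ : PowerSeries ℂ) (k : ℕ) :
    subleadCoeff p φ (k + 1) = ∑ r ∈ Finset.HasAntidiagonal.antidiagonal k,
      1 / ((r.2 + 1).factorial * r.1.factorial : ℂ) *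
        (PowerSeries.coeff r.2 ((1 + PowerSeries.X) ^ (k + 1) * (p ^ r.1 * φ)) -
          ((k : ℂ) + 1) / 2 * PowerSeries.coeff r.2 ((1 + PowerSeries.X) ^ k * p ^ r.1)) := by
  rw [subleadCoeff, Finset.sum_add_distrib, Finset.Nat.sum_antidiagonal_succ',
    Finset.Nat.sum_antidiagonal_succ]
  simp only [zero_add, Nat.cast_one, sub_self, mul_zero, zero_div, neg_zero, zero_mul,
    Nat.cast_zero, map_zero, Nat.add_sub_cancel]
  rw [← Finset.sum_add_distrib]
  refine Finset.sum_congr rfl fun r _ => ?_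
  have h := congrArg (PowerSeries.coeff r.2) (derivative_one_add_X_pow_mul k (p ^ r.1))
  rw [PowerSeries.coeff_derivative, map_add, PowerSeries.coeff_C_mul] at h
  have h1 := Nat.cast_ne_zero (R := ℂ).mpr r.1.factorial_ne_zero
  have h2 := Nat.cast_ne_zero (R := ℂ).mpr r.2.factorial_ne_zero
  have h3 : ((r.2 : ℂ) + 1) ≠ 0 := by exact_mod_cast Nat.succ_ne_zero r.2
  have h4 : ((r.2 : ℂ) + 1 + 1) ≠ 0 := by exact_mod_cast Nat.succ_ne_zero (r.2 + 1)
  have h5 : ((r.1 : ℂ) + 1) ≠ 0 := by exact_mod_cast Nat.succ_ne_zero r.1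
  have hC : ∀ (c : ℂ) (n : ℕ) (F : PowerSeries ℂ),
      PowerSeries.coeff n ((1 + PowerSeries.X) ^ (k + 1) * (PowerSeries.C c * F)) =
        c * PowerSeries.coeff n ((1 + PowerSeries.X) ^ (k + 1) * F) := fun c n F => by
    rw [mul_left_comm, PowerSeries.coeff_C_mul]
  simp only [hC, mul_add, map_add, Nat.factorial_succ]
  push_cast
  rw [eq_div_of_mul_eq h3 h]
  field_simp
  ring

/-- For the exponent `k + 1` the main term contributes `-(k + 1) / 2` and the passage from binomials
to powers `k / 2`, both in front of `(1 + X) ^ k p ^ b`; the sum `-1/2` is the term `-1 / (2x)`. -/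
theorem correctionMoment_eq {Ψ Φ : ℂ → ℂ} (hΨ : AnalyticAt ℂ Ψ 1) (hΦ : AnalyticAt ℂ Φ 1)
    (k : ℕ) :
    correctionMoment Ψ Φ k =
      powCoeff k k * subleadCoeff (taylorOne (deriv Ψ)) (taylorOne (deriv Φ)) k +
          ∑ i ∈ Finset.range k, powCoeff k i *
            if k + 1 = i + 1 + 1 then leadCoeff (taylorOne (deriv Ψ)) i else 0 := by
  rcases k with _ | k
  · simp [correctionMoment, subleadCoeff]
  have h1 : ∀ i, (k + 1 + 1 = i + 1 + 1) = (i = k) := fun i => by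
    rw [eq_iff_iff]; omega
  simp only [h1, mul_ite, mul_zero]
  rw [Finset.sum_ite_eq', if_pos (Finset.self_mem_range_succ k), powCoeff_self,
    powCoeff_succ_self, subleadCoeff_succ, leadCoeff, Finset.mul_sum, Finset.mul_sum,
    ← Finset.sum_add_distrib, ← Finset.Nat.sum_antidiagonal_swap,
    Finset.Nat.sum_antidiagonal_eq_sum_range_succ_mk, correctionMoment]
  refine Finset.sum_congr rfl fun m _ => ?_
  have h2 := Nat.cast_ne_zero (R := ℂ).mpr m.factorial_ne_zero
  have h3 := Nat.cast_ne_zero (R := ℂ).mpr (m + 1).factorial_ne_zero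
  have h4 := Nat.cast_ne_zero (R := ℂ).mpr (k - m).factorial_ne_zero
  rw [iteratedDeriv_eq_coeff_taylorOne, show k + 1 - m - 1 = k - m by omega,
    taylorOne_correction hΨ hΦ, map_add, PowerSeries.coeff_C_mul, Nat.factorial_succ k]
  have hC : ∀ (c : ℂ) (n : ℕ) (F : PowerSeries ℂ),
      PowerSeries.coeff n ((1 + PowerSeries.X) ^ k * (PowerSeries.C c * F)) =
        c * PowerSeries.coeff n ((1 + PowerSeries.X) ^ k * F) := fun c n F => by
    rw [mul_left_comm, PowerSeries.coeff_C_mul]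
  simp only [Prod.fst_swap, Prod.snd_swap, hC]
  push_cast
  field_simp
  ring

theorem powerSum_eq {N : ℕ} (k : ℕ) (l : Signature N) :
    powerSum k l = (∑ j, (l.coord j : ℝ) ^ k) / (N : ℝ) ^ k := by
  simp only [powerSum, div_pow, Finset.sum_div]

theorem hasSum_powerSum {N k : ℕ} {ρ : PMF (Signature N)} {E : ℂ}
    (h : HasSum (fun l : Signature N => ((ρ l).toReal : ℂ) * ∑ j, (l.coord j : ℂ) ^ k) E) :
    HasSum (fun l => (((ρ l).toReal * powerSum k l : ℝ) : ℂ)) (E / (N : ℂ) ^ k) := by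
  refine (h.div_const ((N : ℂ) ^ k)).congr_fun fun l => ?_
  rw [powerSum_eq]
  push_cast
  ring

end SchurGF

end

theorem mainTheorem2
    (ρ : (N : ℕ) → PMF (SchurGF.Signature N)) (Ψ Φ : ℂ → ℂ)
    (hΨ : AnalyticAt ℂ Ψ 1) (hΦ : AnalyticAt ℂ Φ 1)
    (hρ : SchurGF.LogAsymptotics ρ Ψ Φ) (k : ℕ) :
    (∀ᶠ N : ℕ in atTop, Summable (fun l : SchurGF.Signature N =>
      (ρ N l).toReal * SchurGF.powerSum k l)) ∧
    Tendsto
      (fun N : ℕ => (N : ℂ) *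
        ((1 / (N : ℂ)) * (((∑' l : SchurGF.Signature N,
          (ρ N l).toReal * SchurGF.powerSum k l) : ℝ) : ℂ) - SchurGF.limitMoment Ψ k))
      atTop (𝓝 (SchurGF.correctionMoment Ψ Φ k)) := by
  obtain ⟨E, hE, hs⟩ := SchurGF.exists_hasExp_pow hΨ hΦ hρ k
  rw [← SchurGF.correctionMoment_eq hΨ hΦ, SchurGF.powCoeff_self,
    ← SchurGF.limitMoment_eq hΨ] at hE
  refine ⟨hs.mono fun N hN => Complex.summable_ofReal.mp (SchurGF.hasSum_powerSum hN).summable,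
    Tendsto.congr' ?_ hE⟩
  filter_upwards [hs] with N hN
  rw [Complex.ofReal_tsum, (SchurGF.hasSum_powerSum hN).tsum_eq]
  ring
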